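/- **Setting.** Let $\Sigma$ be a (Hausdorff) surface of class $C^6$, $\nabla$ a torsion-free affine connection of class $C^4$ on $\Sigma$, and $\epsilon_{ab}$ a volume form on $\Sigma$ (of class at least $C^2$); $\epsilon^{ab}$ is defined by $\epsilon^{ab}\epsilon_{cb}=\delta^a_c$, and $V^a=\epsilon^{ab}V_b$, $V_a=\epsilon_{ba}V^b$. A *linear first integral* on an open set $U$ is a $C^1$ one-form $K$ on $U$ with $\nabla_{(a}K_{b)}=0$; "admits" means admits one that is not identically zero, and "precisely $k$ independent" means that the real vector space of all of them has dimension $k$. With $[\nabla_a,\nabla_b]X^c=R_{ab}{}^c{}_dX^d$ and $R_{ab}=R_{ca}{}^c{}_b$ put $$P_{ab}=\tfrac23R_{ab}+\tfrac13R_{ba},\quad B_{ab}=P_{ba}-P_{ab},\quad \beta=B_{ab}\epsilon^{ab},\quad \theta_a=\tfrac12\epsilon^{bc}\nabla_a\epsilon_{bc},\quad Y_{cdb}=\nabla_{[c}P_{d]b},\quad L_b=\epsilon^{cd}\nabla_cP_{db},$$ $$F^a=\tfrac13\epsilon^{ab}\big(L_b-\epsilon^{cd}\nabla_bB_{cd}\big),\qquad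 N_a=-F_a+\epsilon^{bc}\nabla_aB_{bc},$$ $$M_a{}^b=\tfrac13\epsilon^{bc}\epsilon^{de}\big(\nabla_aY_{dec}-\nabla_a\nabla_cB_{de}\big)+\beta P^b{}_a+\tfrac12\beta^2\delta^b_a,$$ $$I_N=\epsilon_{cd}\epsilon^{be}M_e{}^c\big(N_bF^d-\tfrac12\beta M_b{}^d\big),\qquad T_a{}^b=N_aF^b-\beta M_a{}^b .$$ Let $D$ be the connection $D_a(K_b,\mu)=\big(\nabla_aK_b-\epsilon_{ab}\mu,\ \nabla_a\mu-(P^b{}_a+\tfrac12\beta\delta^b_a)K_b+\mu\theta_a\big)$ on $\Lambda^1(\Sigma)\oplus\Lambda^2(\Sigma)$, let $D$ also denote the dual connection, coupled with $\nabla$, let $V=(F^1,F^2,\beta)$, a section of the dual bundle, and let $I_S$ be $W_{abc}=\det\big(V,\,D_aV,\,D_{(b}D_{c)}V\big)$. Finally let $\mathcal M$ be the $3\times3$ matrix with rows $(F^1,F^2,\beta)$ and $(M_a{}^1,M_a{}^2,N_a)$, $a=1,2$; a point of $\Sigma$ is *regular* if the rank of $\mathcal M$ is constant in a neighbourhood of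 it. The connection is *projectively flat* on $U$ if near each point of $U$ there is a $C^1$ one-form $\Upsilon$ such that the connection $\Gamma^a_{bc}+\delta^a_b\Upsilon_c+\delta^a_c\Upsilon_b$ is flat. **Theorem.** 1. If $U\subset\Sigma$ is open and connected (for instance $U=\Sigma$ when $\Sigma$ is connected) and $\nabla$ admits a linear first integral on $U$, then $I_N=0$ and $I_S=0$ on $U$. 2. The regular points form a dense open subset of $\Sigma$. 3. Every point $p\in\Sigma$ has arbitrarily small connected open neighbourhoods $U$ such that the following hold. * If $p$ is regular and $I_N=I_S=0$ on $U$, then $\nabla$ admits a linear first integral on $U$. * If there are precisely two independent linear first integrals on $U$, then $T=0$ on $U$ and the skew part of the Ricci tensor of $\nabla$ is not identically zero on $U$. If $p$ is regular, the converse holds as well. At every $p$, regular or not, there are precisely two if $T=0$ on $U$ and the skew part of the Ricci tensor vanishes at no point of $U$. * There are precisely three independent linear first integrals on $U$ if and only if $\nabla$ is projectively flat on $U$ and its Ricci tensor is symmetric on $U$. -/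

import Mathlib

open scoped Manifold ContDiff Topology Bundle

noncomputable section

namespace SurfaceConnection

/-- The model of a surface. -/
abbrev Plane : Type := EuclideanSpace ℝ (Fin 2)

/-! ### Local tensor calculus

In a coordinate chart a torsion-free connection is given by its Christoffel symbols
`Γ a b c = Γ_{ab}^c`, functions on the plane, and a volume form `ε_{ab}` by its single
component `w = ε_{12}`.  Coordinate indices run over `Fin 2`. -/

section Local

/-- Christoffel symbols: `Γ a b c y` is `Γ_{ab}^c` at the point with coordinates `y`. -/
abbrev Symbols : Type := Fin 2 → Fin 2 → Fin 2 → Plane → ℝ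

/-- The partial derivative `∂_a f`. -/
def pd (a : Fin 2) (f : Plane → ℝ) (y : Plane) : ℝ :=
  fderiv ℝ f y (EuclideanSpace.single a 1)

/-- The Kronecker delta. -/
def delta (a b : Fin 2) : ℝ := if a = b then 1 else 0

/-- The permutation symbol with value `1` at `(0, 1)` and `-1` at `(1, 0)`. -/
def perm (a b : Fin 2) : ℝ := if a = b then 0 else if a < b then 1 else -1

variable (Γ : Symbols) (w : Plane → ℝ)

/-- The covariant derivative `∇_a S_{bc}`. -/
def nabla₂ (S : Fin 2 → Fin 2 → Plane → ℝ) (a b c : Fin 2) (y : Plane) : ℝ :=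
  pd a (S b c) y - ∑ d, (Γ a b d y * S d c y + Γ a c d y * S b d y)

/-- The covariant derivative `∇_a S_{bcd}`. -/
def nabla₃ (S : Fin 2 → Fin 2 → Fin 2 → Plane → ℝ) (a b c d : Fin 2) (y : Plane) : ℝ :=
  pd a (S b c d) y -
    ∑ f, (Γ a b f y * S f c d y + Γ a c f y * S b f d y + Γ a d f y * S b c f y)

/-- The curvature `R_{ab}{}^c{}_d`, with `[∇_a, ∇_b] X^c = R_{ab}{}^c{}_d X^d`. -/
def riem (a b c d : Fin 2) (y : Plane) : ℝ :=
  pd a (Γ b d c) y - pd b (Γ a d c) y +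
    ∑ f, (Γ a f c y * Γ b d f y - Γ b f c y * Γ a d f y)

/-- The Ricci tensor `R_{ab} = R_{ca}{}^c{}_b`. -/
def ricci (a b : Fin 2) (y : Plane) : ℝ := ∑ c, riem Γ c a c b y

/-- The Schouten tensor `P_{ab} = (2/3) R_{ab} + (1/3) R_{ba}`. -/
def schouten (a b : Fin 2) (y : Plane) : ℝ :=
  2 / 3 * ricci Γ a b y + 1 / 3 * ricci Γ b a y

/-- `B_{ab} = P_{ba} - P_{ab}`. -/
def skewB (a b : Fin 2) (y : Plane) : ℝ := schouten Γ b a y - schouten Γ a b y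

/-- The volume form `ε_{ab}`. -/
def epsLow (a b : Fin 2) (y : Plane) : ℝ := perm a b * w y

/-- `ε^{ab}`, characterised by `ε^{ab} ε_{cb} = δ^a_c` wherever `w ≠ 0`. -/
def epsUp (a b : Fin 2) (y : Plane) : ℝ := perm a b / w y

/-- `θ_a = (1/2) ε^{bc} ∇_a ε_{bc}`. -/
def theta (a : Fin 2) (y : Plane) : ℝ :=
  1 / 2 * ∑ b, ∑ c, epsUp w b c y * nabla₂ Γ (epsLow w) a b c y

/-- `β = B_{ab} ε^{ab}`. -/
def beta (y : Plane) : ℝ := ∑ a, ∑ b, skewB Γ a b y * epsUp w a b y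

/-- `P^b{}_a = ε^{bc} P_{ca}`. -/
def schoutenUp (b a : Fin 2) (y : Plane) : ℝ := ∑ c, epsUp w b c y * schouten Γ c a y

/-- `L_b = ε^{cd} ∇_c P_{db}`. -/
def cottonL (b : Fin 2) (y : Plane) : ℝ :=
  ∑ c, ∑ d, epsUp w c d y * nabla₂ Γ (schouten Γ) c d b y

/-- The Cotton tensor `Y_{cdb} = ∇_{[c} P_{d]b}`. -/
def cottonY (c d b : Fin 2) (y : Plane) : ℝ :=
  1 / 2 * (nabla₂ Γ (schouten Γ) c d b y - nabla₂ Γ (schouten Γ) d c b y)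

/-- `F^a = (1/3) ε^{ab} (L_b - ε^{cd} ∇_b B_{cd})`. -/
def vecF (a : Fin 2) (y : Plane) : ℝ :=
  1 / 3 * ∑ b, epsUp w a b y *
    (cottonL Γ w b y - ∑ c, ∑ d, epsUp w c d y * nabla₂ Γ (skewB Γ) b c d y)

/-- `F_a = ε_{ba} F^b`. -/
def vecFLow (a : Fin 2) (y : Plane) : ℝ := ∑ b, epsLow w b a y * vecF Γ w b y

/-- `M_a{}^b = (1/3) ε^{bc} ε^{de} (∇_a Y_{dec} - ∇_a ∇_c B_{de}) + β P^b{}_a + (1/2) β² δ^b_a`;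
the first argument is the lower index. -/
def tensM (a b : Fin 2) (y : Plane) : ℝ :=
  1 / 3 * (∑ c, ∑ d, ∑ e, epsUp w b c y * epsUp w d e y *
      (nabla₃ Γ (cottonY Γ) a d e c y - nabla₃ Γ (nabla₂ Γ (skewB Γ)) a c d e y)) +
    beta Γ w y * schoutenUp Γ w b a y + 1 / 2 * beta Γ w y ^ 2 * delta a b

/-- `N_a = - F_a + ε^{bc} ∇_a B_{bc}`. -/
def tensN (a : Fin 2) (y : Plane) : ℝ :=
  - vecFLow Γ w a y + ∑ b, ∑ c, epsUp w b c y * nabla₂ Γ (skewB Γ) a b c y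

/-- The `3 × 3` matrix with rows `(F^1, F^2, β)` and `(M_a{}^1, M_a{}^2, N_a)`, `a = 1, 2`. -/
def matM (y : Plane) : Matrix (Fin 3) (Fin 3) ℝ :=
  !![vecF Γ w 0 y, vecF Γ w 1 y, beta Γ w y;
     tensM Γ w 0 0 y, tensM Γ w 0 1 y, tensN Γ w 0 y;
     tensM Γ w 1 0 y, tensM Γ w 1 1 y, tensN Γ w 1 y]

/-- `I_N = ε_{cd} ε^{be} M_e{}^c (N_b F^d - (1/2) β M_b{}^d)`. -/
def invN (y : Plane) : ℝ :=
  ∑ b, ∑ c, ∑ d, ∑ e, epsLow w c d y * epsUp w b e y * tensM Γ w e c y *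
    (tensN Γ w b y * vecF Γ w d y - 1 / 2 * beta Γ w y * tensM Γ w b d y)

/-- `T_a{}^b = N_a F^b - β M_a{}^b`; the first argument is the lower index. -/
def tensT (a b : Fin 2) (y : Plane) : ℝ :=
  tensN Γ w a y * vecF Γ w b y - beta Γ w y * tensM Γ w a b y

/-- The connection matrices `A_a` of the prolongation connection
`D_a (K_b, μ) = (∇_a K_b - ε_{ab} μ, ∂_a μ - (P^b{}_a + (1/2) β δ^b_a) K_b + θ_a μ)`
on `Λ¹ ⊕ Λ²`: for `Ψ = (K_1, K_2, μ)` one has `D_a Ψ = ∂_a Ψ - A_a Ψ`. -/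
def prolong (a : Fin 2) (y : Plane) : Matrix (Fin 3) (Fin 3) ℝ :=
  !![Γ a 0 0 y, Γ a 0 1 y, epsLow w a 0 y;
     Γ a 1 0 y, Γ a 1 1 y, epsLow w a 1 y;
     schoutenUp Γ w 0 a y + 1 / 2 * beta Γ w y * delta 0 a,
       schoutenUp Γ w 1 a y + 1 / 2 * beta Γ w y * delta 1 a, - theta Γ w a y]

/-- The section `V = (F^1, F^2, β)` of the dual bundle. -/
def secV (y : Plane) : Fin 3 → ℝ := ![vecF Γ w 0 y, vecF Γ w 1 y, beta Γ w y]

/-- `D_a V = ∂_a V + V A_a`, for the connection dual to the prolongation connection. -/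
def secDV (a : Fin 2) (y : Plane) (i : Fin 3) : ℝ :=
  pd a (fun z ↦ secV Γ w z i) y + ∑ j, secV Γ w y j * prolong Γ w a y j i

/-- The second covariant derivative `D_b D_c V` (coupling `D` with `∇` on the index `c`). -/
def secDDV (b c : Fin 2) (y : Plane) (i : Fin 3) : ℝ :=
  pd b (fun z ↦ secDV Γ w c z i) y + ∑ j, secDV Γ w c y j * prolong Γ w b y j i -
    ∑ d, Γ b c d y * secDV Γ w d y i

/-- `I_S`, that is `W_{abc} = det (V, D_a V, D_{(b} D_{c)} V)`. -/
def invS (a b c : Fin 2) (y : Plane) : ℝ :=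
  Matrix.det (Matrix.of ![secV Γ w y, secDV Γ w a y,
    fun i ↦ 1 / 2 * (secDDV Γ w b c y i + secDDV Γ w c b y i)])

/-- The projectively changed symbols `Γ_{ab}^c + δ_a^c Υ_b + δ_b^c Υ_a`. -/
def projChange (Υ : Fin 2 → Plane → ℝ) : Symbols :=
  fun a b c y ↦ Γ a b c y + delta a c * Υ b y + delta b c * Υ a y

end Local

/-! ### Surfaces -/

section Global

variable {M : Type*} [TopologicalSpace M] [ChartedSpace Plane M] [IsManifold (𝓡 2) 6 M]

instance isManifold_one : IsManifold (𝓡 2) 1 M :=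
  IsManifold.of_le (n := 6) (by norm_num)

instance isManifold_two : IsManifold (𝓡 2) 2 M :=
  IsManifold.of_le (n := 6) (by norm_num)

variable (M) in
/-- An affine connection on `M`, as a covariant derivative on the tangent bundle:
`cov Y x (X x)` is `(∇_X Y)(x)`. -/
abbrev AffineConnection : Type _ :=
  CovariantDerivative (𝓡 2) Plane (TangentSpace (𝓡 2) : M → Type _)

variable (M) in
/-- A (not necessarily continuous) one-form on `M`. -/
abbrev OneForm : Type _ := (x : M) → TangentSpace (𝓡 2) x →L[ℝ] ℝ

variable (M) in
/-- A volume form of class `C^2`: a nowhere vanishing skew form on the tangent spaces. -/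
structure VolumeForm where
  /-- The bilinear form on each tangent space. -/
  form : (x : M) → TangentSpace (𝓡 2) x →L[ℝ] TangentSpace (𝓡 2) x →L[ℝ] ℝ
  skew : ∀ (x : M) (v : TangentSpace (𝓡 2) x), form x v v = 0
  ne_zero : ∀ x : M, form x ≠ 0
  contMDiff : ContMDiff (𝓡 2) ((𝓡 2).prod 𝓘(ℝ, Plane →L[ℝ] Plane →L[ℝ] ℝ)) 2
    (fun x ↦ Bundle.TotalSpace.mk' (Plane →L[ℝ] Plane →L[ℝ] ℝ)
      (E := fun x : M ↦ TangentSpace (𝓡 2) x →L[ℝ] TangentSpace (𝓡 2) x →L[ℝ] ℝ) x (form x))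


/-- The `a`-th coordinate vector field of the chart `e` (meaningful on `e.source`). -/
def coordField (e : OpenPartialHomeomorph M Plane) (a : Fin 2) :
    (x : M) → TangentSpace (𝓡 2) x :=
  VectorField.mpullback (𝓡 2) 𝓘(ℝ, Plane) e
    (fun y ↦ (NormedSpace.fromTangentSpace y).symm (EuclideanSpace.single a (1 : ℝ)))

/-- The `c`-th component in the chart `e` of a tangent vector `v` at `x`. -/
def coordComp (e : OpenPartialHomeomorph M Plane) (x : M) (v : TangentSpace (𝓡 2) x)
    (c : Fin 2) : ℝ :=
  mvfderiv (𝓡 2) (e : M → Plane) x v c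

/-- The Christoffel symbols of `∇` in the chart `e`: `∇_{∂_a} ∂_b = Γ_{ab}^c ∂_c`. -/
def christoffel (cov : AffineConnection M) (e : OpenPartialHomeomorph M Plane) : Symbols :=
  fun a b c y ↦
    coordComp e (e.symm y) (cov (coordField e b) (e.symm y) (coordField e a (e.symm y))) c

/-- The component `ε_{12}` of a volume form in the chart `e`. -/
def VolumeForm.comp (ε : VolumeForm M) (e : OpenPartialHomeomorph M Plane) (y : Plane) : ℝ :=
  ε.form (e.symm y) (coordField e 0 (e.symm y)) (coordField e 1 (e.symm y))

/-- `K` is of class `C^1` on `U`. -/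
def IsC1On (K : OneForm M) (U : Set M) : Prop :=
  ContMDiffOn (𝓡 2) ((𝓡 2).prod 𝓘(ℝ, Plane →L[ℝ] ℝ)) 1
    (fun x ↦ Bundle.TotalSpace.mk' (Plane →L[ℝ] ℝ)
      (E := fun x : M ↦ TangentSpace (𝓡 2) x →L[ℝ] ℝ) x (K x)) U

/-- The vector field `X` is differentiable at `x`. -/
def VectorDiffAt (X : (x : M) → TangentSpace (𝓡 2) x) (x : M) : Prop :=
  MDifferentiableAt (𝓡 2) ((𝓡 2).prod 𝓘(ℝ, Plane))
    (fun z ↦ Bundle.TotalSpace.mk' Plane (E := fun z : M ↦ TangentSpace (𝓡 2) z) z (X z)) x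

/-- `∇_{(a} K_{b)} = 0` on `U`, that is `(∇_X K)(X) = X (K(X)) - K(∇_X X) = 0` for all `X`. -/
def IsKillingOn (cov : AffineConnection M) (K : OneForm M) (U : Set M) : Prop :=
  ∀ x ∈ U, ∀ X : (x : M) → TangentSpace (𝓡 2) x, VectorDiffAt X x →
    mvfderiv (𝓡 2) (fun z ↦ K z (X z)) x (X x) - K x (cov X x (X x)) = 0

theorem IsC1On.mdiffAt {K : OneForm M} {U : Set M} (hU : IsOpen U) (h : IsC1On K U) {x : M}
    (hx : x ∈ U) {X : (x : M) → TangentSpace (𝓡 2) x} (hX : VectorDiffAt X x) :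
    MDifferentiableAt (𝓡 2) 𝓘(ℝ, ℝ) (fun z ↦ K z (X z)) x := by
  have h1 := ((h x hx).contMDiffAt (hU.mem_nhds hx)).mdifferentiableAt one_ne_zero
  have h2 := MDifferentiableAt.clm_bundle_apply (F₁ := Plane) (F₂ := ℝ)
    (E₁ := (TangentSpace (𝓡 2) : M → Type _)) (E₂ := Bundle.Trivial M ℝ)
    (b := fun z : M => z) (ϕ := fun z => K z) (v := X) h1 hX
  exact ((mdifferentiableAt_totalSpace _ _).1 h2).2

theorem IsC1On.add {K L : OneForm M} {U : Set M} (hK : IsC1On K U) (hL : IsC1On L U) :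
    IsC1On (K + L) U :=
  ContMDiffOn.add_section (V := fun x : M ↦ TangentSpace (𝓡 2) x →L[ℝ] Bundle.Trivial M ℝ x) hK hL

theorem IsC1On.smul {K : OneForm M} {U : Set M} (c : ℝ) (hK : IsC1On K U) :
    IsC1On (c • K) U :=
  ContMDiffOn.const_smul_section
    (V := fun x : M ↦ TangentSpace (𝓡 2) x →L[ℝ] Bundle.Trivial M ℝ x) hK

/-- The linear first integrals of `∇` on `U`, i.e. the one-forms of class `C^1` on `U` solving
`∇_{(a} K_{b)} = 0` there.  A form on `U` is represented by its extension by zero. -/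
def firstIntegrals (cov : AffineConnection M) (U : TopologicalSpace.Opens M) :
    Submodule ℝ (OneForm M) where
  carrier := {K | IsC1On K U ∧ IsKillingOn cov K U ∧ ∀ x ∉ U, K x = 0}
  zero_mem' := by
    refine ⟨?_, ?_, fun _ _ ↦ rfl⟩
    · exact (Bundle.contMDiff_zeroSection ℝ
        (fun x : M ↦ TangentSpace (𝓡 2) x →L[ℝ] Bundle.Trivial M ℝ x)).contMDiffOn
    · intro x _ X _
      have h : (fun z ↦ (0 : OneForm M) z (X z)) = fun _ ↦ (0 : ℝ) := rfl
      rw [h, mvfderiv_const]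
      simp
  add_mem' := by
    rintro K L ⟨hK, hK', hK0⟩ ⟨hL, hL', hL0⟩
    refine ⟨hK.add hL, ?_, fun x hx ↦ by simp [hK0 x hx, hL0 x hx]⟩
    intro x hx X hX
    have h1 := hK' x hx X hX
    have h2 := hL' x hx X hX
    have h : (fun z ↦ (K + L) z (X z)) = (fun z ↦ K z (X z)) + fun z ↦ L z (X z) := rfl
    rw [h, mvfderiv_add (hK.mdiffAt U.isOpen hx hX) (hL.mdiffAt U.isOpen hx hX)]
    simp only [add_apply, Pi.add_apply]
    linarith
  smul_mem' := by
    rintro c K ⟨hK, hK', hK0⟩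
    refine ⟨hK.smul c, ?_, fun x hx ↦ by simp [hK0 x hx]⟩
    intro x hx X hX
    have h1 := hK' x hx X hX
    have h : (fun z : M ↦ (c • K) z (X z)) = (fun _ : M ↦ c) • fun z : M ↦ K z (X z) := rfl
    rw [h, mvfderiv_smul mdifferentiableAt_const (hK.mdiffAt U.isOpen hx hX), mvfderiv_const]
    have h2 : c * (mvfderiv (𝓡 2) (fun z ↦ K z (X z)) x (X x) - K x (cov X x (X x))) = 0 := by
      rw [h1, mul_zero]
    simpa [mul_sub] using h2

/-! Pointwise conditions on tensors are imposed on their components in every chart of the atlas;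
a point of `U` in the domain of `e` is written `e.symm y` with `y ∈ e.target`. -/

/-- `I_N = 0` on `U`. -/
def InvNVanishes (cov : AffineConnection M) (ε : VolumeForm M) (U : Set M) : Prop :=
  ∀ e ∈ atlas Plane M, ∀ y ∈ e.target, e.symm y ∈ U → invN (christoffel cov e) (ε.comp e) y = 0

/-- `I_S = 0` on `U`. -/
def InvSVanishes (cov : AffineConnection M) (ε : VolumeForm M) (U : Set M) : Prop :=
  ∀ e ∈ atlas Plane M, ∀ y ∈ e.target, e.symm y ∈ U →
    ∀ a b c, invS (christoffel cov e) (ε.comp e) a b c y = 0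

/-- `T = 0` on `U`. -/
def TensTVanishes (cov : AffineConnection M) (ε : VolumeForm M) (U : Set M) : Prop :=
  ∀ e ∈ atlas Plane M, ∀ y ∈ e.target, e.symm y ∈ U →
    ∀ a b, tensT (christoffel cov e) (ε.comp e) a b y = 0

/-- The Ricci tensor of `∇` is symmetric at `x`. -/
def RicciSymmAt (cov : AffineConnection M) (x : M) : Prop :=
  ∀ e ∈ atlas Plane M, x ∈ e.source →
    ∀ a b, ricci (christoffel cov e) a b (e x) = ricci (christoffel cov e) b a (e x)

/-- `∇` is projectively flat on `U`: near each point of `U` there is a one-form `Υ` such that the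
connection `Γ_{ab}^c + δ_a^c Υ_b + δ_b^c Υ_a`, which has the same unparametrised geodesics as `∇`,
is flat. -/
def ProjFlatOn (cov : AffineConnection M) (U : Set M) : Prop :=
  ∀ e ∈ atlas Plane M, ∀ y₀ ∈ e.target, e.symm y₀ ∈ U →
    ∃ O : Set Plane, IsOpen O ∧ y₀ ∈ O ∧ O ⊆ e.target ∧
      ∃ Υ : Fin 2 → Plane → ℝ, (∀ a, ContDiffOn ℝ 1 (Υ a) O) ∧
        ∀ y ∈ O, ∀ a b c d, riem (projChange (christoffel cov e) Υ) a b c d y = 0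

/-- The rank of the `3 × 3` matrix of algebraic equations is constant near `p`. -/
def RegularAt (cov : AffineConnection M) (ε : VolumeForm M) (p : M) : Prop :=
  ∃ e ∈ atlas Plane M, p ∈ e.source ∧
    ∀ᶠ y in 𝓝 (e p), (matM (christoffel cov e) (ε.comp e) y).rank =
      (matM (christoffel cov e) (ε.comp e) (e p)).rank

end Global

end SurfaceConnection

end

/-!
# Linear first integrals of an affine connection on a surface

A one-form `K` solves the Killing equation `∇_{(a} K_{b)} = 0` if and only if `∇_a K_b = ε_{ab} μ`
for some `μ`, and then `(K, μ)` is parallel for the connection `D` with matrices `prolong`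
(`IsGeometryOn.isParallelOn_killingSection`, `IsGeometryOn.isKillingComp_of_isParallelOn`).  Hence a
solution on a connected set is determined by the value of `(K, μ)` at one point
(`eq_zero_of_formSection_eq_zero`).

The curvature of `D` is carried by the single section `V = (F, β)` of the dual bundle
(`IsGeometryOn.curv_prolong`).  A parallel section `Ψ` satisfies `V Ψ = 0`, and by differentiation
`(D_a V) Ψ = 0` and `(D_b D_c V) Ψ = 0`.  The rows of `matM` are `V` and `D_a V` up to multiples of
`V` (`IsGeometryOn.rowsV_eq`), and `I_N` is their determinant (`IsGeometryOn.det_rowsV`), so that a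
nonzero solution forces `I_N = 0` and `I_S = 0` (`invariants_vanish`), and the number of independent
solutions is at most the corank of these rows at any point (`finrank_firstIntegrals_le`).

Conversely, let the rank be constant and let the second derivatives `D_b D_c V` vanish on the kernel
of the rows wherever `V ≠ 0`.  A section transported from `p` along coordinate lines, starting in
the kernel at `p`, stays in the kernel by Grönwall's inequality, since by constancy of the rank the
derivatives of the rows are bounded combinations of the rows (`exists_bound_of_ker_le`,
`IsTransport.apply_eq_zero`).  It is thus annihilated by the curvature, which makes it parallel
(`IsTransport.hasDerivAt_fst`).  This is `IsGeometryOn.exists_isParallelOn_of_rank_eq`.  The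
condition on `D_b D_c V` holds if the rank is at most one
(`IsGeometryOn.secDDV_pairing_of_rank_le_one`), and if the rank is two and `I_S = 0`
(`IsGeometryOn.secDDV_pairing_of_invS`).

The three counting statements reduce to the rank.  `T` consists of the `2 × 2` minors of `matM` that
contain `β`, so rank one gives `T = 0`, and `T = 0` gives rank one where `β ≠ 0`, that is, where the
Ricci tensor is not symmetric; if `β = 0` near a point then `T = 0` forces `V = 0` there.  Rank zero
means `V = 0`, which is equivalent to symmetry of the Ricci tensor together with projective
flatness (`IsGeometryOn.secV_eq_zero_of_projChange`, `IsGeometryOn.exists_projChange`): the equation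
`∇_a ∇_b f = - P_{ab} f` is then integrable, and a solution without zeros gives the flattening
one-form `Υ = - d log |f|`.

Everything is computed in the charts of the atlas.  Transformation laws of the components are not
needed: a condition in one chart is passed to the others through the dimension of the space of
linear first integrals, which bounds the rank in every chart.
-/

noncomputable section

namespace SurfaceConnection

/-! ### Partial derivatives in the plane -/

section Calculus

variable {f g : Plane → ℝ} {y : Plane} {O : Set Plane} {a b : Fin 2}

theorem pd_congr (h : f =ᶠ[𝓝 y] g) : pd a f y = pd a g y := by
  unfold pd; rw [h.fderiv_eq]

theorem pd_congr_of_eqOn (hO : IsOpen O) (h : Set.EqOn f g O) (hy : y ∈ O) :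
    pd a f y = pd a g y :=
  pd_congr (h.eventuallyEq_of_mem (hO.mem_nhds hy))

theorem pd_const (c : ℝ) : pd a (fun _ ↦ c) y = 0 := by
  simp [pd]

theorem pd_add (hf : DifferentiableAt ℝ f y) (hg : DifferentiableAt ℝ g y) :
    pd a (fun z ↦ f z + g z) y = pd a f y + pd a g y := by
  unfold pd; rw [fderiv_fun_add hf hg]; rfl

theorem pd_sub (hf : DifferentiableAt ℝ f y) (hg : DifferentiableAt ℝ g y) :
    pd a (fun z ↦ f z - g z) y = pd a f y - pd a g y := by
  unfold pd; rw [fderiv_fun_sub hf hg]; rfl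

theorem pd_neg : pd a (fun z ↦ - f z) y = - pd a f y := by
  unfold pd; rw [fderiv_fun_neg]; rfl

theorem pd_mul (hf : DifferentiableAt ℝ f y) (hg : DifferentiableAt ℝ g y) :
    pd a (fun z ↦ f z * g z) y = pd a f y * g y + f y * pd a g y := by
  unfold pd; rw [fderiv_fun_mul hf hg]; simp; ring

theorem pd_const_mul (c : ℝ) (hf : DifferentiableAt ℝ f y) :
    pd a (fun z ↦ c * f z) y = c * pd a f y := by
  rw [pd_mul (differentiableAt_const c) hf, pd_const]; ring

theorem pd_div (hf : DifferentiableAt ℝ f y) (hg : DifferentiableAt ℝ g y) (h0 : g y ≠ 0) :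
    pd a (fun z ↦ f z / g z) y = (pd a f y * g y - f y * pd a g y) / g y ^ 2 := by
  have hd : DifferentiableAt ℝ (fun z ↦ f z / g z) y := by
    simpa only [div_eq_mul_inv] using hf.fun_mul (hg.fun_inv h0)
  have h1 := pd_mul (a := a) hd hg
  have h2 : pd a (fun z ↦ f z / g z * g z) y = pd a f y := by
    refine pd_congr ?_
    filter_upwards [hg.continuousAt.eventually_ne h0] with z hz
    field_simp
  rw [h2] at h1
  field_simp
  rw [h1]
  field_simp
  ring

theorem pd_sum {ι : Type*} (s : Finset ι) {F : ι → Plane → ℝ}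
    (h : ∀ i ∈ s, DifferentiableAt ℝ (F i) y) :
    pd a (fun z ↦ ∑ i ∈ s, F i z) y = ∑ i ∈ s, pd a (F i) y := by
  unfold pd; rw [fderiv_fun_sum h]; simp

theorem pd_comm (hf : ContDiffAt ℝ 2 f y) :
    pd a (pd b f) y = pd b (pd a f) y := by
  have hd : DifferentiableAt ℝ (fderiv ℝ f) y :=
    (hf.fderiv_right (m := 1) (by norm_num)).differentiableAt one_ne_zero
  have key : ∀ c d : Fin 2, pd c (pd d f) y =
      fderiv ℝ (fderiv ℝ f) y (EuclideanSpace.single c 1) (EuclideanSpace.single d 1) := by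
    intro c d
    have h : HasFDerivAt (pd d f) _ y :=
      hd.hasFDerivAt.clm_apply (hasFDerivAt_const (EuclideanSpace.single d (1 : ℝ)) y)
    rw [pd, h.fderiv]
    simp
  rw [key, key]
  exact (hf.isSymmSndFDerivAt (by simp)) _ _

theorem contDiffOn_pd {m n : ℕ∞ω} (hO : IsOpen O) (hf : ContDiffOn ℝ n f O) (hmn : m + 1 ≤ n) :
    ContDiffOn ℝ m (pd a f) O :=
  (hf.fderiv_of_isOpen hO hmn).clm_apply contDiffOn_const

theorem _root_.ContDiffOn.diffAt {n : ℕ∞ω} (hf : ContDiffOn ℝ n f O) (hO : IsOpen O) (hn : n ≠ 0)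
    (hy : y ∈ O) : DifferentiableAt ℝ f y :=
  (hf.contDiffAt (hO.mem_nhds hy)).differentiableAt hn

end Calculus

/-! ### The coefficients of a connection with a volume form -/

@[simp] theorem perm_zero_zero : perm 0 0 = 0 := by simp [perm]
@[simp] theorem perm_zero_one : perm 0 1 = 1 := by simp [perm]
@[simp] theorem perm_one_zero : perm 1 0 = -1 := by simp [perm]
@[simp] theorem perm_one_one : perm 1 1 = 0 := by simp [perm]
@[simp] theorem delta_self (a : Fin 2) : delta a a = 1 := by simp [delta]
@[simp] theorem delta_zero_one : delta 0 1 = 0 := by simp [delta]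
@[simp] theorem delta_one_zero : delta 1 0 = 0 := by simp [delta]

/-- `Γ` and `w` are the Christoffel symbols of a torsion-free connection of class `C^4` and the
component of a volume form of class `C^2` on the open set `O` of the plane. -/
structure IsGeometryOn (Γ : Symbols) (w : Plane → ℝ) (O : Set Plane) : Prop where
  isOpen : IsOpen O
  contDiffOn_symbols : ∀ a b c, ContDiffOn ℝ 4 (Γ a b c) O
  symm : ∀ y ∈ O, ∀ a b c, Γ a b c y = Γ b a c y
  contDiffOn_vol : ContDiffOn ℝ 2 w O
  vol_ne_zero : ∀ y ∈ O, w y ≠ 0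

theorem contDiffOn_nabla₂ {Γ : Symbols} {O : Set Plane} {m n : ℕ∞ω} (hO : IsOpen O)
    (hΓ : ∀ a b c, ContDiffOn ℝ m (Γ a b c) O) {S : Fin 2 → Fin 2 → Plane → ℝ}
    (hS : ∀ a b, ContDiffOn ℝ n (S a b) O) (hmn : m + 1 ≤ n) (a b c : Fin 2) :
    ContDiffOn ℝ m (nabla₂ Γ S a b c) O := by
  have h : ∀ b c, ContDiffOn ℝ m (S b c) O := fun b c ↦
    (hS b c).of_le (le_trans le_self_add hmn)
  exact (contDiffOn_pd hO (hS b c) hmn).sub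
    (ContDiffOn.sum fun d _ ↦ ((hΓ a b d).mul (h d c)).add ((hΓ a c d).mul (h b d)))

namespace IsGeometryOn

variable {Γ : Symbols} {w : Plane → ℝ} {O : Set Plane} (hG : IsGeometryOn Γ w O)
include hG

theorem mono {O' : Set Plane} (hO' : IsOpen O') (h : O' ⊆ O) : IsGeometryOn Γ w O' where
  isOpen := hO'
  contDiffOn_symbols a b c := (hG.contDiffOn_symbols a b c).mono h
  symm y hy := hG.symm y (h hy)
  contDiffOn_vol := hG.contDiffOn_vol.mono h
  vol_ne_zero y hy := hG.vol_ne_zero y (h hy)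

theorem symbols {n : ℕ∞ω} (hn : n ≤ 4) (a b c : Fin 2) : ContDiffOn ℝ n (Γ a b c) O :=
  (hG.contDiffOn_symbols a b c).of_le hn

theorem contDiffOn_riem (a b c d : Fin 2) : ContDiffOn ℝ 3 (riem Γ a b c d) O := by
  have h : ∀ a b c, ContDiffOn ℝ 3 (Γ a b c) O := hG.symbols (by norm_num)
  have h' : ∀ a b c e, ContDiffOn ℝ 3 (pd e (Γ a b c)) O := fun a b c e ↦
    contDiffOn_pd hG.isOpen (hG.contDiffOn_symbols a b c) (by norm_num)
  exact ((h' _ _ _ _).sub (h' _ _ _ _)).add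
    (ContDiffOn.sum fun f _ ↦ ((h _ _ _).mul (h _ _ _)).sub ((h _ _ _).mul (h _ _ _)))

theorem contDiffOn_schouten (a b : Fin 2) : ContDiffOn ℝ 3 (schouten Γ a b) O := by
  have h : ∀ a b, ContDiffOn ℝ 3 (ricci Γ a b) O := fun a b ↦
    ContDiffOn.sum fun c _ ↦ hG.contDiffOn_riem c a c b
  exact (contDiffOn_const.mul (h a b)).add (contDiffOn_const.mul (h b a))

theorem contDiffOn_skewB (a b : Fin 2) : ContDiffOn ℝ 3 (skewB Γ a b) O :=
  (hG.contDiffOn_schouten b a).sub (hG.contDiffOn_schouten a b)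

theorem contDiffOn_nabla_schouten (a b c : Fin 2) :
    ContDiffOn ℝ 2 (nabla₂ Γ (schouten Γ) a b c) O :=
  contDiffOn_nabla₂ hG.isOpen (hG.symbols (by norm_num)) hG.contDiffOn_schouten (by norm_num) a b c

theorem contDiffOn_nabla_skewB (a b c : Fin 2) :
    ContDiffOn ℝ 2 (nabla₂ Γ (skewB Γ) a b c) O :=
  contDiffOn_nabla₂ hG.isOpen (hG.symbols (by norm_num)) hG.contDiffOn_skewB (by norm_num) a b c

theorem contDiffOn_epsUp (a b : Fin 2) : ContDiffOn ℝ 2 (epsUp w a b) O :=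
  contDiffOn_const.div hG.contDiffOn_vol hG.vol_ne_zero

theorem contDiffOn_epsLow (a b : Fin 2) : ContDiffOn ℝ 2 (epsLow w a b) O :=
  contDiffOn_const.mul hG.contDiffOn_vol

theorem contDiffOn_beta : ContDiffOn ℝ 2 (beta Γ w) O :=
  ContDiffOn.sum fun a _ ↦ ContDiffOn.sum fun b _ ↦
    ((hG.contDiffOn_skewB a b).of_le (by norm_num)).mul (hG.contDiffOn_epsUp a b)

theorem contDiffOn_schoutenUp (a b : Fin 2) : ContDiffOn ℝ 2 (schoutenUp Γ w a b) O :=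
  ContDiffOn.sum fun c _ ↦
    (hG.contDiffOn_epsUp a c).mul ((hG.contDiffOn_schouten c b).of_le (by norm_num))

theorem contDiffOn_theta (a : Fin 2) : ContDiffOn ℝ 1 (theta Γ w a) O := by
  refine contDiffOn_const.mul (ContDiffOn.sum fun b _ ↦ ContDiffOn.sum fun c _ ↦ ?_)
  exact ((hG.contDiffOn_epsUp b c).of_le (by norm_num)).mul
    (contDiffOn_nabla₂ hG.isOpen (hG.symbols (by norm_num)) hG.contDiffOn_epsLow
      (by norm_num) a b c)

theorem contDiffOn_vecF (a : Fin 2) : ContDiffOn ℝ 2 (vecF Γ w a) O := by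
  refine contDiffOn_const.mul (ContDiffOn.sum fun b _ ↦ (hG.contDiffOn_epsUp a b).mul
    (ContDiffOn.sub ?_ ?_))
  · exact ContDiffOn.sum fun c _ ↦ ContDiffOn.sum fun d _ ↦
      (hG.contDiffOn_epsUp c d).mul (hG.contDiffOn_nabla_schouten c d b)
  · exact ContDiffOn.sum fun c _ ↦ ContDiffOn.sum fun d _ ↦
      (hG.contDiffOn_epsUp c d).mul (hG.contDiffOn_nabla_skewB b c d)

theorem contDiffOn_secV (i : Fin 3) : ContDiffOn ℝ 2 (fun y ↦ secV Γ w y i) O := by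
  fin_cases i
  exacts [hG.contDiffOn_vecF 0, hG.contDiffOn_vecF 1, hG.contDiffOn_beta]

theorem contDiffOn_prolong (a : Fin 2) (i j : Fin 3) :
    ContDiffOn ℝ 1 (fun y ↦ prolong Γ w a y i j) O := by
  have h1 : ∀ a b c, ContDiffOn ℝ 1 (Γ a b c) O := hG.symbols (by norm_num)
  have h2 : ∀ a b, ContDiffOn ℝ 1 (epsLow w a b) O := fun a b ↦
    (hG.contDiffOn_epsLow a b).of_le (by norm_num)
  have h3 : ∀ b, ContDiffOn ℝ 1
      (fun y ↦ schoutenUp Γ w b a y + 1 / 2 * beta Γ w y * delta b a) O := fun b ↦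
    (((hG.contDiffOn_schoutenUp b a).of_le (by norm_num)).add
      ((contDiffOn_const.mul (hG.contDiffOn_beta.of_le (by norm_num))).mul contDiffOn_const))
  fin_cases i <;> fin_cases j
  exacts [h1 a 0 0, h1 a 0 1, h2 a 0, h1 a 1 0, h1 a 1 1, h2 a 1, h3 0, h3 1,
    (hG.contDiffOn_theta a).neg]

theorem contDiffOn_secDV (a : Fin 2) (i : Fin 3) :
    ContDiffOn ℝ 1 (fun y ↦ secDV Γ w a y i) O :=
  (contDiffOn_pd hG.isOpen (hG.contDiffOn_secV i) (by norm_num)).add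
    (ContDiffOn.sum fun j _ ↦ ((hG.contDiffOn_secV j).of_le (by norm_num)).mul
      (hG.contDiffOn_prolong a j i))

end IsGeometryOn

namespace IsGeometryOn

variable {Γ : Symbols} {w : Plane → ℝ} {O : Set Plane} (hG : IsGeometryOn Γ w O) {y : Plane}
  (hy : y ∈ O)
include hG hy

theorem diff_symbols (a b c : Fin 2) : DifferentiableAt ℝ (Γ a b c) y :=
  (hG.contDiffOn_symbols a b c).diffAt hG.isOpen (by norm_num) hy

theorem diff_vol : DifferentiableAt ℝ w y :=
  hG.contDiffOn_vol.diffAt hG.isOpen (by norm_num) hy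

theorem diff_schouten (a b : Fin 2) : DifferentiableAt ℝ (schouten Γ a b) y :=
  (hG.contDiffOn_schouten a b).diffAt hG.isOpen (by norm_num) hy

theorem diff_nabla_schouten (a b c : Fin 2) :
    DifferentiableAt ℝ (nabla₂ Γ (schouten Γ) a b c) y :=
  (hG.contDiffOn_nabla_schouten a b c).diffAt hG.isOpen (by norm_num) hy

theorem pd_symbols_symm (e a b c : Fin 2) : pd e (Γ a b c) y = pd e (Γ b a c) y :=
  pd_congr_of_eqOn hG.isOpen (fun z hz ↦ hG.symm z hz a b c) hy

/-- In dimension two the curvature is determined by the Schouten tensor. -/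
theorem riem_eq (a b c d : Fin 2) :
    riem Γ a b c d y = delta a c * schouten Γ b d y - delta b c * schouten Γ a d y +
      (schouten Γ b a y - schouten Γ a b y) * delta d c := by
  have h1 : ∀ e c, pd e (Γ 1 0 c) y = pd e (Γ 0 1 c) y := fun e c ↦
    hG.pd_symbols_symm hy e 1 0 c
  have h2 : ∀ c, Γ 1 0 c y = Γ 0 1 c y := fun c ↦ hG.symm y hy 1 0 c
  fin_cases a <;> fin_cases b <;> fin_cases c <;> fin_cases d <;>
    simp [schouten, ricci, riem, Fin.sum_univ_two, h1, h2] <;> ring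

theorem nabla_skewB (a b c : Fin 2) :
    nabla₂ Γ (skewB Γ) a b c y =
      nabla₂ Γ (schouten Γ) a c b y - nabla₂ Γ (schouten Γ) a b c y := by
  have h : pd a (skewB Γ b c) y = pd a (schouten Γ c b) y - pd a (schouten Γ b c) y :=
    pd_sub (hG.diff_schouten hy c b) (hG.diff_schouten hy b c)
  rw [nabla₂, h]
  simp only [nabla₂, skewB, Fin.sum_univ_two]
  ring

theorem beta_eq : beta Γ w y = 2 * (schouten Γ 1 0 y - schouten Γ 0 1 y) / w y := by
  have := hG.vol_ne_zero y hy
  simp [beta, skewB, epsUp, Fin.sum_univ_two]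
  field_simp
  ring

theorem theta_eq (a : Fin 2) : theta Γ w a y = pd a w y / w y - Γ a 0 0 y - Γ a 1 1 y := by
  have h0 := hG.vol_ne_zero y hy
  have h : ∀ b c, pd a (epsLow w b c) y = perm b c * pd a w y := fun b c ↦
    pd_const_mul _ (hG.diff_vol hy)
  simp [theta, nabla₂, epsUp, h, epsLow, Fin.sum_univ_two]
  field_simp
  ring

theorem vecF_zero : vecF Γ w 0 y = (nabla₂ Γ (schouten Γ) 0 1 1 y + nabla₂ Γ (schouten Γ) 1 0 1 y
      - 2 * nabla₂ Γ (schouten Γ) 1 1 0 y) / (3 * w y ^ 2) := by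
  have h0 := hG.vol_ne_zero y hy
  simp only [vecF, cottonL, hG.nabla_skewB hy]
  simp [epsUp, Fin.sum_univ_two]
  field_simp
  ring

theorem vecF_one : vecF Γ w 1 y = (nabla₂ Γ (schouten Γ) 0 1 0 y + nabla₂ Γ (schouten Γ) 1 0 0 y
      - 2 * nabla₂ Γ (schouten Γ) 0 0 1 y) / (3 * w y ^ 2) := by
  have h0 := hG.vol_ne_zero y hy
  simp only [vecF, cottonL, hG.nabla_skewB hy]
  simp [epsUp, Fin.sum_univ_two]
  field_simp
  ring

theorem pd_theta (a b : Fin 2) : pd b (theta Γ w a) y =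
    (pd b (pd a w) y * w y - pd a w y * pd b w y) / w y ^ 2 - pd b (Γ a 0 0) y
      - pd b (Γ a 1 1) y := by
  have h1 : DifferentiableAt ℝ (pd a w) y :=
    (contDiffOn_pd (m := 1) hG.isOpen hG.contDiffOn_vol (by norm_num)).diffAt hG.isOpen
      (by norm_num) hy
  have h2 := hG.diff_vol hy
  have h3 : DifferentiableAt ℝ (fun z ↦ pd a w z / w z) y := by
    simpa only [div_eq_mul_inv] using h1.fun_mul (h2.fun_inv (hG.vol_ne_zero y hy))
  rw [pd_congr_of_eqOn hG.isOpen (fun z hz ↦ hG.theta_eq hz a) hy,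
    pd_sub (h3.fun_sub (hG.diff_symbols hy a 0 0)) (hG.diff_symbols hy a 1 1),
    pd_sub h3 (hG.diff_symbols hy a 0 0), pd_div h1 h2 (hG.vol_ne_zero y hy)]

/-- `dθ = - 3 B`. -/
theorem curl_theta : pd 0 (theta Γ w 1) y - pd 1 (theta Γ w 0) y =
    - 3 * (schouten Γ 1 0 y - schouten Γ 0 1 y) := by
  have h0 := hG.vol_ne_zero y hy
  have h1 : pd 0 (pd 1 w) y = pd 1 (pd 0 w) y :=
    pd_comm (hG.contDiffOn_vol.contDiffAt (hG.isOpen.mem_nhds hy))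
  have h2 := hG.riem_eq hy 0 1 0 0
  have h3 := hG.riem_eq hy 0 1 1 1
  simp only [riem, Fin.sum_univ_two, delta_self, delta_one_zero, delta_zero_one] at h2 h3
  rw [hG.pd_theta hy, hG.pd_theta hy, h1]
  linear_combination -h2 - h3

theorem prolong_two_zero (a : Fin 2) : prolong Γ w a y 2 0 =
    (schouten Γ 1 a y + delta 0 a * (schouten Γ 1 0 y - schouten Γ 0 1 y)) / w y := by
  have h0 := hG.vol_ne_zero y hy
  simp [prolong, schoutenUp, epsUp, Fin.sum_univ_two, hG.beta_eq hy]
  field_simp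

theorem prolong_two_one (a : Fin 2) : prolong Γ w a y 2 1 =
    (- schouten Γ 0 a y + delta 1 a * (schouten Γ 1 0 y - schouten Γ 0 1 y)) / w y := by
  have h0 := hG.vol_ne_zero y hy
  simp [prolong, schoutenUp, epsUp, Fin.sum_univ_two, hG.beta_eq hy]
  field_simp

theorem pd_prolong_two_zero (a b : Fin 2) : pd b (fun z ↦ prolong Γ w a z 2 0) y =
    ((pd b (schouten Γ 1 a) y + delta 0 a * (pd b (schouten Γ 1 0) y - pd b (schouten Γ 0 1) y))
      * w y - (schouten Γ 1 a y + delta 0 a * (schouten Γ 1 0 y - schouten Γ 0 1 y)) * pd b w y)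
      / w y ^ 2 := by
  have hP := fun a b ↦ hG.diff_schouten hy a b
  have hs := (hP 1 0).fun_sub (hP 0 1)
  rw [pd_congr_of_eqOn hG.isOpen (fun z hz ↦ hG.prolong_two_zero hz a) hy,
    pd_div ((hP 1 a).fun_add (hs.const_mul _)) (hG.diff_vol hy) (hG.vol_ne_zero y hy),
    pd_add (hP 1 a) (hs.const_mul _), pd_const_mul _ hs, pd_sub (hP 1 0) (hP 0 1)]

theorem pd_prolong_two_one (a b : Fin 2) : pd b (fun z ↦ prolong Γ w a z 2 1) y =
    ((- pd b (schouten Γ 0 a) y + delta 1 a * (pd b (schouten Γ 1 0) y - pd b (schouten Γ 0 1) y))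
      * w y - (- schouten Γ 0 a y + delta 1 a * (schouten Γ 1 0 y - schouten Γ 0 1 y)) * pd b w y)
      / w y ^ 2 := by
  have hP := fun a b ↦ hG.diff_schouten hy a b
  have hs := (hP 1 0).fun_sub (hP 0 1)
  rw [pd_congr_of_eqOn hG.isOpen (fun z hz ↦ hG.prolong_two_one hz a) hy,
    pd_div ((hP 0 a).fun_neg.fun_add (hs.const_mul _)) (hG.diff_vol hy) (hG.vol_ne_zero y hy),
    pd_add (hP 0 a).fun_neg (hs.const_mul _), pd_const_mul _ hs, pd_sub (hP 1 0) (hP 0 1), pd_neg]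

end IsGeometryOn

/-! ### The curvature of the prolongation connection -/

/-- The curvature `∂_0 A_1 - ∂_1 A_0 + A_1 A_0 - A_0 A_1` of a linear system `∂_a Ψ = A_a Ψ`
on the plane. -/
def curv (A : Fin 2 → Plane → Matrix (Fin 3) (Fin 3) ℝ) (y : Plane) :
    Matrix (Fin 3) (Fin 3) ℝ :=
  Matrix.of fun i j ↦ pd 0 (fun z ↦ A 1 z i j) y - pd 1 (fun z ↦ A 0 z i j) y +
    (A 1 y * A 0 y - A 0 y * A 1 y) i j

namespace IsGeometryOn

variable {Γ : Symbols} {w : Plane → ℝ} {O : Set Plane} (hG : IsGeometryOn Γ w O) {y : Plane}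
  (hy : y ∈ O)
include hG hy

/-- The curvature of the prolongation connection has rank at most one: it is given by the
section `V` of the dual bundle, with values in the summand `Λ²`. -/
theorem curv_prolong (i j : Fin 3) : curv (prolong Γ w) y i j =
      if i = 2 then 3 * w y * secV Γ w y j else 0 := by
  have h0 := hG.vol_ne_zero y hy
  have hs : ∀ c, Γ 1 0 c y = Γ 0 1 c y := fun c ↦ hG.symm y hy 1 0 c
  have hw : ∀ a b c, pd a (epsLow w b c) y = perm b c * pd a w y := fun a b c ↦
    pd_const_mul _ (hG.diff_vol hy)
  have hR : ∀ c d, riem Γ 0 1 c d y = _ := fun c d ↦ hG.riem_eq hy 0 1 c d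
  simp only [riem, Fin.sum_univ_two, hs] at hR
  have p00 : ∀ a, (fun z ↦ prolong Γ w a z 0 0) = Γ a 0 0 := fun _ ↦ rfl
  have p01 : ∀ a, (fun z ↦ prolong Γ w a z 0 1) = Γ a 0 1 := fun _ ↦ rfl
  have p02 : ∀ a, (fun z ↦ prolong Γ w a z 0 2) = epsLow w a 0 := fun _ ↦ rfl
  have p10 : ∀ a, (fun z ↦ prolong Γ w a z 1 0) = Γ a 1 0 := fun _ ↦ rfl
  have p11 : ∀ a, (fun z ↦ prolong Γ w a z 1 1) = Γ a 1 1 := fun _ ↦ rfl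
  have p12 : ∀ a, (fun z ↦ prolong Γ w a z 1 2) = epsLow w a 1 := fun _ ↦ rfl
  have p22 : ∀ a, pd a (fun z ↦ prolong Γ w (1 - a) z 2 2) y =
    - pd a (theta Γ w (1 - a)) y := fun _ ↦ pd_neg
  have q22 := p22 0
  have r22 := p22 1
  simp only [sub_self, sub_zero] at q22 r22
  have e00 : ∀ a, prolong Γ w a y 0 0 = Γ a 0 0 y := fun _ ↦ rfl
  have e01 : ∀ a, prolong Γ w a y 0 1 = Γ a 0 1 y := fun _ ↦ rfl
  have e02 : ∀ a, prolong Γ w a y 0 2 = perm a 0 * w y := fun _ ↦ rfl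
  have e10 : ∀ a, prolong Γ w a y 1 0 = Γ a 1 0 y := fun _ ↦ rfl
  have e11 : ∀ a, prolong Γ w a y 1 1 = Γ a 1 1 y := fun _ ↦ rfl
  have e12 : ∀ a, prolong Γ w a y 1 2 = perm a 1 * w y := fun _ ↦ rfl
  have e22 : ∀ a, prolong Γ w a y 2 2 = - theta Γ w a y := fun _ ↦ rfl
  have v0 : secV Γ w y 0 = vecF Γ w 0 y := rfl
  have v1 : secV Γ w y 1 = vecF Γ w 1 y := rfl
  have v2 : secV Γ w y 2 = beta Γ w y := rfl
  have hθ := hG.curl_theta hy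
  have hp := hG.theta_eq hy
  simp only [curv, Matrix.of_apply, Matrix.sub_apply, Matrix.mul_apply, Fin.sum_univ_three]
  have t20 := hG.prolong_two_zero hy
  have t21 := hG.prolong_two_one hy
  have s20 := hG.pd_prolong_two_zero hy
  have s21 := hG.pd_prolong_two_one hy
  fin_cases i <;> fin_cases j <;>
    simp only [Fin.zero_eta, Fin.mk_one, Fin.reduceFinMk, Fin.isValue, Fin.reduceEq, if_true,
      if_false, p00, p01, p02, p10, p11, p12, q22, r22, e00, e01, e02, e10, e11, e12, e22, v0, v1,
      v2, t20, t21, s20, s21, hG.vecF_zero hy, hG.vecF_one hy, hG.beta_eq hy, hw, perm_zero_zero,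
      perm_zero_one, perm_one_zero, perm_one_one, delta_self, delta_zero_one, delta_one_zero,
      nabla₂, Fin.sum_univ_two, hp, hs]
  · have h := hR 0 0
    simp [hs] at h
    field_simp
    linear_combination h
  · have h := hR 1 0
    simp [hs] at h
    field_simp
    linear_combination h
  · field_simp
    ring
  · have h := hR 0 1
    simp at h
    field_simp
    linear_combination h
  · have h := hR 1 1
    simp at h
    field_simp
    linear_combination h
  · field_simp
    ring
  · field_simp
    ring
  · field_simp
    ring
  · field_simp
    linear_combination -(w y ^ 2) * hθ

/-- The rows `(M_a^1, M_a^2, N_a)` of the matrix of algebraic equations are those of `D_a V` up to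
a multiple of `V`. -/
theorem secDV_eq (a : Fin 2) (i : Fin 3) : secDV Γ w a y i =
    ![tensM Γ w a 0 y, tensM Γ w a 1 y, tensN Γ w a y] i - 2 * theta Γ w a y * secV Γ w y i := by
  have h0 := hG.vol_ne_zero y hy
  have hD := hG.diff_nabla_schouten hy
  have hP := hG.diff_schouten hy
  have hwd := hG.diff_vol hy
  have hw2 : DifferentiableAt ℝ (fun z ↦ 3 * w z ^ 2) y := (hwd.fun_pow 2).const_mul 3
  have hpw : pd a (fun z ↦ 3 * w z ^ 2) y = 6 * w y * pd a w y := by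
    have : (fun z ↦ 3 * w z ^ 2) = fun z ↦ 3 * (w z * w z) := by ext; ring
    rw [this, pd_const_mul _ (hwd.fun_mul hwd), pd_mul hwd hwd]; ring
  have hw3 : 3 * w y ^ 2 ≠ 0 := by positivity
  have d0 := pd_congr_of_eqOn (a := a) hG.isOpen (fun z hz ↦ hG.vecF_zero hz) hy
  rw [pd_div (((hD 0 1 1).fun_add (hD 1 0 1)).fun_sub ((hD 1 1 0).const_mul 2)) hw2 hw3,
      pd_sub ((hD 0 1 1).fun_add (hD 1 0 1)) ((hD 1 1 0).const_mul 2),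
      pd_add (hD 0 1 1) (hD 1 0 1), pd_const_mul _ (hD 1 1 0), hpw] at d0
  have d1 := pd_congr_of_eqOn (a := a) hG.isOpen (fun z hz ↦ hG.vecF_one hz) hy
  rw [pd_div (((hD 0 1 0).fun_add (hD 1 0 0)).fun_sub ((hD 0 0 1).const_mul 2)) hw2 hw3,
      pd_sub ((hD 0 1 0).fun_add (hD 1 0 0)) ((hD 0 0 1).const_mul 2),
      pd_add (hD 0 1 0) (hD 1 0 0), pd_const_mul _ (hD 0 0 1), hpw] at d1
  have d2 := pd_congr_of_eqOn (a := a) hG.isOpen (fun z hz ↦ hG.beta_eq hz) hy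
  rw [pd_div (((hP 1 0).fun_sub (hP 0 1)).const_mul 2) hwd h0,
      pd_const_mul _ ((hP 1 0).fun_sub (hP 0 1)), pd_sub (hP 1 0) (hP 0 1)] at d2
  have dY : ∀ c d b, pd a (cottonY Γ c d b) y = 1 / 2 * (pd a (nabla₂ Γ (schouten Γ) c d b) y -
      pd a (nabla₂ Γ (schouten Γ) d c b) y) := fun c d b ↦ by
    have : pd a (cottonY Γ c d b) y = _ := pd_const_mul _ ((hD c d b).fun_sub (hD d c b))
    rw [this, pd_sub (hD c d b) (hD d c b)]
  have dB : ∀ b c d, pd a (nabla₂ Γ (skewB Γ) b c d) y = pd a (nabla₂ Γ (schouten Γ) b d c) y -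
      pd a (nabla₂ Γ (schouten Γ) b c d) y := fun b c d ↦ by
    rw [pd_congr_of_eqOn hG.isOpen (fun z hz ↦ hG.nabla_skewB hz b c d) hy,
      pd_sub (hD b d c) (hD b c d)]
  have s0 : (fun z ↦ secV Γ w z 0) = vecF Γ w 0 := rfl
  have s1 : (fun z ↦ secV Γ w z 1) = vecF Γ w 1 := rfl
  have s2 : (fun z ↦ secV Γ w z 2) = beta Γ w := rfl
  have v0 : secV Γ w y 0 = vecF Γ w 0 y := rfl
  have v1 : secV Γ w y 1 = vecF Γ w 1 y := rfl
  have v2 : secV Γ w y 2 = beta Γ w y := rfl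
  have e00 : prolong Γ w a y 0 0 = Γ a 0 0 y := rfl
  have e01 : prolong Γ w a y 0 1 = Γ a 0 1 y := rfl
  have e02 : prolong Γ w a y 0 2 = perm a 0 * w y := rfl
  have e10 : prolong Γ w a y 1 0 = Γ a 1 0 y := rfl
  have e11 : prolong Γ w a y 1 1 = Γ a 1 1 y := rfl
  have e12 : prolong Γ w a y 1 2 = perm a 1 * w y := rfl
  have e22 : prolong Γ w a y 2 2 = - theta Γ w a y := rfl
  have hs : ∀ c, Γ 1 0 c y = Γ 0 1 c y := fun c ↦ hG.symm y hy 1 0 c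
  have hb := hG.nabla_skewB hy
  rw [secDV, Fin.sum_univ_three]
  fin_cases i
  · simp only [Fin.zero_eta, s0, v0, v1, v2, e00, e10, d0, hG.prolong_two_zero hy, tensM, nabla₃,
      Matrix.cons_val_zero, Fin.sum_univ_two, dY, dB, hb, cottonY, epsUp, perm_zero_zero,
      perm_zero_one, perm_one_zero, perm_one_one, schoutenUp, hG.beta_eq hy, hG.theta_eq hy,
      hG.vecF_zero hy, hG.vecF_one hy]
    clear d0 d1 d2 dY dB hb hD hP s0 s1 s2 v0 v1 v2
    generalize nabla₂ Γ (schouten Γ) = Q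
    generalize schouten Γ = P
    fin_cases a <;>
    · simp only [Fin.zero_eta, Fin.mk_one, hs, delta_self, delta_zero_one, delta_one_zero]
      field_simp
      ring
  · simp only [Fin.mk_one, s1, v0, v1, v2, e01, e11, d1, hG.prolong_two_one hy, tensM, nabla₃,
      Matrix.cons_val_one, Matrix.cons_val_zero, Fin.sum_univ_two, dY, dB, hb, cottonY, epsUp,
      perm_zero_zero, perm_zero_one, perm_one_zero, perm_one_one,
      schoutenUp, hG.beta_eq hy, hG.theta_eq hy,
      hG.vecF_zero hy, hG.vecF_one hy]
    clear d0 d1 d2 dY dB hb hD hP s0 s1 s2 v0 v1 v2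
    generalize nabla₂ Γ (schouten Γ) = Q
    generalize schouten Γ = P
    fin_cases a <;>
    · simp only [Fin.zero_eta, Fin.mk_one, hs, delta_self, delta_zero_one, delta_one_zero]
      field_simp
      ring
  · simp only [Fin.reduceFinMk, s2, v0, v1, v2, e02, e12, e22, d2, tensN, vecFLow, epsLow,
      Matrix.cons_val, Fin.sum_univ_two, hb, epsUp, perm_zero_zero,
      perm_zero_one, perm_one_zero, perm_one_one, hG.beta_eq hy, hG.theta_eq hy,
      hG.vecF_zero hy, hG.vecF_one hy]
    simp only [nabla₂, Fin.sum_univ_two]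
    clear d0 d1 d2 dY dB hb hD hP s0 s1 s2 v0 v1 v2
    generalize schouten Γ = P
    fin_cases a <;>
    · simp only [Fin.zero_eta, Fin.mk_one, hs, perm_zero_zero,
        perm_zero_one, perm_one_zero, perm_one_one]
      field_simp
      ring

/-- The curvature of the prolongation connection acts on the dual section `V` as a multiple of the
identity. -/
theorem secDDV_comm (i : Fin 3) : secDDV Γ w 0 1 y i - secDDV Γ w 1 0 y i =
    3 * w y * beta Γ w y * secV Γ w y i := by
  have hV : ∀ i, DifferentiableAt ℝ (fun z ↦ secV Γ w z i) y := fun i ↦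
    (hG.contDiffOn_secV i).diffAt hG.isOpen (by norm_num) hy
  have hA : ∀ a i j, DifferentiableAt ℝ (fun z ↦ prolong Γ w a z i j) y := fun a i j ↦
    (hG.contDiffOn_prolong a i j).diffAt hG.isOpen (by norm_num) hy
  have hpV : ∀ a i, DifferentiableAt ℝ (pd a (fun z ↦ secV Γ w z i)) y := fun a i ↦
    (contDiffOn_pd (m := 1) hG.isOpen (hG.contDiffOn_secV i) (by norm_num)).diffAt hG.isOpen
      (by norm_num) hy
  have hsym : pd 0 (pd 1 (fun z ↦ secV Γ w z i)) y = pd 1 (pd 0 (fun z ↦ secV Γ w z i)) y :=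
    pd_comm ((hG.contDiffOn_secV i).contDiffAt (hG.isOpen.mem_nhds hy))
  have key : ∀ b c, pd b (fun z ↦ secDV Γ w c z i) y = pd b (pd c (fun z ↦ secV Γ w z i)) y +
      ∑ j, (pd b (fun z ↦ secV Γ w z j) y * prolong Γ w c y j i +
        secV Γ w y j * pd b (fun z ↦ prolong Γ w c z j i) y) := by
    intro b c
    have h1 : ∀ j ∈ Finset.univ, DifferentiableAt ℝ
        (fun z ↦ secV Γ w z j * prolong Γ w c z j i) y := fun j _ ↦ (hV j).fun_mul (hA c j i)
    unfold secDV
    rw [pd_add (hpV c i) (DifferentiableAt.fun_sum h1), pd_sum _ h1]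
    congr 1
    exact Finset.sum_congr rfl fun j _ ↦ pd_mul (hV j) (hA c j i)
  have hs : ∀ c, Γ 1 0 c y = Γ 0 1 c y := fun c ↦ hG.symm y hy 1 0 c
  have hc : ∑ j, secV Γ w y j * curv (prolong Γ w) y j i =
      3 * w y * beta Γ w y * secV Γ w y i := by
    simp only [hG.curv_prolong hy, Fin.sum_univ_three, Fin.isValue, Fin.reduceEq, if_true, if_false]
    have : secV Γ w y 2 = beta Γ w y := rfl
    rw [this]
    ring
  rw [← hc]
  simp only [secDDV, key, hsym, hs, curv, Matrix.of_apply, Matrix.sub_apply, Matrix.mul_apply,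
    Fin.sum_univ_two, Fin.sum_univ_three]
  simp only [secDV, Fin.sum_univ_three]
  ring

end IsGeometryOn

/-- The `3 × 3` matrix with rows `V`, `D_0 V` and `D_1 V`. -/
def rowsV (Γ : Symbols) (w : Plane → ℝ) (y : Plane) : Matrix (Fin 3) (Fin 3) ℝ :=
  Matrix.of ![secV Γ w y, secDV Γ w 0 y, secDV Γ w 1 y]

namespace IsGeometryOn

variable {Γ : Symbols} {w : Plane → ℝ} {O : Set Plane} (hG : IsGeometryOn Γ w O) {y : Plane}
  (hy : y ∈ O)
include hG hy

/-- The matrix `matM` arises from the rows `V`, `D_a V` by row operations. -/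
theorem rowsV_eq : rowsV Γ w y =
    !![1, 0, 0; - 2 * theta Γ w 0 y, 1, 0; - 2 * theta Γ w 1 y, 0, 1] * matM Γ w y := by
  ext i j
  fin_cases i <;> fin_cases j <;>
    simp [rowsV, hG.secDV_eq hy, matM, Matrix.mul_apply, Fin.sum_univ_three, secV] <;> ring

theorem rank_rowsV : (rowsV Γ w y).rank = (matM Γ w y).rank := by
  rw [hG.rowsV_eq hy]
  refine Matrix.rank_mul_eq_right_of_isUnit_det _ _ ?_
  simp [Matrix.det_fin_three]

theorem det_rowsV : (rowsV Γ w y).det = invN Γ w y := by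
  have h0 := hG.vol_ne_zero y hy
  rw [hG.rowsV_eq hy, Matrix.det_mul]
  simp [Matrix.det_fin_three, matM, invN, epsLow, epsUp, Fin.sum_univ_two]
  field_simp
  ring

end IsGeometryOn

/-! ### Functions with continuous partial derivatives -/

section Partials

/-- The `a`-th coordinate vector of the plane. -/
abbrev unitVec (a : Fin 2) : Plane := EuclideanSpace.single a 1

variable {F : Type*} [NormedAddCommGroup F] [NormedSpace ℝ F] {O : Set Plane}

theorem HasFDerivAt.hasDerivAt_line {f : Plane → F} {f' : Plane →L[ℝ] F} {y v : Plane} {t : ℝ}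
    (h : HasFDerivAt f f' (y + t • v)) : HasDerivAt (fun s : ℝ ↦ f (y + s • v)) (f' v) t := by
  have h1 : HasDerivAt (fun s : ℝ ↦ y + s • v) v t := by
    simpa using! ((hasDerivAt_id t).smul_const v).const_add y
  exact h.comp_hasDerivAt t h1

theorem hasDerivAt_pd {f : Plane → ℝ} {y : Plane} {t : ℝ} {a : Fin 2}
    (h : DifferentiableAt ℝ f (y + t • unitVec a)) :
    HasDerivAt (fun s : ℝ ↦ f (y + s • unitVec a)) (pd a f (y + t • unitVec a)) t :=
  HasFDerivAt.hasDerivAt_line h.hasFDerivAt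

theorem sum_coord_smul_unitVec (v : Plane) : v = v 0 • unitVec 0 + v 1 • unitVec 1 := by
  ext i; fin_cases i <;> simp

/-- The derivative assembled from its values on the coordinate vectors. -/
def derivOfPartials (f' : Fin 2 → F) : Plane →L[ℝ] F :=
  ∑ a, (EuclideanSpace.proj a : Plane →L[ℝ] ℝ).smulRight (f' a)

theorem derivOfPartials_unitVec (f' : Fin 2 → F) (a : Fin 2) :
    derivOfPartials f' (unitVec a) = f' a := by
  fin_cases a <;> simp [derivOfPartials, Fin.sum_univ_two]

/-- The parametrisation of the plane by two real coordinates. -/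
def coordEquiv : Plane ≃L[ℝ] ℝ × ℝ :=
  (EuclideanSpace.equiv (Fin 2) ℝ).trans (ContinuousLinearEquiv.finTwoArrow ℝ ℝ)

theorem coordEquiv_symm_apply (u v : ℝ) :
    coordEquiv.symm (u, v) = u • unitVec 0 + v • unitVec 1 := by
  rw [ContinuousLinearEquiv.symm_apply_eq]
  simp [coordEquiv]

theorem hasFDerivAt_of_partials (hO : IsOpen O) {f : Plane → F} {f' : Fin 2 → Plane → F}
    (h : ∀ y ∈ O, ∀ a, HasDerivAt (fun t : ℝ ↦ f (y + t • unitVec a)) (f' a y) 0)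
    (hc : ∀ a, ContinuousOn (f' a) O) {y : Plane} (hy : y ∈ O) :
    HasFDerivAt f (derivOfPartials fun a ↦ f' a y) y := by
  set φ := coordEquiv.symm with hφ
  have hmem : ∀ᶠ z in 𝓝 (coordEquiv y), φ z ∈ O :=
    φ.continuous.continuousAt.eventually_mem (hO.mem_nhds (by simpa [hφ] using hy))
  have key := hasStrictFDerivAt_uncurry_coprod (𝕜 := ℝ) (u := coordEquiv y)
    (f := fun u v ↦ f (φ (u, v)))
    (f₁ := fun u v ↦ ContinuousLinearMap.toSpanSingleton ℝ (f' 0 (φ (u, v))))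
    (f₂ := fun u v ↦ ContinuousLinearMap.toSpanSingleton ℝ (f' 1 (φ (u, v)))) ?_ ?_ ?_ ?_
  · have h1 : HasFDerivAt (fun z ↦ f (φ z)) _ (coordEquiv y) := key.hasFDerivAt
    have h2 := h1.comp y coordEquiv.hasFDerivAt
    have e1 : (fun z ↦ f (φ z)) ∘ coordEquiv = f := by ext z; simp [hφ]
    rw [e1] at h2
    refine h2.congr_fderiv ?_
    ext v
    have e2 : φ (coordEquiv y) = y := by simp [hφ]
    simp only [Function.HasUncurry.uncurry, id, Prod.mk.eta, e2]
    simp [derivOfPartials, Fin.sum_univ_two, coordEquiv]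
  · filter_upwards [hmem] with z hz
    have := h _ hz 0
    have h3 := hasDerivAt_iff_hasFDerivAt.1
      (HasDerivAt.comp_sub_const z.1 z.1 (by simpa using this))
    refine (h3.congr_of_eventuallyEq (Filter.Eventually.of_forall fun s ↦ ?_)).congr_fderiv ?_
    · simp only [hφ]
      congr 1
      rw [← Prod.mk.eta (p := z)]
      simp only [coordEquiv_symm_apply]
      module
    · rfl
  · filter_upwards [hmem] with z hz
    have := h _ hz 1
    have h3 := hasDerivAt_iff_hasFDerivAt.1
      (HasDerivAt.comp_sub_const z.2 z.2 (by simpa using this))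
    refine (h3.congr_of_eventuallyEq (Filter.Eventually.of_forall fun s ↦ ?_)).congr_fderiv ?_
    · simp only [hφ]
      congr 1
      rw [← Prod.mk.eta (p := z)]
      simp only [coordEquiv_symm_apply]
      module
    · rfl
  all_goals
    refine ((ContinuousLinearMap.toSpanSingletonCLE (𝕜 := ℝ) (E := F)).continuous.continuousAt.comp
      (ContinuousAt.comp (f := fun z : ℝ × ℝ ↦ φ z) ?_ φ.continuous.continuousAt))
    have e2 : φ (coordEquiv y) = y := by simp [hφ]
    rw [e2]
  exacts [(hc 0).continuousAt (hO.mem_nhds hy), (hc 1).continuousAt (hO.mem_nhds hy)]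

theorem contDiffOn_one_of_partials (hO : IsOpen O) {f : Plane → F} {f' : Fin 2 → Plane → F}
    (h : ∀ y ∈ O, ∀ a, HasDerivAt (fun t : ℝ ↦ f (y + t • unitVec a)) (f' a y) 0)
    (hc : ∀ a, ContinuousOn (f' a) O) : ContDiffOn ℝ 1 f O := by
  have h1 := fun y (hy : y ∈ O) ↦ hasFDerivAt_of_partials hO h hc hy
  refine (contDiffOn_succ_iff_fderiv_of_isOpen (n := 0) hO).2 ⟨fun y hy ↦
    (h1 y hy).differentiableAt.differentiableWithinAt, by simp, contDiffOn_zero.2 ?_⟩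
  refine ContinuousOn.congr (f := fun y ↦ derivOfPartials fun a ↦ f' a y) ?_
    fun y hy ↦ (h1 y hy).fderiv
  refine continuousOn_finsetSum _ fun a _ ↦ ?_
  exact ((ContinuousLinearMap.smulRightL ℝ Plane F
    (EuclideanSpace.proj a : Plane →L[ℝ] ℝ)).continuous.comp_continuousOn (hc a))

theorem pd_eq_of_partials (hO : IsOpen O) {f : Plane → ℝ} {f' : Fin 2 → Plane → ℝ}
    (h : ∀ y ∈ O, ∀ a, HasDerivAt (fun t : ℝ ↦ f (y + t • unitVec a)) (f' a y) 0)
    (hc : ∀ a, ContinuousOn (f' a) O) {y : Plane} (hy : y ∈ O) (a : Fin 2) :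
    pd a f y = f' a y := by
  rw [pd, (hasFDerivAt_of_partials hO h hc hy).fderiv]
  exact derivOfPartials_unitVec _ a

/-- The symmetry of mixed partial derivatives, existence included: if `f` and `∂_a f` are of
class `C^1`, then `∂_b f` has a partial derivative in the direction `a`. -/
theorem hasDerivAt_pd_of_contDiffOn_pd (hO : IsOpen O) {f : Plane → ℝ} {a b : Fin 2}
    (hf : ContDiffOn ℝ 1 f O) (hg : ContDiffOn ℝ 1 (pd a f) O) {y : Plane} (hy : y ∈ O) :
    HasDerivAt (fun t : ℝ ↦ pd b f (y + t • unitVec a)) (pd b (pd a f) y) 0 := by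
  have hgs : HasStrictFDerivAt (pd a f) (fderiv ℝ (pd a f) y) y :=
    (hg.contDiffAt (hO.mem_nhds hy)).hasStrictFDerivAt one_ne_zero
  have hd : ∀ z ∈ O, DifferentiableAt ℝ f z := fun z hz ↦ hf.diffAt hO one_ne_zero hz
  rw [hasDerivAt_iff_isLittleO, Asymptotics.isLittleO_iff]
  intro ε hε
  have h1 := hgs.isLittleO.def hε
  rw [nhds_prod_eq] at h1
  obtain ⟨P, hP, P', hP', hPε⟩ := Filter.eventually_prod_iff.1 h1
  obtain ⟨r, hr, hball⟩ := Metric.eventually_nhds_iff_ball.1 ((hP.and hP').and (hO.mem_nhds hy))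
  have hmem : ∀ s k : ℝ, |s| < r / 2 → |k| < r / 2 →
      y + s • unitVec a + k • unitVec b ∈ Metric.ball y r := by
    intro s k hs hk
    rw [mem_ball_iff_norm]
    calc ‖y + s • unitVec a + k • unitVec b - y‖ = ‖s • unitVec a + k • unitVec b‖ := by
          congr 1; abel
      _ ≤ ‖s • unitVec a‖ + ‖k • unitVec b‖ := norm_add_le _ _
      _ = |s| + |k| := by simp [norm_smul]
      _ < r := by linarith
  filter_upwards [Metric.ball_mem_nhds (0 : ℝ) (half_pos hr)] with t ht
  rw [Metric.mem_ball, dist_zero_right, Real.norm_eq_abs] at ht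
  -- the second difference quotient, bounded by the mean value inequality in the direction `a`
  have hbound : ∀ k : ℝ, |k| < r / 2 →
      ‖(f (y + t • unitVec a + k • unitVec b) - f (y + t • unitVec a) - t * (k * pd b (pd a f) y))
        - (f (y + k • unitVec b) - f y)‖ ≤ ε * |t| * |k| := by
    intro k hk
    have hu : ∀ s ∈ Set.uIcc 0 t, HasDerivWithinAt
        (fun s : ℝ ↦ f (y + s • unitVec a + k • unitVec b) - f (y + s • unitVec a)
          - s * (k * pd b (pd a f) y))
        (pd a f (y + s • unitVec a + k • unitVec b) - pd a f (y + s • unitVec a)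
          - k * pd b (pd a f) y) (Set.uIcc 0 t) s := by
      intro s hs
      have hs' : |s| < r / 2 := lt_of_le_of_lt (by
        rcases Set.mem_uIcc.1 hs with h | h
        · rw [abs_of_nonneg h.1]; exact h.2.trans (le_abs_self _)
        · rw [abs_of_nonpos h.2, abs_of_nonpos (h.1.trans h.2)]; linarith) ht
      have e1 : HasDerivAt (fun s : ℝ ↦ f (y + s • unitVec a)) _ s :=
        hasDerivAt_pd (hd _ (by
          have := (hball _ (hmem s 0 hs' (by simpa using half_pos hr))).2
          rwa [zero_smul, add_zero] at this))
      have e2 : HasDerivAt (fun s : ℝ ↦ f (y + k • unitVec b + s • unitVec a)) _ s :=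
        hasDerivAt_pd (hd _ (by
          have := (hball _ (hmem s k hs' hk)).2
          rwa [add_right_comm] at this))
      simp only [add_right_comm y (k • unitVec b)] at e2
      have := (e2.fun_sub e1).fun_sub ((hasDerivAt_id s).mul_const (k * pd b (pd a f) y))
      simpa using this.hasDerivWithinAt
    have hb : ∀ s ∈ Set.uIcc 0 t, ‖pd a f (y + s • unitVec a + k • unitVec b)
        - pd a f (y + s • unitVec a) - k * pd b (pd a f) y‖ ≤ ε * |k| := by
      intro s hs
      have hs' : |s| < r / 2 := lt_of_le_of_lt (by
        rcases Set.mem_uIcc.1 hs with h | h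
        · rw [abs_of_nonneg h.1]; exact h.2.trans (le_abs_self _)
        · rw [abs_of_nonpos h.2, abs_of_nonpos (h.1.trans h.2)]; linarith) ht
      have m1 := (hball _ (hmem s k hs' hk)).1.1
      have m2 := (hball _ (hmem s 0 hs' (by simpa using half_pos hr))).1.2
      rw [zero_smul, add_zero] at m2
      have := hPε m1 m2
      rw [add_sub_cancel_left, map_smul, norm_smul] at this
      simpa [pd] using this
    have := (convex_uIcc 0 t).norm_image_sub_le_of_norm_hasDerivWithin_le hu hb
      Set.left_mem_uIcc Set.right_mem_uIcc
    simp only [zero_smul, add_zero, zero_mul, sub_zero, Real.norm_eq_abs] at this ⊢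
    linarith
  have hd1 : HasDerivAt (fun k : ℝ ↦
      (f (y + t • unitVec a + k • unitVec b) - f (y + t • unitVec a) - t * (k * pd b (pd a f) y))
        - (f (y + k • unitVec b) - f y))
      (pd b f (y + t • unitVec a) - t * pd b (pd a f) y - pd b f y) 0 := by
    have e1 : HasDerivAt (fun k : ℝ ↦ f (y + t • unitVec a + k • unitVec b)) _ 0 :=
      hasDerivAt_pd (hd _ (hball _ (hmem t 0 ht (by simpa using half_pos hr))).2)
    have e2 : HasDerivAt (fun k : ℝ ↦ f (y + k • unitVec b)) _ 0 :=
      hasDerivAt_pd (hd _ (by simpa using hy))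
    have e3 : HasDerivAt (fun k : ℝ ↦ t * (k * pd b (pd a f) y)) (t * (1 * pd b (pd a f) y)) 0 :=
      ((hasDerivAt_id (0 : ℝ)).mul_const _).const_mul t
    simp only [zero_smul, add_zero, one_mul] at e1 e2 e3
    exact ((e1.sub_const _).fun_sub e3).fun_sub (e2.sub_const _)
  have hle := hd1.le_of_lip' (C := ε * |t|) (by positivity) (by
    filter_upwards [Metric.ball_mem_nhds (0 : ℝ) (half_pos hr)] with k hk
    rw [Metric.mem_ball, dist_zero_right, Real.norm_eq_abs] at hk
    simpa using hbound k hk)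
  simp only [zero_smul, add_zero, sub_zero, smul_eq_mul, Real.norm_eq_abs] at hle ⊢
  convert hle using 2
  ring

theorem pd_comm_of_contDiffOn (hO : IsOpen O) {f : Plane → ℝ} {a b : Fin 2}
    (hf : ContDiffOn ℝ 1 f O) (ha : ContDiffOn ℝ 1 (pd a f) O) (hb : ContDiffOn ℝ 1 (pd b f) O)
    {y : Plane} (hy : y ∈ O) : pd a (pd b f) y = pd b (pd a f) y := by
  have h1 : HasDerivAt (fun t : ℝ ↦ pd b f (y + t • unitVec a)) _ 0 :=
    hasDerivAt_pd (hb.diffAt hO one_ne_zero (by simpa using hy))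
  simpa using h1.unique (hasDerivAt_pd_of_contDiffOn_pd hO hf ha hy)

end Partials

/-! ### Parallel sections of a linear system -/

/-- `Ψ` is of class `C^1` on `O` and solves the linear system `∂_a Ψ = A_a Ψ` there. -/
structure IsParallelOn (A : Fin 2 → Plane → Matrix (Fin 3) (Fin 3) ℝ) (Ψ : Plane → Fin 3 → ℝ)
    (O : Set Plane) : Prop where
  contDiffOn : ∀ i, ContDiffOn ℝ 1 (fun y ↦ Ψ y i) O
  pd_eq : ∀ y ∈ O, ∀ a i, pd a (fun z ↦ Ψ z i) y = ∑ j, A a y i j * Ψ y j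

namespace IsParallelOn

variable {A : Fin 2 → Plane → Matrix (Fin 3) (Fin 3) ℝ} {Ψ : Plane → Fin 3 → ℝ}
    {O : Set Plane} {y : Plane}

/-- The integrability condition: a parallel section is annihilated by the curvature. -/
theorem curv_mul_eq_zero (hO : IsOpen O) (hA : ∀ a i j, ContDiffOn ℝ 1 (fun y ↦ A a y i j) O)
    (h : IsParallelOn A Ψ O) (hy : y ∈ O) (i : Fin 3) : ∑ j, curv A y i j * Ψ y j = 0 := by
  have hΨ : ∀ j, DifferentiableAt ℝ (fun z ↦ Ψ z j) y := fun j ↦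
    (h.contDiffOn j).diffAt hO one_ne_zero hy
  have hA' : ∀ a i j, DifferentiableAt ℝ (fun z ↦ A a z i j) y := fun a i j ↦
    (hA a i j).diffAt hO one_ne_zero hy
  have hpd : ∀ a, ContDiffOn ℝ 1 (pd a (fun z ↦ Ψ z i)) O := fun a ↦
    (ContDiffOn.sum fun j _ ↦ (hA a i j).mul (h.contDiffOn j)).congr fun z hz ↦ h.pd_eq z hz a i
  have hcomm := pd_comm_of_contDiffOn hO (h.contDiffOn i) (hpd 0) (hpd 1) hy
  have key : ∀ b c, pd b (pd c (fun z ↦ Ψ z i)) y = ∑ j,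
      (pd b (fun z ↦ A c z i j) y * Ψ y j + A c y i j * ∑ k, A b y j k * Ψ y k) := by
    intro b c
    rw [pd_congr_of_eqOn hO (fun z hz ↦ h.pd_eq z hz c i) hy,
      pd_sum _ fun j _ ↦ (hA' c i j).fun_mul (hΨ j)]
    refine Finset.sum_congr rfl fun j _ ↦ ?_
    rw [pd_mul (hA' c i j) (hΨ j), h.pd_eq y hy]
  rw [key, key] at hcomm
  simp only [curv, Matrix.of_apply, Matrix.sub_apply, Matrix.mul_apply, Fin.sum_univ_three]
    at hcomm ⊢
  linear_combination hcomm

/-- The Leibniz rule for the pairing of a parallel section with a section of the dual bundle. -/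
theorem pd_pairing (hO : IsOpen O) (h : IsParallelOn A Ψ O) {σ : Plane → Fin 3 → ℝ} (hy : y ∈ O)
    (hσ : ∀ i, DifferentiableAt ℝ (fun z ↦ σ z i) y) (a : Fin 2) :
    pd a (fun z ↦ ∑ i, σ z i * Ψ z i) y =
      ∑ i, (pd a (fun z ↦ σ z i) y + ∑ j, σ y j * A a y j i) * Ψ y i := by
  have hΨ : ∀ j, DifferentiableAt ℝ (fun z ↦ Ψ z j) y := fun j ↦
    (h.contDiffOn j).diffAt hO one_ne_zero hy
  rw [pd_sum _ fun j _ ↦ (hσ j).fun_mul (hΨ j)]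
  simp only [pd_mul (hσ _) (hΨ _), h.pd_eq y hy, Fin.sum_univ_three]
  ring

theorem pairing_deriv_eq_zero (hO : IsOpen O) (h : IsParallelOn A Ψ O) {σ : Plane → Fin 3 → ℝ}
    (hσ : ∀ i, ContDiffOn ℝ 1 (fun z ↦ σ z i) O) (h0 : ∀ y ∈ O, ∑ i, σ y i * Ψ y i = 0)
    (hy : y ∈ O) (a : Fin 2) :
      ∑ i, (pd a (fun z ↦ σ z i) y + ∑ j, σ y j * A a y j i) * Ψ y i = 0 := by
  rw [← h.pd_pairing hO hy fun i ↦ (hσ i).diffAt hO one_ne_zero hy,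
    pd_congr_of_eqOn hO (g := fun _ ↦ 0) h0 hy, pd_const]

/-- A parallel section that vanishes at a point vanishes near it. -/
theorem eventually_eq_zero (hO : IsOpen O) (hA : ∀ a i j, ContDiffOn ℝ 1 (fun y ↦ A a y i j) O)
    (h : IsParallelOn A Ψ O) (hy : y ∈ O) (h0 : Ψ y = 0) : ∀ᶠ z in 𝓝 y, Ψ z = 0 := by
  have hb : ∀ a i j, ∀ᶠ z in 𝓝 y, |A a z i j| < |A a y i j| + 1 := fun a i j ↦
    (((hA a i j).continuousOn.continuousAt (hO.mem_nhds hy)).abs).eventually_lt_const (by simp)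
  simp only [← Filter.eventually_all] at hb
  obtain ⟨r, hr, hball⟩ := Metric.eventually_nhds_iff_ball.1 (hb.and (hO.mem_nhds hy))
  set C := ∑ a, ∑ i, ∑ j, (|A a y i j| + 1) with hC
  have hAC : ∀ z ∈ Metric.ball y r, ∀ a i j, |A a z i j| ≤ C := by
    intro z hz a i j
    refine ((hball z hz).1 a i j).le.trans ?_
    rw [hC]
    refine le_trans ?_ (Finset.single_le_sum (f := fun a ↦ ∑ i, ∑ j, (|A a y i j| + 1))
      (fun _ _ ↦ by positivity) (Finset.mem_univ a))
    refine le_trans ?_ (Finset.single_le_sum (f := fun i ↦ ∑ j, (|A a y i j| + 1))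
      (fun _ _ ↦ by positivity) (Finset.mem_univ i))
    exact Finset.single_le_sum (f := fun j ↦ (|A a y i j| + 1))
      (fun _ _ ↦ by positivity) (Finset.mem_univ j)
  have hC0 : 0 ≤ C := by positivity
  filter_upwards [Metric.ball_mem_nhds y hr] with z hz
  have hseg : ∀ t ∈ Set.Icc (0 : ℝ) 1, y + t • (z - y) ∈ Metric.ball y r := by
    intro t ht
    rw [mem_ball_iff_norm] at hz ⊢
    rw [add_sub_cancel_left, norm_smul, Real.norm_of_nonneg ht.1]
    nlinarith [norm_nonneg (z - y), ht.2]
  -- the equation along the segment from `y` to `z`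
  have hder : ∀ t ∈ Set.Icc (0 : ℝ) 1, HasDerivAt (fun t : ℝ ↦ Ψ (y + t • (z - y)))
      (fun i ↦ ∑ a, (z - y) a * ∑ j, A a (y + t • (z - y)) i j * Ψ (y + t • (z - y)) j) t := by
    intro t ht
    rw [hasDerivAt_pi]
    intro i
    have hm := (hball _ (hseg t ht)).2
    have := HasFDerivAt.hasDerivAt_line ((h.contDiffOn i).diffAt hO one_ne_zero hm).hasFDerivAt
    convert this using 1
    have e := sum_coord_smul_unitVec (z - y)
    rw [e]
    simp only [map_add, map_smul, smul_eq_mul, Fin.sum_univ_two]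
    rw [← e]
    have e0 := h.pd_eq _ hm 0 i
    have e1 := h.pd_eq _ hm 1 i
    simp only [pd] at e0 e1
    rw [e0, e1]
  have := eq_zero_of_abs_deriv_le_mul_abs_self_of_eq_zero_right
    (f := fun t : ℝ ↦ Ψ (y + t • (z - y))) (K := ∑ a, |(z - y) a| * (3 * C)) (a := 0) (b := 1)
    (fun t ht ↦ (hder t ht).continuousAt.continuousWithinAt)
    (fun t ht ↦ (hder t ⟨ht.1, ht.2.le⟩).hasDerivWithinAt) (by simpa using h0) ?_ 1 (by simp)
  · simpa using this
  · intro t ht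
    refine (pi_norm_le_iff_of_nonneg (by positivity)).2 fun i ↦ ?_
    rw [Finset.sum_mul]
    refine norm_sum_le_of_le _ fun a _ ↦ ?_
    rw [norm_mul, mul_assoc]
    refine mul_le_mul_of_nonneg_left ?_ (abs_nonneg _)
    have : ∀ j ∈ Finset.univ, ‖A a (y + t • (z - y)) i j * Ψ (y + t • (z - y)) j‖ ≤
        C * ‖Ψ (y + t • (z - y))‖ := fun j _ ↦ by
      rw [norm_mul]
      exact mul_le_mul (hAC _ (hseg t ⟨ht.1, ht.2.le⟩) a i j) (norm_le_pi_norm _ j)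
        (norm_nonneg _) hC0
    refine (norm_sum_le_of_le _ this).trans ?_
    simp
    linarith

end IsParallelOn

/-! ### Prolongation of the Killing equation -/

/-- The one-form with components `K a` satisfies `∇_{(a} K_{b)} = 0` on `O`. -/
def IsKillingComp (Γ : Symbols) (K : Fin 2 → Plane → ℝ) (O : Set Plane) : Prop :=
  ∀ y ∈ O, ∀ a b, pd a (K b) y + pd b (K a) y = 2 * ∑ c, Γ a b c y * K c y

/-- The section `(K_1, K_2, μ)` of the prolongation bundle attached to a one-form `K`, where
`μ = (∇_0 K_1) / ε_{01}`; if `K` solves the Killing equation then `∇_a K_b = ε_{ab} μ`. -/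
def killingSection (Γ : Symbols) (w : Plane → ℝ) (K : Fin 2 → Plane → ℝ) (y : Plane) :
    Fin 3 → ℝ :=
  ![K 0 y, K 1 y, (pd 0 (K 1) y - ∑ c, Γ 0 1 c y * K c y) / w y]

namespace IsGeometryOn

variable {Γ : Symbols} {w : Plane → ℝ} {O : Set Plane} (hG : IsGeometryOn Γ w O)
include hG

/-- A solution `K` of class `C^1` of the Killing equation is of class `C^2`: every second partial
derivative can be expressed by first partial derivatives of `Γ_{ab}^c K_c`.  Only the derivative
`∂_0 K_1` needs an argument, as `∂_0 K_0` and `∂_1 K_1` are given by the equation. -/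
theorem contDiffOn_pd_killing {K : Fin 2 → Plane → ℝ} (hK : ∀ a, ContDiffOn ℝ 1 (K a) O)
    (h : IsKillingComp Γ K O) : ContDiffOn ℝ 1 (pd 0 (K 1)) O := by
  have hO := hG.isOpen
  have hΓK : ∀ a b, ContDiffOn ℝ 1 (fun y ↦ ∑ c, Γ a b c y * K c y) O := fun a b ↦
    ContDiffOn.sum fun c _ ↦ (hG.symbols (by norm_num) a b c).mul (hK c)
  have h00 : ContDiffOn ℝ 1 (pd 0 (K 0)) O := (hΓK 0 0).congr fun y hy ↦ by
    linarith [h y hy 0 0]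
  have h11 : ContDiffOn ℝ 1 (pd 1 (K 1)) O := (hΓK 1 1).congr fun y hy ↦ by
    linarith [h y hy 1 1]
  have h01 : ∀ y ∈ O, pd 0 (K 1) y = 2 * (∑ c, Γ 0 1 c y * K c y) - pd 1 (K 0) y := fun y hy ↦ by
    linarith [h y hy 0 1]
  refine contDiffOn_one_of_partials (f' := ![fun y ↦ 2 * pd 0 (fun y ↦ ∑ c, Γ 0 1 c y * K c y) y
      - pd 1 (pd 0 (K 0)) y, pd 0 (pd 1 (K 1))]) hO (fun y hy a ↦ ?_) fun a ↦ ?_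
  · fin_cases a
    · have e1 := hasDerivAt_pd_of_contDiffOn_pd hO (b := 1) (hK 0) h00 hy
      have e2 := (hasDerivAt_pd (a := 0) (t := 0)
        ((hΓK 0 1).diffAt hO one_ne_zero (by simpa using hy))).const_mul (2 : ℝ)
      have e3 := e2.fun_sub e1
      simp only [zero_smul, add_zero] at e3
      refine e3.congr_of_eventuallyEq ?_
      have : ∀ᶠ t : ℝ in 𝓝 0, y + t • unitVec 0 ∈ O := by
        have hc : ContinuousAt (fun t : ℝ ↦ y + t • unitVec 0) 0 := by fun_prop
        exact hc.eventually_mem (hO.mem_nhds (by simpa using hy))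
      filter_upwards [this] with t ht
      exact h01 _ ht
    · exact hasDerivAt_pd_of_contDiffOn_pd hO (hK 1) h11 hy
  · have c0 : ∀ {f : Plane → ℝ} {b : Fin 2}, ContDiffOn ℝ 1 f O → ContinuousOn (pd b f) O :=
      fun hf ↦ (contDiffOn_pd (m := 0) hO hf (by norm_num)).continuousOn
    fin_cases a
    · exact (continuousOn_const.mul (c0 (hΓK 0 1))).sub (c0 h00)
    · exact c0 h11

/-- Prolongation: solutions of the Killing equation give parallel sections.  The equation for `μ`
comes from commuting the second derivatives of `K`. -/
theorem isParallelOn_killingSection {K : Fin 2 → Plane → ℝ} (hK : ∀ a, ContDiffOn ℝ 1 (K a) O)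
    (h : IsKillingComp Γ K O) : IsParallelOn (prolong Γ w) (killingSection Γ w K) O := by
  have hO := hG.isOpen
  have hΓK : ∀ a b, ContDiffOn ℝ 1 (fun y ↦ ∑ c, Γ a b c y * K c y) O := fun a b ↦
    ContDiffOn.sum fun c _ ↦ (hG.symbols (by norm_num) a b c).mul (hK c)
  have h01 := hG.contDiffOn_pd_killing hK h
  have hμ : ContDiffOn ℝ 1 (fun y ↦ killingSection Γ w K y 2) O :=
    (h01.sub (hΓK 0 1)).div (hG.contDiffOn_vol.of_le (by norm_num)) hG.vol_ne_zero
  have hC : ∀ i, ContDiffOn ℝ 1 (fun y ↦ killingSection Γ w K y i) O := by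
    intro i
    fin_cases i
    exacts [hK 0, hK 1, hμ]
  set μ : Plane → ℝ := fun y ↦ killingSection Γ w K y 2 with hμdef
  -- the first two rows of the system: `∇_a K_b = ε_{ab} μ`
  have hrow : ∀ a b, ∀ y ∈ O, pd a (K b) y = ∑ c, Γ a b c y * K c y + perm a b * (w y * μ y) := by
    intro a b y hy
    have hm : w y * μ y = pd 0 (K 1) y - ∑ c, Γ 0 1 c y * K c y := by
      have := hG.vol_ne_zero y hy
      simp only [hμdef, killingSection, Matrix.cons_val]
      field_simp
    have hs : ∀ c, Γ 1 0 c y = Γ 0 1 c y := fun c ↦ hG.symm y hy 1 0 c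
    rw [hm]
    have k00 := h y hy 0 0
    have k11 := h y hy 1 1
    have k10 := h y hy 0 1
    simp only [Fin.sum_univ_two] at *
    fin_cases a <;> fin_cases b <;> simp [hs] <;> linarith
  have hKc : ∀ b, ∀ y ∈ O, pd 0 (pd 1 (K b)) y = pd 1 (pd 0 (K b)) y := by
    intro b y hy
    have hp : ∀ a, ContDiffOn ℝ 1 (pd a (K b)) O := fun a ↦
      ((hΓK a b).add (contDiffOn_const.mul
        ((hG.contDiffOn_vol.of_le (by norm_num)).mul hμ))).congr (hrow a b)
    exact pd_comm_of_contDiffOn hO (hK b) (hp 0) (hp 1) hy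
  refine ⟨hC, fun y hy a i ↦ ?_⟩
  have h0 := hG.vol_ne_zero y hy
  have hs : ∀ c, Γ 1 0 c y = Γ 0 1 c y := fun c ↦ hG.symm y hy 1 0 c
  have hKd : ∀ b, DifferentiableAt ℝ (K b) y := fun b ↦ (hK b).diffAt hO one_ne_zero hy
  have hμd : DifferentiableAt ℝ μ y := hμ.diffAt hO one_ne_zero hy
  have hwd := hG.diff_vol hy
  -- second derivatives, computed from the first two rows
  have hsec : ∀ a b c, pd a (pd b (K c)) y =
      ∑ d, (pd a (Γ b c d) y * K d y + Γ b c d y * pd a (K d) y) +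
        perm b c * (pd a w y * μ y + w y * pd a μ y) := by
    intro a b c
    have hd : ∀ d ∈ Finset.univ, DifferentiableAt ℝ (fun z ↦ Γ b c d z * K d z) y := fun d _ ↦
      (hG.diff_symbols hy b c d).fun_mul (hKd d)
    rw [pd_congr_of_eqOn hO (hrow b c) hy, pd_add (DifferentiableAt.fun_sum hd)
      ((hwd.fun_mul hμd).const_mul _), pd_sum _ hd, pd_const_mul _ (hwd.fun_mul hμd),
      pd_mul hwd hμd]
    congr 1
    exact Finset.sum_congr rfl fun d _ ↦ pd_mul (hG.diff_symbols hy b c d) (hKd d)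
  have e00 : prolong Γ w a y 0 0 = Γ a 0 0 y := rfl
  have e01 : prolong Γ w a y 0 1 = Γ a 0 1 y := rfl
  have e02 : prolong Γ w a y 0 2 = perm a 0 * w y := rfl
  have e10 : prolong Γ w a y 1 0 = Γ a 1 0 y := rfl
  have e11 : prolong Γ w a y 1 1 = Γ a 1 1 y := rfl
  have e12 : prolong Γ w a y 1 2 = perm a 1 * w y := rfl
  have e22 : prolong Γ w a y 2 2 = - theta Γ w a y := rfl
  have k0 : killingSection Γ w K y 0 = K 0 y := rfl
  have k1 : killingSection Γ w K y 1 = K 1 y := rfl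
  have k2 : killingSection Γ w K y 2 = μ y := rfl
  rw [Fin.sum_univ_three, k0, k1, k2]
  fin_cases i
  · have := hrow a 0 y hy
    rw [Fin.sum_univ_two] at this
    change pd a (K 0) y = prolong Γ w a y 0 0 * K 0 y + prolong Γ w a y 0 1 * K 1 y +
      prolong Γ w a y 0 2 * μ y
    rw [e00, e01, e02, this]
    ring
  · have := hrow a 1 y hy
    rw [Fin.sum_univ_two] at this
    change pd a (K 1) y = prolong Γ w a y 1 0 * K 0 y + prolong Γ w a y 1 1 * K 1 y +
      prolong Γ w a y 1 2 * μ y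
    rw [e10, e11, e12, this]
    ring
  · change pd a μ y = prolong Γ w a y 2 0 * K 0 y + prolong Γ w a y 2 1 * K 1 y +
      prolong Γ w a y 2 2 * μ y
    have hR : ∀ c d, riem Γ 0 1 c d y = _ := fun c d ↦ hG.riem_eq hy 0 1 c d
    have c0 := hKc 0 y hy
    have c1 := hKc 1 y hy
    rw [hsec, hsec] at c0 c1
    have hr := fun a b ↦ hrow a b y hy
    simp only [riem, Fin.sum_univ_two, hs] at hR hr
    simp only [Fin.sum_univ_two, hr, hs, perm_zero_zero, perm_zero_one, perm_one_zero,
      perm_one_one] at c0 c1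
    rw [hG.prolong_two_zero hy, hG.prolong_two_one hy, e22, hG.theta_eq hy]
    fin_cases a
    · have r0 := hR 0 0
      have r1 := hR 1 0
      simp [hs] at r0 r1 ⊢
      field_simp
      linear_combination -c0 + r0 * K 0 y + r1 * K 1 y
    · have r0 := hR 0 1
      have r1 := hR 1 1
      simp [hs] at r0 r1 ⊢
      field_simp
      linear_combination -c1 + r0 * K 0 y + r1 * K 1 y

theorem isKillingComp_of_isParallelOn {Ψ : Plane → Fin 3 → ℝ}
    (h : IsParallelOn (prolong Γ w) Ψ O) :
    IsKillingComp Γ ![fun y ↦ Ψ y 0, fun y ↦ Ψ y 1] O := by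
  intro y hy a b
  have hs : ∀ c, Γ 1 0 c y = Γ 0 1 c y := fun c ↦ hG.symm y hy 1 0 c
  have e0 := fun a ↦ h.pd_eq y hy a 0
  have e1 := fun a ↦ h.pd_eq y hy a 1
  simp only [Fin.sum_univ_three] at e0 e1
  fin_cases a <;> fin_cases b <;>
    simp [e0, e1, prolong, epsLow, Fin.sum_univ_two, hs] <;> ring

theorem killingSection_of_isParallelOn {Ψ : Plane → Fin 3 → ℝ}
    (h : IsParallelOn (prolong Γ w) Ψ O) {y : Plane} (hy : y ∈ O) :
    killingSection Γ w ![fun y ↦ Ψ y 0, fun y ↦ Ψ y 1] y = Ψ y := by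
  have h0 := hG.vol_ne_zero y hy
  have e1 := h.pd_eq y hy 0 1
  simp only [Fin.sum_univ_three] at e1
  ext i
  fin_cases i
  · rfl
  · rfl
  · simp [killingSection, e1, prolong, epsLow, Fin.sum_univ_two]
    field_simp

/-- A parallel section is annihilated by the curvature, hence by `V`. -/
theorem secV_pairing {Ψ : Plane → Fin 3 → ℝ} (h : IsParallelOn (prolong Γ w) Ψ O) {y : Plane}
    (hy : y ∈ O) : ∑ i, secV Γ w y i * Ψ y i = 0 := by
  have h1 := h.curv_mul_eq_zero hG.isOpen hG.contDiffOn_prolong hy 2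
  have h0 := hG.vol_ne_zero y hy
  simp only [hG.curv_prolong hy, if_true, mul_assoc, ← Finset.mul_sum] at h1
  simpa [h0] using h1

theorem secDV_pairing {Ψ : Plane → Fin 3 → ℝ} (h : IsParallelOn (prolong Γ w) Ψ O) {y : Plane}
    (hy : y ∈ O) (a : Fin 2) : ∑ i, secDV Γ w a y i * Ψ y i = 0 :=
  h.pairing_deriv_eq_zero hG.isOpen (fun i ↦ (hG.contDiffOn_secV i).of_le (by norm_num))
    (fun _ hz ↦ hG.secV_pairing h hz) hy a

theorem secDDV_pairing {Ψ : Plane → Fin 3 → ℝ} (h : IsParallelOn (prolong Γ w) Ψ O) {y : Plane}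
    (hy : y ∈ O) (b c : Fin 2) : ∑ i, secDDV Γ w b c y i * Ψ y i = 0 := by
  have h1 := h.pairing_deriv_eq_zero hG.isOpen (hG.contDiffOn_secDV c)
    (fun _ hz ↦ hG.secDV_pairing h hz c) hy b
  have h2 := hG.secDV_pairing h hy
  simp only [secDDV, Fin.sum_univ_two, Fin.sum_univ_three] at h1 h2 ⊢
  linear_combination h1 - Γ b c 0 y * h2 0 - Γ b c 1 y * h2 1

theorem rowsV_mulVec {Ψ : Plane → Fin 3 → ℝ} (h : IsParallelOn (prolong Γ w) Ψ O) {y : Plane}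
    (hy : y ∈ O) : Matrix.mulVec (rowsV Γ w y) (Ψ y) = 0 := by
  ext i
  fin_cases i
  exacts [hG.secV_pairing h hy, hG.secDV_pairing h hy 0, hG.secDV_pairing h hy 1]

theorem invN_eq_zero_of_mulVec {x : Fin 3 → ℝ} {y : Plane} (hy : y ∈ O) (hx : x ≠ 0)
    (h : Matrix.mulVec (rowsV Γ w y) x = 0) : invN Γ w y = 0 := by
  rw [← hG.det_rowsV hy]
  exact Matrix.exists_mulVec_eq_zero_iff.1 ⟨x, hx, h⟩

theorem invS_eq_zero_of_isParallelOn {Ψ : Plane → Fin 3 → ℝ}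
    (h : IsParallelOn (prolong Γ w) Ψ O) {y : Plane} (hy : y ∈ O) (h0 : Ψ y ≠ 0)
    (a b c : Fin 2) : invS Γ w a b c y = 0 := by
  refine Matrix.exists_mulVec_eq_zero_iff.1 ⟨Ψ y, h0, ?_⟩
  ext i
  fin_cases i
  · exact hG.secV_pairing h hy
  · exact hG.secDV_pairing h hy a
  · have h1 := hG.secDDV_pairing h hy b c
    have h2 := hG.secDDV_pairing h hy c b
    simp only [Fin.sum_univ_three] at h1 h2
    simp [Matrix.mulVec, dotProduct, Fin.sum_univ_three]
    linear_combination 1 / 2 * h1 + 1 / 2 * h2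

end IsGeometryOn

/-! ### Linear systems on a small square -/

section Frobenius

open Set

variable {E : Type*} [NormedAddCommGroup E] [NormedSpace ℝ E]

/-- A linear equation has a solution on any interval that is short in terms of a bound of its
coefficients; `2 C δ ≤ 1` keeps the solution in the ball of radius `‖x₀‖` about `x₀`. -/
theorem exists_solution_linear_ode [CompleteSpace E] {B : ℝ → E →L[ℝ] E} {δ C : ℝ} (hδ : 0 ≤ δ)
    (hC : 0 ≤ C) (hB : ContinuousOn B (Icc (-δ) δ)) (hBC : ∀ t ∈ Icc (-δ) δ, ‖B t‖ ≤ C)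
    (hCδ : 2 * C * δ ≤ 1) (x₀ : E) : ∃ f : ℝ → E, f 0 = x₀ ∧
      ∀ t ∈ Icc (-δ) δ, HasDerivWithinAt f (B t (f t)) (Icc (-δ) δ) t := by
  have h0 : (0 : ℝ) ∈ Icc (-δ) δ := ⟨by linarith, hδ⟩
  lift C to NNReal using hC
  have hPL : IsPicardLindelof (fun t x ↦ B t x) (tmin := -δ) (tmax := δ) ⟨0, h0⟩ x₀ ‖x₀‖₊ 0
      (C * (2 * ‖x₀‖₊)) C := by
    refine ⟨fun t ht ↦ ?_, fun x _ ↦ hB.clm_apply continuousOn_const, fun t ht x hx ↦ ?_, ?_⟩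
    · refine LipschitzOnWith.of_dist_le_mul fun x _ y _ ↦ ?_
      rw [dist_eq_norm, dist_eq_norm, ← map_sub]
      exact (B t).le_of_opNorm_le (hBC t ht) _
    · refine ((B t).le_of_opNorm_le (hBC t ht) x).trans ?_
      have hx' : ‖x - x₀‖ ≤ ‖x₀‖ := by simpa [dist_eq_norm] using hx
      have := norm_le_norm_add_norm_sub' x x₀
      simp only [NNReal.coe_mul, NNReal.coe_ofNat, coe_nnnorm]
      exact mul_le_mul_of_nonneg_left (by linarith) C.2
    · simp only [sub_zero, zero_sub, neg_neg, max_self, NNReal.coe_mul,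
        NNReal.coe_ofNat, coe_nnnorm, NNReal.coe_zero]
      nlinarith [norm_nonneg x₀]
  exact hPL.exists_eq_forall_mem_Icc_hasDerivWithinAt₀

/-- Grönwall's inequality on both sides of the initial time. -/
theorem norm_le_of_norm_deriv_le {f f' : ℝ → E} {δ K η ε : ℝ} (hK : 0 < K) (hη : 0 ≤ η)
    (hε : 0 ≤ ε) (hf : ∀ t ∈ Icc (-δ) δ, HasDerivWithinAt f (f' t) (Icc (-δ) δ) t)
    (h0 : ‖f 0‖ ≤ η) (hb : ∀ t ∈ Icc (-δ) δ, ‖f' t‖ ≤ K * ‖f t‖ + ε) :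
    ∀ t ∈ Icc (-δ) δ, ‖f t‖ ≤ (η + ε / K) * Real.exp (K * δ) := by
  have main : ∀ g g' : ℝ → E, (∀ t ∈ Icc (-δ) δ, HasDerivWithinAt g (g' t) (Icc (-δ) δ) t) →
      ‖g 0‖ ≤ η → (∀ t ∈ Icc (-δ) δ, ‖g' t‖ ≤ K * ‖g t‖ + ε) →
      ∀ t ∈ Icc 0 δ, ‖g t‖ ≤ (η + ε / K) * Real.exp (K * δ) := by
    intro g g' hg hg0 hgb t ht
    have hsub : Icc 0 δ ⊆ Icc (-δ) δ := Icc_subset_Icc_left (by linarith [ht.1.trans ht.2])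
    have := norm_le_gronwallBound_of_norm_deriv_right_le (f := g) (f' := g') (δ := η) (K := K)
      (ε := ε) (a := 0) (b := δ)
      (fun s hs ↦ ((hg s (hsub hs)).continuousWithinAt).mono hsub)
      (fun s hs ↦ (hg s (hsub ⟨hs.1, hs.2.le⟩)).mono_of_mem_nhdsWithin
        (Filter.mem_of_superset (Icc_mem_nhdsGE hs.2) (Icc_subset_Icc_left
          (by linarith [hs.1, hs.2]))))
      hg0 (fun s hs ↦ hgb s (hsub ⟨hs.1, hs.2.le⟩)) t ht
    refine this.trans ?_
    rw [gronwallBound_of_K_ne_0 hK.ne', sub_zero]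
    have h1 : Real.exp (K * t) ≤ Real.exp (K * δ) :=
      Real.exp_le_exp.2 (mul_le_mul_of_nonneg_left ht.2 hK.le)
    have h2 : 0 ≤ ε / K := by positivity
    calc η * Real.exp (K * t) + ε / K * (Real.exp (K * t) - 1)
        ≤ η * Real.exp (K * δ) + ε / K * Real.exp (K * δ) := by
          gcongr
          linarith
      _ = _ := by ring
  intro t ht
  rcases le_total 0 t with h | h
  · exact main f f' hf h0 hb t ⟨h, ht.2⟩
  · have hneg : ∀ s ∈ Icc (-δ) δ, -s ∈ Icc (-δ) δ := fun s hs ↦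
      ⟨by linarith [hs.2], by linarith [hs.1]⟩
    have := main (fun s ↦ f (-s)) (fun s ↦ - f' (-s)) (fun s hs ↦ ?_) (by simpa using h0)
      (fun s hs ↦ by simpa using hb _ (hneg s hs)) (-t) ⟨by linarith, by linarith [ht.1]⟩
    · simpa using this
    · have := (hf (-s) (hneg s hs)).scomp s (hasDerivAt_neg s).hasDerivWithinAt hneg
      simpa using! this

/-- The point with coordinates `(u, v)` relative to `p`. -/
def pt (p : Plane) (u v : ℝ) : Plane := p + u • unitVec 0 + v • unitVec 1

theorem continuous_pt (p : Plane) : Continuous fun z : ℝ × ℝ ↦ pt p z.1 z.2 := by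
  unfold pt; fun_prop

theorem hasDerivAt_pt_fst {F : Type*} [NormedAddCommGroup F] [NormedSpace ℝ F] {f : Plane → F}
    {p : Plane} {u v : ℝ} (h : DifferentiableAt ℝ f (pt p u v)) :
    HasDerivAt (fun s ↦ f (pt p s v)) (fderiv ℝ f (pt p u v) (unitVec 0)) u := by
  have e : ∀ s, pt p s v = (p + v • unitVec 1) + s • unitVec 0 := fun s ↦ by
    simp only [pt]; module
  simp only [e] at h ⊢
  exact HasFDerivAt.hasDerivAt_line h.hasFDerivAt

theorem hasDerivAt_pt_snd {F : Type*} [NormedAddCommGroup F] [NormedSpace ℝ F] {f : Plane → F}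
    {p : Plane} {u v : ℝ} (h : DifferentiableAt ℝ f (pt p u v)) :
    HasDerivAt (fun s ↦ f (pt p u s)) (fderiv ℝ f (pt p u v) (unitVec 1)) v :=
  HasFDerivAt.hasDerivAt_line (y := p + u • unitVec 0) h.hasFDerivAt

/-- `Ψ` is obtained from its value at `p` by solving `∂_a Ψ = A_a Ψ` along the first axis through
`p`, and then along all lines parallel to the second axis, on the square of half side `δ`. -/
structure IsTransport (A : Fin 2 → Plane → E →L[ℝ] E) (p : Plane) (δ : ℝ) (Ψ : ℝ → ℝ → E) :
    Prop where
  axis : ∀ u ∈ Icc (-δ) δ,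
    HasDerivWithinAt (fun s ↦ Ψ s 0) (A 0 (pt p u 0) (Ψ u 0)) (Icc (-δ) δ) u
  vert : ∀ u ∈ Icc (-δ) δ, ∀ v ∈ Icc (-δ) δ,
    HasDerivWithinAt (Ψ u) (A 1 (pt p u v) (Ψ u v)) (Icc (-δ) δ) v

theorem exists_isTransport [CompleteSpace E] {A : Fin 2 → Plane → E →L[ℝ] E} {O : Set Plane}
    (hO : IsOpen O) (hA : ∀ a, ContinuousOn (A a) O) {p : Plane} (hp : p ∈ O) :
    ∃ δ₀ > 0, ∀ δ, 0 < δ → δ ≤ δ₀ → (∀ u ∈ Icc (-δ) δ, ∀ v ∈ Icc (-δ) δ, pt p u v ∈ O) ∧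
      ∀ x₀, ∃ Ψ, Ψ 0 0 = x₀ ∧ IsTransport A p δ Ψ := by
  have hb : ∀ a, ∀ᶠ z in 𝓝 p, ‖A a z‖ < ‖A a p‖ + 1 := fun a ↦
    ((hA a).continuousAt (hO.mem_nhds hp)).norm.eventually_lt_const (by simp)
  obtain ⟨r, hr, hball⟩ := Metric.eventually_nhds_iff_ball.1
    ((Filter.eventually_all.2 hb).and (hO.mem_nhds hp))
  set C := ‖A 0 p‖ + ‖A 1 p‖ + 1 with hC
  have hC0 : 0 < C := by positivity
  have hAC : ∀ z ∈ Metric.ball p r, ∀ a, ‖A a z‖ ≤ C := by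
    intro z hz a
    refine ((hball z hz).1 a).le.trans ?_
    fin_cases a <;> simp [hC]
  refine ⟨min (r / 3) (1 / (2 * C)), by positivity, fun δ hδ hδ₀ ↦ ?_⟩
  have h1 : δ ≤ r / 3 := hδ₀.trans (min_le_left _ _)
  have h2 : 2 * C * δ ≤ 1 := by
    have := hδ₀.trans (min_le_right _ _)
    rw [le_div_iff₀ (by positivity)] at this
    linarith
  have hmem : ∀ u ∈ Icc (-δ) δ, ∀ v ∈ Icc (-δ) δ, pt p u v ∈ Metric.ball p r := by
    intro u hu v hv
    rw [mem_ball_iff_norm]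
    calc ‖pt p u v - p‖ = ‖u • unitVec 0 + v • unitVec 1‖ := by
          congr 1; simp only [pt]; abel
      _ ≤ ‖u • unitVec 0‖ + ‖v • unitVec 1‖ := norm_add_le _ _
      _ = |u| + |v| := by simp [norm_smul]
      _ < r := by linarith [abs_le.2 hu, abs_le.2 hv]
  have h0 : (0 : ℝ) ∈ Icc (-δ) δ := ⟨by linarith, hδ.le⟩
  refine ⟨fun u hu v hv ↦ (hball _ (hmem u hu v hv)).2, fun x₀ ↦ ?_⟩
  obtain ⟨φ, hφ0, hφ⟩ := exists_solution_linear_ode (B := fun u ↦ A 0 (pt p u 0)) hδ.le hC0.le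
    ((hA 0).comp ((continuous_pt p).comp (by fun_prop :
      Continuous fun u : ℝ ↦ (u, (0 : ℝ)))).continuousOn fun u hu ↦ (hball _ (hmem u hu 0 h0)).2)
    (fun u hu ↦ hAC _ (hmem u hu 0 h0) 0) h2 x₀
  have hψ : ∀ u, ∃ ψ : ℝ → E, ψ 0 = φ u ∧ (u ∈ Icc (-δ) δ → ∀ v ∈ Icc (-δ) δ,
      HasDerivWithinAt ψ (A 1 (pt p u v) (ψ v)) (Icc (-δ) δ) v) := by
    intro u
    by_cases hu : u ∈ Icc (-δ) δ
    · obtain ⟨ψ, hψ0, hψ⟩ := exists_solution_linear_ode (B := fun v ↦ A 1 (pt p u v)) hδ.le hC0.le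
        ((hA 1).comp ((continuous_pt p).comp (by fun_prop :
          Continuous fun v : ℝ ↦ (u, v))).continuousOn fun v hv ↦ (hball _ (hmem u hu v hv)).2)
        (fun v hv ↦ hAC _ (hmem u hu v hv) 1) h2 (φ u)
      exact ⟨ψ, hψ0, fun _ ↦ hψ⟩
    · exact ⟨fun _ ↦ φ u, rfl, fun h ↦ absurd h hu⟩
  choose Ψ hΨ0 hΨ using hψ
  refine ⟨Ψ, by rw [hΨ0, hφ0], fun u hu ↦ ?_, hΨ⟩
  simp only [hΨ0]
  exact hφ u hu

theorem IsTransport.exists_bound {A : Fin 2 → Plane → E →L[ℝ] E} {p : Plane} {δ C : ℝ}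
    (hδ : 0 ≤ δ) (hC : 0 < C) {Ψ : ℝ → ℝ → E} (hΨ : IsTransport A p δ Ψ)
    (hA0C : ∀ u ∈ Icc (-δ) δ, ∀ v ∈ Icc (-δ) δ, ‖A 0 (pt p u v)‖ ≤ C)
    (hA1C : ∀ u ∈ Icc (-δ) δ, ∀ v ∈ Icc (-δ) δ, ‖A 1 (pt p u v)‖ ≤ C) :
    ∃ B, 0 ≤ B ∧ ∀ u ∈ Icc (-δ) δ, ∀ v ∈ Icc (-δ) δ, ‖Ψ u v‖ ≤ B := by
  have h0 : (0 : ℝ) ∈ Icc (-δ) δ := ⟨by linarith, hδ⟩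
  set X := Real.exp (C * δ)
  have hX0 : 0 < X := Real.exp_pos _
  have hb0 : ∀ u ∈ Icc (-δ) δ, ‖Ψ u 0‖ ≤ ‖Ψ 0 0‖ * X := fun u hu ↦ by
    simpa using norm_le_of_norm_deriv_le hC (norm_nonneg (Ψ 0 0)) le_rfl hΨ.axis le_rfl
      (fun t ht ↦ by simpa using (A 0 _).le_of_opNorm_le (hA0C t ht 0 h0) _) u hu
  refine ⟨‖Ψ 0 0‖ * X * X, by positivity, fun u hu v hv ↦ ?_⟩
  simpa using norm_le_of_norm_deriv_le hC (by positivity) le_rfl (hΨ.vert u hu) (hb0 u hu)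
    (fun t ht ↦ by simpa using (A 1 _).le_of_opNorm_le (hA1C u hu t ht) _) v hv

/-- The curvature of the system `∂_a Ψ = A_a Ψ`, as an operator. -/
def curvOp (A : Fin 2 → Plane → E →L[ℝ] E) (y : Plane) : E →L[ℝ] E :=
  fderiv ℝ (A 1) y (unitVec 0) - fderiv ℝ (A 0) y (unitVec 1) + (A 1 y ∘L A 0 y - A 0 y ∘L A 1 y)

/-- If the curvature annihilates a transported section, then the section is parallel.  The
candidate `Θ = A_0 Ψ` for `∂_0 Ψ` solves the equation of variation along the vertical lines, and
Grönwall's inequality identifies it with the limit of the difference quotients. -/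
theorem IsTransport.hasDerivAt_fst {A : Fin 2 → Plane → E →L[ℝ] E} {O : Set Plane}
    (hO : IsOpen O) (hA : ∀ a, ContDiffOn ℝ 1 (A a) O) {p : Plane} {δ : ℝ} (hδ : 0 < δ)
    (hmem : ∀ u ∈ Icc (-δ) δ, ∀ v ∈ Icc (-δ) δ, pt p u v ∈ O) {Ψ : ℝ → ℝ → E}
    (hΨ : IsTransport A p δ Ψ)
    (hcurv : ∀ u ∈ Icc (-δ) δ, ∀ v ∈ Icc (-δ) δ, curvOp A (pt p u v) (Ψ u v) = 0)
    {u v : ℝ} (hu : u ∈ Ioo (-δ) δ) (hv : v ∈ Icc (-δ) δ) :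
    HasDerivAt (fun s ↦ Ψ s v) (A 0 (pt p u v) (Ψ u v)) u := by
  set I := Icc (-δ) δ with hI
  have h0 : (0 : ℝ) ∈ I := ⟨by linarith, hδ.le⟩
  have hu' : u ∈ I := Ioo_subset_Icc_self hu
  have hdiff : ∀ a, ∀ y ∈ O, DifferentiableAt ℝ (A a) y := fun a y hy ↦
    ((hA a).contDiffAt (hO.mem_nhds hy)).differentiableAt one_ne_zero
  have hII : IsCompact (I ×ˢ I) := isCompact_Icc.prod isCompact_Icc
  have hmaps : MapsTo (fun z : ℝ × ℝ ↦ pt p z.1 z.2) (I ×ˢ I) O := fun z hz ↦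
    hmem _ hz.1 _ hz.2
  have hAc : ∀ a, ContinuousOn (fun z : ℝ × ℝ ↦ A a (pt p z.1 z.2)) (I ×ˢ I) := fun a ↦
    (hA a).continuousOn.comp (continuous_pt p).continuousOn hmaps
  have hdAc : ContinuousOn (fun z : ℝ × ℝ ↦ fderiv ℝ (A 1) (pt p z.1 z.2) (unitVec 0))
      (I ×ˢ I) := by
    have : ContinuousOn (fderiv ℝ (A 1)) O :=
      ((hA 1).fderiv_of_isOpen (m := 0) hO (by norm_num)).continuousOn
    exact (this.comp (continuous_pt p).continuousOn hmaps).clm_apply continuousOn_const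
  obtain ⟨C₀, hC₀⟩ := hII.exists_bound_of_continuousOn (hAc 0)
  obtain ⟨C₁, hC₁⟩ := hII.exists_bound_of_continuousOn (hAc 1)
  obtain ⟨D, hD⟩ := hII.exists_bound_of_continuousOn hdAc
  set C := |C₀| + |C₁| + |D| + 1 with hCdef
  have hC : 0 < C := by positivity
  have hA0C : ∀ u ∈ I, ∀ v ∈ I, ‖A 0 (pt p u v)‖ ≤ C := fun u hu v hv ↦
    (hC₀ (u, v) ⟨hu, hv⟩).trans (by
      rw [hCdef]; linarith [le_abs_self C₀, abs_nonneg C₁, abs_nonneg D])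
  have hA1C : ∀ u ∈ I, ∀ v ∈ I, ‖A 1 (pt p u v)‖ ≤ C := fun u hu v hv ↦
    (hC₁ (u, v) ⟨hu, hv⟩).trans (by
      rw [hCdef]; linarith [le_abs_self C₁, abs_nonneg C₀, abs_nonneg D])
  have hDC : ∀ u ∈ I, ∀ v ∈ I, ‖fderiv ℝ (A 1) (pt p u v) (unitVec 0)‖ ≤ C := fun u hu v hv ↦
    (hD (u, v) ⟨hu, hv⟩).trans (by
      rw [hCdef]; linarith [le_abs_self D, abs_nonneg C₀, abs_nonneg C₁])
  set X := Real.exp (C * δ) with hX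
  have hX0 : 0 < X := Real.exp_pos _
  obtain ⟨B, hB0, hB⟩ := hΨ.exists_bound hδ.le hC hA0C hA1C
  have hA1lip : ∀ s ∈ I, ∀ v ∈ I, ‖A 1 (pt p s v) - A 1 (pt p u v)‖ ≤ C * |s - u| := by
    intro s hs v hv
    exact (convex_Icc (-δ) δ).norm_image_sub_le_of_norm_hasDerivWithin_le
      (fun t ht ↦ (hasDerivAt_pt_fst (hdiff 1 _ (hmem t ht v hv))).hasDerivWithinAt)
      (fun t ht ↦ hDC t ht v hv) hu' hs
  have haxis : ∀ s ∈ I, ‖Ψ s 0 - Ψ u 0‖ ≤ C * B * |s - u| := by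
    intro s hs
    refine (convex_Icc (-δ) δ).norm_image_sub_le_of_norm_hasDerivWithin_le hΨ.axis
      (fun t ht ↦ ?_) hu' hs
    exact ((A 0 _).le_of_opNorm_le (hA0C t ht 0 h0) _).trans
      (mul_le_mul_of_nonneg_left (hB t ht 0 h0) hC.le)
  -- `Ψ` is Lipschitz in the first variable
  set L := (C * B + C * B / C) * X with hL
  have hL0 : 0 ≤ L := by positivity
  have hlip : ∀ s ∈ I, ∀ v ∈ I, ‖Ψ s v - Ψ u v‖ ≤ L * |s - u| := by
    intro s hs v hv
    have := norm_le_of_norm_deriv_le (f := fun v ↦ Ψ s v - Ψ u v) (η := C * B * |s - u|)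
      (ε := C * B * |s - u|) hC (by positivity) (by positivity)
      (fun t ht ↦ (hΨ.vert s hs t ht).fun_sub (hΨ.vert u hu' t ht)) (haxis s hs)
      (fun t ht ↦ ?_) v hv
    · refine this.trans (le_of_eq ?_)
      rw [hL]; ring
    · have e : A 1 (pt p s t) (Ψ s t) - A 1 (pt p u t) (Ψ u t) =
          A 1 (pt p s t) (Ψ s t - Ψ u t) + (A 1 (pt p s t) - A 1 (pt p u t)) (Ψ u t) := by
        simp
      rw [e]
      refine (norm_add_le _ _).trans (add_le_add
        ((A 1 _).le_of_opNorm_le (hA1C s hs t ht) _) ?_)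
      refine (ContinuousLinearMap.le_of_opNorm_le _ (hA1lip s hs t ht) _).trans ?_
      rw [mul_right_comm]
      gcongr
      exact hB u hu' t ht
  -- the first order remainder
  rw [hasDerivAt_iff_isLittleO, Asymptotics.isLittleO_iff]
  intro c hc
  set M := (1 + (B + C * L) / C) * X with hM
  have hM0 : 0 < M := by positivity
  set ε := c / M with hε
  have hε0 : 0 < ε := by positivity
  have hunif := hII.uniformContinuousOn_of_continuous hdAc
  obtain ⟨η, hη, hηε⟩ := Metric.uniformContinuousOn_iff.1 hunif ε hε0
  have hIn : I ∈ 𝓝 u := Icc_mem_nhds hu.1 hu.2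
  have hax := ((hΨ.axis u hu').hasDerivAt hIn)
  rw [hasDerivAt_iff_isLittleO, Asymptotics.isLittleO_iff] at hax
  obtain ⟨ρ, hρ, hρI⟩ := Metric.mem_nhds_iff.1 hIn
  filter_upwards [hax hε0, Metric.ball_mem_nhds u (lt_min hρ (lt_min hη hε0))] with s hs1 hs2
  rw [Metric.mem_ball, Real.dist_eq] at hs2
  have hsI : s ∈ I := hρI (by
    rw [Metric.mem_ball, Real.dist_eq]; exact hs2.trans_le (min_le_left _ _))
  have hsη : |s - u| < η := hs2.trans_le ((min_le_right _ _).trans (min_le_left _ _))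
  have hsε : |s - u| ≤ ε := (hs2.trans_le ((min_le_right _ _).trans (min_le_right _ _))).le
  have hA1rem : ∀ v ∈ I, ‖A 1 (pt p s v) - A 1 (pt p u v)
      - (s - u) • fderiv ℝ (A 1) (pt p u v) (unitVec 0)‖ ≤ ε * |s - u| := by
    intro v hv
    have hsub : uIcc u s ⊆ I := (convex_Icc (-δ) δ).ordConnected.uIcc_subset hu' hsI
    have hlin : ∀ t : ℝ, HasDerivAt (fun t : ℝ ↦ t • fderiv ℝ (A 1) (pt p u v) (unitVec 0))
        (fderiv ℝ (A 1) (pt p u v) (unitVec 0)) t := fun t ↦ by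
      have := (hasDerivAt_id t).smul_const (fderiv ℝ (A 1) (pt p u v) (unitVec 0))
      rwa [one_smul] at this
    have := (convex_uIcc u s).norm_image_sub_le_of_norm_hasDerivWithin_le
      (f := fun t ↦ A 1 (pt p t v) - t • fderiv ℝ (A 1) (pt p u v) (unitVec 0)) (C := ε)
      (f' := fun t ↦ fderiv ℝ (A 1) (pt p t v) (unitVec 0)
        - fderiv ℝ (A 1) (pt p u v) (unitVec 0))
      (fun t ht ↦ ((hasDerivAt_pt_fst (hdiff 1 _ (hmem t (hsub ht) v hv))).fun_sub
        (hlin t)).hasDerivWithinAt)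
      (fun t ht ↦ ?_) left_mem_uIcc right_mem_uIcc
    · refine le_trans (le_of_eq ?_) this
      congr 1
      module
    · rw [← dist_eq_norm]
      refine (hηε (t, v) ⟨hsub ht, hv⟩ (u, v) ⟨hu', hv⟩ ?_).le
      rw [Prod.dist_eq, dist_self, max_eq_left dist_nonneg, Real.dist_eq]
      exact (abs_sub_left_of_mem_uIcc ht).trans_lt hsη
  have := norm_le_of_norm_deriv_le (δ := δ)
    (f := fun v ↦ Ψ s v - Ψ u v - (s - u) • A 0 (pt p u v) (Ψ u v))
    (f' := fun v ↦ A 1 (pt p s v) (Ψ s v) - A 1 (pt p u v) (Ψ u v) -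
      (s - u) • (fderiv ℝ (A 0) (pt p u v) (unitVec 1) (Ψ u v) +
        A 0 (pt p u v) (A 1 (pt p u v) (Ψ u v))))
    (η := ε * |s - u|) (ε := ε * |s - u| * B + |s - u| * C * (L * ε)) hC (by positivity)
    (by positivity) (fun t ht ↦ ?_) hs1 (fun t ht ↦ ?_) v hv
  · refine this.trans (le_of_eq ?_)
    rw [Real.norm_eq_abs]
    have : c = ε * M := by rw [hε]; field_simp
    rw [this, hM]
    ring
  · exact ((hΨ.vert s hsI t ht).fun_sub (hΨ.vert u hu' t ht)).fun_sub
      (((hasDerivAt_pt_snd (hdiff 0 _ (hmem u hu' t ht))).hasDerivWithinAt.clm_apply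
        (hΨ.vert u hu' t ht)).const_smul (s - u))
  · have hcv := hcurv u hu' t ht
    have e : A 1 (pt p s t) (Ψ s t) - A 1 (pt p u t) (Ψ u t) -
        (s - u) • (fderiv ℝ (A 0) (pt p u t) (unitVec 1) (Ψ u t) +
        A 0 (pt p u t) (A 1 (pt p u t) (Ψ u t))) =
        A 1 (pt p u t) (Ψ s t - Ψ u t - (s - u) • A 0 (pt p u t) (Ψ u t)) +
        ((A 1 (pt p s t) - A 1 (pt p u t)
          - (s - u) • fderiv ℝ (A 1) (pt p u t) (unitVec 0)) (Ψ s t) +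
        (s - u) • fderiv ℝ (A 1) (pt p u t) (unitVec 0) (Ψ s t - Ψ u t)) +
        (s - u) • curvOp A (pt p u t) (Ψ u t) := by
      simp only [curvOp, add_apply, sub_apply, smul_apply,
        ContinuousLinearMap.comp_apply, map_sub, map_smul]
      module
    rw [e, hcv, smul_zero, add_zero]
    refine (norm_add_le _ _).trans (add_le_add
      ((A 1 _).le_of_opNorm_le (hA1C u hu' t ht) _) ((norm_add_le _ _).trans (add_le_add ?_ ?_)))
    · refine (ContinuousLinearMap.le_of_opNorm_le _ (hA1rem t ht) _).trans ?_
      gcongr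
      exact hB s hsI t ht
    · rw [norm_smul, Real.norm_eq_abs, mul_assoc]
      refine mul_le_mul_of_nonneg_left ?_ (abs_nonneg _)
      refine (ContinuousLinearMap.le_of_opNorm_le _ (hDC u hu' t ht) _).trans ?_
      refine mul_le_mul_of_nonneg_left ((hlip s hsI t ht).trans ?_) hC.le
      exact mul_le_mul_of_nonneg_left hsε hL0

/-- A transported section stays in the kernel of a field of operators `R` whose covariant
derivative is bounded by `R`. -/
theorem IsTransport.apply_eq_zero {F : Type*} [NormedAddCommGroup F] [NormedSpace ℝ F]
    {A : Fin 2 → Plane → E →L[ℝ] E} {O : Set Plane} {p : Plane} {δ : ℝ} (hδ : 0 < δ)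
    (hmem : ∀ u ∈ Icc (-δ) δ, ∀ v ∈ Icc (-δ) δ, pt p u v ∈ O) {Ψ : ℝ → ℝ → E}
    (hΨ : IsTransport A p δ Ψ) {R : Plane → E →L[ℝ] F} (hR : ∀ y ∈ O, DifferentiableAt ℝ R y)
    {K : ℝ} (hK : 0 < K)
    (hb : ∀ u ∈ Icc (-δ) δ, ∀ v ∈ Icc (-δ) δ, ∀ a x,
      ‖fderiv ℝ R (pt p u v) (unitVec a) x + R (pt p u v) (A a (pt p u v) x)‖
        ≤ K * ‖R (pt p u v) x‖)
    (h0 : R p (Ψ 0 0) = 0) {u v : ℝ} (hu : u ∈ Icc (-δ) δ) (hv : v ∈ Icc (-δ) δ) :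
    R (pt p u v) (Ψ u v) = 0 := by
  have hz : (0 : ℝ) ∈ Icc (-δ) δ := ⟨by linarith, hδ.le⟩
  have hp : pt p 0 0 = p := by simp [pt]
  have hax : ∀ u ∈ Icc (-δ) δ, R (pt p u 0) (Ψ u 0) = 0 := fun u hu ↦ by
    have := norm_le_of_norm_deriv_le (f := fun u ↦ R (pt p u 0) (Ψ u 0)) hK le_rfl le_rfl
      (fun t ht ↦ (hasDerivAt_pt_fst (hR _ (hmem t ht 0 hz))).hasDerivWithinAt.clm_apply
        (hΨ.axis t ht)) (by simp [hp, h0])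
      (fun t ht ↦ by simpa using hb t ht 0 hz 0 (Ψ t 0)) u hu
    simpa using this
  have := norm_le_of_norm_deriv_le (f := fun v ↦ R (pt p u v) (Ψ u v)) hK le_rfl le_rfl
      (fun t ht ↦ (hasDerivAt_pt_snd (hR _ (hmem u hu t ht))).hasDerivWithinAt.clm_apply
        (hΨ.vert u hu t ht)) (by simp [hax u hu])
      (fun t ht ↦ by simpa using hb u hu t ht 1 (Ψ u t)) v hv
  simpa using this

/-- The open square with centre `p` and half side `δ`. -/
def sq (p : Plane) (δ : ℝ) : Set Plane := {y | ∀ a, |y a - p a| < δ}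

theorem isOpen_sq (p : Plane) (δ : ℝ) : IsOpen (sq p δ) := by
  simp only [sq, ofPred_forall]
  exact isOpen_iInter_of_finite fun a ↦ isOpen_lt (by fun_prop) continuous_const

theorem mem_sq_self (p : Plane) {δ : ℝ} (hδ : 0 < δ) : p ∈ sq p δ := fun a ↦ by simpa using hδ

theorem convex_sq (p : Plane) (δ : ℝ) : Convex ℝ (sq p δ) := by
  have : sq p δ = ⋂ a, (fun y : Plane ↦ y a) ⁻¹' Metric.ball (p a) δ := by
    ext y; simp [sq, Real.dist_eq]
  rw [this]
  exact convex_iInter fun a ↦ (convex_ball (p a) δ).linear_preimage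
    (EuclideanSpace.proj a : Plane →L[ℝ] ℝ).toLinearMap

theorem pt_sub (p y : Plane) : pt p (y 0 - p 0) (y 1 - p 1) = y := by
  ext i; fin_cases i <;> simp [pt]

theorem pt_mem_sq {p : Plane} {δ u v : ℝ} (hu : |u| < δ) (hv : |v| < δ) : pt p u v ∈ sq p δ := by
  intro a
  fin_cases a <;> simpa [pt]

theorem pt_mem_closure_sq {p : Plane} {δ u v : ℝ} (hδ : 0 < δ) (hu : u ∈ Icc (-δ) δ)
    (hv : v ∈ Icc (-δ) δ) : pt p u v ∈ closure (sq p δ) := by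
  have hlim : Filter.Tendsto (fun t : ℝ ↦ pt p (t * u) (t * v)) (𝓝[<] 1) (𝓝 (pt p u v)) := by
    have hc : Continuous fun t : ℝ ↦ pt p (t * u) (t * v) :=
      (continuous_pt p).comp (by fun_prop : Continuous fun t : ℝ ↦ (t * u, t * v))
    simpa using (hc.tendsto 1).mono_left nhdsWithin_le_nhds
  refine mem_closure_of_tendsto hlim ?_
  filter_upwards [Ioo_mem_nhdsLT (show (0 : ℝ) < 1 by norm_num)] with t ht
  have hlt : ∀ u ∈ Icc (-δ) δ, |t * u| < δ := fun u hu ↦ by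
    rw [abs_mul, abs_of_pos ht.1]
    nlinarith [abs_le.2 hu, abs_nonneg u, ht.1, ht.2]
  exact pt_mem_sq (hlt u hu) (hlt v hv)

theorem exists_sq_subset {p : Plane} {N : Set Plane} (hN : N ∈ 𝓝 p) :
    ∃ δ₀ > 0, ∀ δ ≤ δ₀, sq p δ ⊆ N := by
  have hN' : N ∈ 𝓝 p := hN
  rw [← coordEquiv.toHomeomorph.symm_apply_apply p] at hN
  have h1 : coordEquiv.symm ⁻¹' N ∈ 𝓝 (coordEquiv p) :=
    coordEquiv.symm.continuous.continuousAt.preimage_mem_nhds (by simpa using hN')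
  obtain ⟨r, hr, hrN⟩ := Metric.mem_nhds_iff.1 h1
  refine ⟨r, hr, fun δ hδ y hy ↦ ?_⟩
  have h2 : coordEquiv y ∈ Metric.ball (coordEquiv p) r := by
    rw [Metric.mem_ball, Prod.dist_eq, max_lt_iff, Real.dist_eq, Real.dist_eq]
    exact ⟨(hy 0).trans_le hδ, (hy 1).trans_le hδ⟩
  simpa using hrN h2

/-- A transported section annihilated by the curvature, as a function on the open square. -/
theorem IsTransport.partials {A : Fin 2 → Plane → E →L[ℝ] E} {O : Set Plane}
    (hO : IsOpen O) (hA : ∀ a, ContDiffOn ℝ 1 (A a) O) {p : Plane} {δ : ℝ} (hδ : 0 < δ)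
    (hmem : ∀ u ∈ Icc (-δ) δ, ∀ v ∈ Icc (-δ) δ, pt p u v ∈ O) {Ψ : ℝ → ℝ → E}
    (hΨ : IsTransport A p δ Ψ)
    (hcurv : ∀ u ∈ Icc (-δ) δ, ∀ v ∈ Icc (-δ) δ, curvOp A (pt p u v) (Ψ u v) = 0) :
    (∀ y ∈ sq p δ, ∀ a, HasDerivAt
      (fun t : ℝ ↦ (fun z : Plane ↦ Ψ (z 0 - p 0) (z 1 - p 1)) (y + t • unitVec a))
      (A a y (Ψ (y 0 - p 0) (y 1 - p 1))) 0) ∧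
    ContinuousOn (fun z : Plane ↦ Ψ (z 0 - p 0) (z 1 - p 1)) (sq p δ) := by
  have hfst := fun u (hu : u ∈ Ioo (-δ) δ) v (hv : v ∈ Icc (-δ) δ) ↦
    hΨ.hasDerivAt_fst hO hA hδ hmem hcurv hu hv
  have hIoo : ∀ y ∈ sq p δ, ∀ a, y a - p a ∈ Ioo (-δ) δ := fun y hy a ↦ abs_lt.1 (hy a)
  have hI := fun y hy a ↦ Ioo_subset_Icc_self (hIoo y hy a)
  constructor
  · intro y hy a
    fin_cases a
    · have h1 := hfst _ (hIoo y hy 0) _ (hI y hy 1)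
      rw [pt_sub] at h1
      have h2 : HasDerivAt (fun t : ℝ ↦ y 0 - p 0 + t) 1 0 := (hasDerivAt_id (0 : ℝ)).const_add _
      have h3 := HasDerivAt.scomp (𝕜' := ℝ) (0 : ℝ)
        (by simpa using h1 : HasDerivAt (fun s ↦ Ψ s (y 1 - p 1)) _ (y 0 - p 0 + 0)) h2
      rw [one_smul] at h3
      refine h3.congr_of_eventuallyEq (Filter.Eventually.of_forall fun t ↦ ?_)
      simp [Function.comp]
      ring_nf
    · have h1 := (hΨ.vert _ (hI y hy 0) _ (hI y hy 1)).hasDerivAt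
        (Icc_mem_nhds (hIoo y hy 1).1 (hIoo y hy 1).2)
      rw [pt_sub] at h1
      have h2 : HasDerivAt (fun t : ℝ ↦ y 1 - p 1 + t) 1 0 := (hasDerivAt_id (0 : ℝ)).const_add _
      have h3 := HasDerivAt.scomp (𝕜' := ℝ) (0 : ℝ)
        (by simpa using h1 : HasDerivAt (Ψ (y 0 - p 0)) _ (y 1 - p 1 + 0)) h2
      rw [one_smul] at h3
      refine h3.congr_of_eventuallyEq (Filter.Eventually.of_forall fun t ↦ ?_)
      simp [Function.comp]
      ring_nf
  · -- both partial derivatives are bounded, hence `Ψ` is Lipschitz on the open square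
    have hII : IsCompact (Icc (-δ) δ ×ˢ Icc (-δ) δ) := isCompact_Icc.prod isCompact_Icc
    have hAc : ∀ a, ContinuousOn (fun z : ℝ × ℝ ↦ A a (pt p z.1 z.2))
        (Icc (-δ) δ ×ˢ Icc (-δ) δ) := fun a ↦
      (hA a).continuousOn.comp (continuous_pt p).continuousOn fun z hz ↦ hmem _ hz.1 _ hz.2
    obtain ⟨C₀, hC₀⟩ := hII.exists_bound_of_continuousOn (hAc 0)
    obtain ⟨C₁, hC₁⟩ := hII.exists_bound_of_continuousOn (hAc 1)
    set C := |C₀| + |C₁| + 1 with hCdef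
    have hC : 0 < C := by positivity
    have hA0 : ∀ u ∈ Icc (-δ) δ, ∀ v ∈ Icc (-δ) δ, ‖A 0 (pt p u v)‖ ≤ C := fun u hu v hv ↦
      (hC₀ (u, v) ⟨hu, hv⟩).trans (by rw [hCdef]; linarith [le_abs_self C₀, abs_nonneg C₁])
    have hA1 : ∀ u ∈ Icc (-δ) δ, ∀ v ∈ Icc (-δ) δ, ‖A 1 (pt p u v)‖ ≤ C := fun u hu v hv ↦
      (hC₁ (u, v) ⟨hu, hv⟩).trans (by rw [hCdef]; linarith [le_abs_self C₁, abs_nonneg C₀])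
    obtain ⟨B, hB0, hB⟩ := hΨ.exists_bound hδ.le hC hA0 hA1
    intro y hy
    have hbound : ∀ z ∈ sq p δ, ‖Ψ (z 0 - p 0) (z 1 - p 1) - Ψ (y 0 - p 0) (y 1 - p 1)‖ ≤
        C * B * |z 0 - y 0| + C * B * |z 1 - y 1| := by
      intro z hz
      have e : Ψ (z 0 - p 0) (z 1 - p 1) - Ψ (y 0 - p 0) (y 1 - p 1) =
          (Ψ (z 0 - p 0) (z 1 - p 1) - Ψ (y 0 - p 0) (z 1 - p 1)) +
          (Ψ (y 0 - p 0) (z 1 - p 1) - Ψ (y 0 - p 0) (y 1 - p 1)) := by abel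
      rw [e]
      refine (norm_add_le _ _).trans (add_le_add ?_ ?_)
      · have := (convex_Ioo (-δ) δ).norm_image_sub_le_of_norm_hasDerivWithin_le (C := C * B)
          (fun t ht ↦ (hfst t ht _ (hI z hz 1)).hasDerivWithinAt)
          (fun t ht ↦ ((A 0 _).le_of_opNorm_le
              (hA0 t (Ioo_subset_Icc_self ht) _ (hI z hz 1)) _).trans
            (mul_le_mul_of_nonneg_left (hB t (Ioo_subset_Icc_self ht) _ (hI z hz 1)) hC.le))
          (hIoo y hy 0) (hIoo z hz 0)
        simpa using this
      · have := (convex_Icc (-δ) δ).norm_image_sub_le_of_norm_hasDerivWithin_le (C := C * B)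
          (hΨ.vert _ (hI y hy 0))
          (fun t ht ↦ ((A 1 _).le_of_opNorm_le (hA1 _ (hI y hy 0) t ht) _).trans
            (mul_le_mul_of_nonneg_left (hB _ (hI y hy 0) t ht) hC.le)) (hI y hy 1) (hI z hz 1)
        simpa using this
    rw [ContinuousWithinAt, tendsto_iff_norm_sub_tendsto_zero]
    have hlim : Filter.Tendsto (fun z : Plane ↦ C * B * |z 0 - y 0| + C * B * |z 1 - y 1|)
        (𝓝[sq p δ] y) (𝓝 0) := by
      have hc : Continuous fun z : Plane ↦ C * B * |z 0 - y 0| + C * B * |z 1 - y 1| := by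
        fun_prop
      simpa using (hc.tendsto y).mono_left nhdsWithin_le_nhds
    refine squeeze_zero' (Filter.Eventually.of_forall fun _ ↦ norm_nonneg _) ?_ hlim
    filter_upwards [self_mem_nhdsWithin] with z hz using hbound z hz

end Frobenius

/-! ### Fields of linear maps of constant rank -/

section ConstantRank

variable {X E F : Type*} [TopologicalSpace X] [NormedAddCommGroup E] [NormedSpace ℝ E]
  [NormedAddCommGroup F] [NormedSpace ℝ F] [FiniteDimensional ℝ E] [FiniteDimensional ℝ F]

/-- A linear map between finite-dimensional spaces has a generalised inverse. -/
theorem exists_generalizedInverse (R : E →L[ℝ] F) : ∃ G : F →L[ℝ] E, ∀ x, R (G (R x)) = R x := by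
  obtain ⟨g, hg⟩ := (R : E →ₗ[ℝ] F).rangeRestrict.exists_rightInverse_of_surjective
    (LinearMap.range_rangeRestrict _)
  obtain ⟨q, hq⟩ := (LinearMap.range (R : E →ₗ[ℝ] F)).subtype.exists_leftInverse_of_injective
    (Submodule.ker_subtype _)
  refine ⟨(g ∘ₗ q).toContinuousLinearMap, fun x ↦ ?_⟩
  have h1 : q (R x) = (R : E →ₗ[ℝ] F).rangeRestrict x :=
    LinearMap.congr_fun hq ((R : E →ₗ[ℝ] F).rangeRestrict x)
  have h2 := congrArg Subtype.val (LinearMap.congr_fun hg ((R : E →ₗ[ℝ] F).rangeRestrict x))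
  simpa [h1] using h2

/-- Where the rank of a continuous field `R` of linear maps is locally constant, a covector that
vanishes on the kernel of `R` factors through `R` with a uniform bound. -/
theorem exists_bound_of_ker_le {R : X → E →L[ℝ] F} {p : X} (hR : ContinuousAt R p)
    (hrank : ∀ᶠ y in 𝓝 p, Module.finrank ℝ (LinearMap.ker (R p : E →ₗ[ℝ] F)) ≤
      Module.finrank ℝ (LinearMap.ker (R y : E →ₗ[ℝ] F))) :
    ∃ C, 0 < C ∧ ∀ᶠ y in 𝓝 p, ∀ τ : E →L[ℝ] ℝ, (∀ x, R y x = 0 → τ x = 0) →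
      ∀ x, ‖τ x‖ ≤ C * ‖τ‖ * ‖R y x‖ := by
  obtain ⟨G, hG⟩ := exists_generalizedInverse (R p)
  set T : X → E →L[ℝ] E := fun y ↦ 1 + G ∘L (R y - R p) with hT
  have hTp : T p = 1 := by simp [hT]
  have hTc : ContinuousAt T p :=
    continuousAt_const.add ((continuousAt_const (y := G)).clm_comp (hR.sub continuousAt_const))
  have hinv : ContinuousAt (fun y ↦ Ring.inverse (T y)) p := by
    have h1 := NormedRing.inverse_continuousAt (R := E →L[ℝ] E) 1
    rw [Units.val_one, ← hTp] at h1
    exact ContinuousAt.comp (f := T) h1 hTc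
  have hunit : ∀ᶠ y in 𝓝 p, IsUnit (T y) := by
    refine hTc.eventually_mem (Units.isOpen.mem_nhds ?_)
    rw [hTp]; exact isUnit_one
  have hbd : ∀ᶠ y in 𝓝 p, ‖Ring.inverse (T y)‖ < ‖Ring.inverse (T p)‖ + 1 :=
    hinv.norm.eventually_lt_const (lt_add_one _)
  refine ⟨(‖Ring.inverse (T p)‖ + 1) * (‖G‖ + 1), by positivity, ?_⟩
  filter_upwards [hrank, hunit, hbd] with y hy1 hy2 hy3 τ hτ x
  set S := Ring.inverse (T y) with hS
  have hST : ∀ x, S (T y x) = x := fun x ↦ by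
    have := Ring.inverse_mul_cancel (T y) hy2
    exact DFunLike.congr_fun this x
  -- `1 - G R(p)` maps onto the kernel of `R(p)`
  set Q : E →L[ℝ] E := 1 - G ∘L R p with hQ
  have hQker : LinearMap.range (Q : E →ₗ[ℝ] E) ≤ LinearMap.ker (R p : E →ₗ[ℝ] F) := by
    rintro _ ⟨x, rfl⟩
    simp [hQ, hG]
  have hGR : ∀ x, S (G (R y x)) = x - S (Q x) := fun x ↦ by
    have h1 : G (R y x) = T y x - Q x := by simp [hT, hQ]
    rw [h1, map_sub, hST]
  have hle : LinearMap.ker (R y : E →ₗ[ℝ] F) ≤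
      (LinearMap.range (Q : E →ₗ[ℝ] E)).map (S : E →ₗ[ℝ] E) := by
    intro x hx
    refine ⟨Q x, ⟨x, rfl⟩, ?_⟩
    have h1 := hGR x
    rw [show R y x = 0 from hx, map_zero, map_zero] at h1
    exact (sub_eq_zero.1 h1.symm).symm
  have heq := Submodule.eq_of_le_of_finrank_le hle
    ((Submodule.finrank_map_le _ _).trans ((Submodule.finrank_mono hQker).trans hy1))
  have hker : R y (S (Q x)) = 0 := by
    have : S (Q x) ∈ LinearMap.ker (R y : E →ₗ[ℝ] F) := by
      rw [heq]; exact ⟨Q x, ⟨x, rfl⟩, rfl⟩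
    exact this
  have hτx : τ x = τ (S (G (R y x))) := by
    rw [hGR, map_sub, hτ _ hker, sub_zero]
  rw [hτx]
  calc ‖τ (S (G (R y x)))‖ ≤ ‖τ‖ * (‖S‖ * (‖G‖ * ‖R y x‖)) :=
        τ.le_opNorm_of_le (S.le_opNorm_of_le (G.le_opNorm _))
    _ ≤ ‖τ‖ * ((‖Ring.inverse (T p)‖ + 1) * ((‖G‖ + 1) * ‖R y x‖)) := by
        gcongr
        linarith
    _ = _ := by ring

end ConstantRank

/-! ### Existence of parallel sections -/

section MatrixSystems

open Set
open scoped Matrix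

/-- Multiplication by a `3 × 3` matrix as a continuous linear map. -/
def mulOp (m : Matrix (Fin 3) (Fin 3) ℝ) : (Fin 3 → ℝ) →L[ℝ] (Fin 3 → ℝ) :=
  m.mulVecLin.toContinuousLinearMap

theorem mulOp_apply (m : Matrix (Fin 3) (Fin 3) ℝ) (x : Fin 3 → ℝ) : mulOp m x = m *ᵥ x := rfl

variable {O : Set Plane} {y p : Plane}

theorem contDiffOn_mulOp {m : Plane → Matrix (Fin 3) (Fin 3) ℝ} {n : WithTop ℕ∞}
    (h : ∀ i j, ContDiffOn ℝ n (fun y ↦ m y i j) O) : ContDiffOn ℝ n (fun y ↦ mulOp (m y)) O := by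
  refine contDiffOn_clm_apply.2 fun x ↦ contDiffOn_pi.2 fun i ↦ ?_
  simp only [mulOp_apply, Matrix.mulVec, dotProduct]
  exact ContDiffOn.sum fun j _ ↦ (h i j).mul contDiffOn_const

theorem fderiv_mulOp_apply {m : Plane → Matrix (Fin 3) (Fin 3) ℝ} (hO : IsOpen O)
    (h : ∀ i j, ContDiffOn ℝ 1 (fun y ↦ m y i j) O) (hy : y ∈ O) (a : Fin 2) (x : Fin 3 → ℝ)
    (i : Fin 3) : fderiv ℝ (fun z ↦ mulOp (m z)) y (unitVec a) x i =
      ∑ j, pd a (fun z ↦ m z i j) y * x j := by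
  have hd := ((contDiffOn_mulOp h).contDiffAt (hO.mem_nhds hy)).differentiableAt one_ne_zero
  have h1 := ((ContinuousLinearMap.proj (R := ℝ) (φ := fun _ : Fin 3 ↦ ℝ) i ∘L
    ContinuousLinearMap.apply ℝ (Fin 3 → ℝ) x).hasFDerivAt.comp y hd.hasFDerivAt)
  have h2 : pd a (fun z ↦ ∑ j, m z i j * x j) y =
      fderiv ℝ (fun z ↦ mulOp (m z)) y (unitVec a) x i := by
    have := congrArg (fun f ↦ f (unitVec a)) h1.fderiv
    exact this
  rw [← h2, pd_sum _ fun j _ ↦ ((h i j).diffAt hO one_ne_zero hy).mul_const _]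
  refine Finset.sum_congr rfl fun j _ ↦ ?_
  rw [pd_mul ((h i j).diffAt hO one_ne_zero hy) (differentiableAt_const _), pd_const]
  ring

theorem curvOp_mulOp {A : Fin 2 → Plane → Matrix (Fin 3) (Fin 3) ℝ} (hO : IsOpen O)
    (hA : ∀ a i j, ContDiffOn ℝ 1 (fun y ↦ A a y i j) O) (hy : y ∈ O) (x : Fin 3 → ℝ) :
    curvOp (fun a y ↦ mulOp (A a y)) y x = curv A y *ᵥ x := by
  ext i
  have e1 := fderiv_mulOp_apply hO (hA 1) hy 0 x i
  have e0 := fderiv_mulOp_apply hO (hA 0) hy 1 x i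
  simp only [curvOp, add_apply, sub_apply, ContinuousLinearMap.comp_apply, Pi.add_apply,
    Pi.sub_apply, e0, e1, mulOp_apply, curv]
  simp only [Matrix.mulVec, dotProduct, Fin.sum_univ_three, Matrix.of_apply, Matrix.sub_apply,
    Matrix.mul_apply]
  ring

theorem IsTransport.isParallelOn {A : Fin 2 → Plane → Matrix (Fin 3) (Fin 3) ℝ} (hO : IsOpen O)
    (hA : ∀ a i j, ContDiffOn ℝ 1 (fun y ↦ A a y i j) O) {δ : ℝ} (hδ : 0 < δ)
    (hmem : ∀ u ∈ Icc (-δ) δ, ∀ v ∈ Icc (-δ) δ, pt p u v ∈ O) (hsq : sq p δ ⊆ O)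
    {Ψ : ℝ → ℝ → Fin 3 → ℝ} (hΨ : IsTransport (fun a y ↦ mulOp (A a y)) p δ Ψ)
    (hcurv : ∀ u ∈ Icc (-δ) δ, ∀ v ∈ Icc (-δ) δ, curv A (pt p u v) *ᵥ Ψ u v = 0) :
    IsParallelOn A (fun z ↦ Ψ (z 0 - p 0) (z 1 - p 1)) (sq p δ) := by
  obtain ⟨h1, h2⟩ := hΨ.partials hO (fun a ↦ contDiffOn_mulOp (hA a)) hδ hmem fun u hu v hv ↦ by
    rw [curvOp_mulOp hO hA (hmem u hu v hv), hcurv u hu v hv]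
  have h3 : ∀ i, ∀ y ∈ sq p δ, ∀ a, HasDerivAt
      (fun t : ℝ ↦ (fun z : Plane ↦ Ψ (z 0 - p 0) (z 1 - p 1) i) (y + t • unitVec a))
      (mulOp (A a y) (Ψ (y 0 - p 0) (y 1 - p 1)) i) 0 := fun i y hy a ↦
    hasDerivAt_pi.1 (h1 y hy a) i
  have h4 : ∀ i a, ContinuousOn
      (fun y : Plane ↦ mulOp (A a y) (Ψ (y 0 - p 0) (y 1 - p 1)) i) (sq p δ) := fun i a ↦
    continuousOn_pi.1 (((contDiffOn_mulOp (hA a)).continuousOn.mono hsq).clm_apply h2) i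
  exact ⟨fun i ↦ contDiffOn_one_of_partials (isOpen_sq p δ) (h3 i) (h4 i),
    fun y hy a i ↦ pd_eq_of_partials (isOpen_sq p δ) (h3 i) (h4 i) hy a⟩

/-- A system without curvature on a small square has solutions with arbitrary initial values. -/
theorem exists_isParallelOn_of_curv_eq_zero {A : Fin 2 → Plane → Matrix (Fin 3) (Fin 3) ℝ}
    (hO : IsOpen O) (hA : ∀ a i j, ContDiffOn ℝ 1 (fun y ↦ A a y i j) O) (hp : p ∈ O) :
    ∃ δ₀ > 0, ∀ δ, 0 < δ → δ ≤ δ₀ → sq p δ ⊆ O ∧ ((∀ y ∈ O, y ∈ closure (sq p δ) → curv A y = 0) →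
      ∀ x₀, ∃ Ψ, IsParallelOn A Ψ (sq p δ) ∧ Ψ p = x₀) := by
  obtain ⟨δ₁, h₁, H₁⟩ := exists_isTransport hO
    (fun a ↦ (contDiffOn_mulOp (hA a)).continuousOn) hp
  obtain ⟨δ₂, h₂, H₂⟩ := exists_sq_subset (hO.mem_nhds hp)
  refine ⟨min δ₁ δ₂, lt_min h₁ h₂, fun δ hδ hle ↦ ?_⟩
  have hsq := H₂ δ (hle.trans (min_le_right _ _))
  obtain ⟨hmem, hex⟩ := H₁ δ hδ (hle.trans (min_le_left _ _))
  refine ⟨hsq, fun hc x₀ ↦ ?_⟩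
  obtain ⟨Ψ, h0, hΨ⟩ := hex x₀
  refine ⟨_, hΨ.isParallelOn hO hA hδ hmem hsq fun u hu v hv ↦ ?_, by simpa using h0⟩
  rw [hc _ (hmem u hu v hv) (pt_mem_closure_sq hδ hu hv), Matrix.zero_mulVec]

end MatrixSystems

section Rows

open scoped Matrix

variable {Γ : Symbols} {w : Plane → ℝ} {y : Plane}

theorem finrank_ker_mulOp_rowsV (y : Plane) :
    Module.finrank ℝ (LinearMap.ker (mulOp (rowsV Γ w y) : (Fin 3 → ℝ) →ₗ[ℝ] Fin 3 → ℝ)) =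
      3 - (rowsV Γ w y).rank := by
  have h := LinearMap.finrank_range_add_finrank_ker (rowsV Γ w y).mulVecLin
  rw [Module.finrank_fin_fun] at h
  have h2 : (rowsV Γ w y).rank = Module.finrank ℝ (LinearMap.range (rowsV Γ w y).mulVecLin) := rfl
  have h3 : Module.finrank ℝ (LinearMap.ker (mulOp (rowsV Γ w y) : (Fin 3 → ℝ) →ₗ[ℝ] Fin 3 → ℝ)) =
    Module.finrank ℝ (LinearMap.ker (rowsV Γ w y).mulVecLin) := rfl
  omega

theorem secDV_eq_zero (hV : ∀ᶠ z in 𝓝 y, secV Γ w z = 0) (a : Fin 2) : secDV Γ w a y = 0 := by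
  ext i
  have h0 : secV Γ w y = 0 := hV.self_of_nhds
  have h1 : pd a (fun z ↦ secV Γ w z i) y = 0 := by
    rw [pd_congr (g := fun _ ↦ 0) (hV.mono fun z hz ↦ by simp [hz]), pd_const]
  simp [secDV, h0, h1]

theorem secDDV_eq_zero (hV : ∀ᶠ z in 𝓝 y, secV Γ w z = 0) (b c : Fin 2) :
    secDDV Γ w b c y = 0 := by
  have hD : ∀ a, ∀ᶠ z in 𝓝 y, secDV Γ w a z = 0 := fun a ↦
    hV.eventually_nhds.mono fun z hz ↦ secDV_eq_zero hz a
  have hD0 : ∀ a, secDV Γ w a y = 0 := fun a ↦ (hD a).self_of_nhds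
  ext i
  have h1 : pd b (fun z ↦ secDV Γ w c z i) y = 0 := by
    rw [pd_congr (g := fun _ ↦ 0) ((hD c).mono fun z hz ↦ by simp [hz]), pd_const]
  simp [secDDV, hD0, h1]

theorem mulOp_rowsV_eq_zero_iff {x : Fin 3 → ℝ} : mulOp (rowsV Γ w y) x = 0 ↔
    ∑ i, secV Γ w y i * x i = 0 ∧ ∀ a, ∑ i, secDV Γ w a y i * x i = 0 := by
  rw [mulOp_apply, funext_iff, Fin.forall_fin_succ, Fin.forall_fin_two]
  simp [Matrix.mulVec, dotProduct, rowsV, Fin.forall_fin_two]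

theorem vec3_zero : (![0, 0, 0] : Fin 3 → ℝ) = 0 := by
  ext i; fin_cases i <;> rfl

end Rows

namespace IsGeometryOn

open Set
open scoped Matrix

variable {Γ : Symbols} {w : Plane → ℝ} {O : Set Plane} (hG : IsGeometryOn Γ w O) {y p : Plane}
include hG

theorem curv_prolong_mulVec (hy : y ∈ O) {x : Fin 3 → ℝ} (h : ∑ j, secV Γ w y j * x j = 0) :
    curv (prolong Γ w) y *ᵥ x = 0 := by
  ext i
  simp only [Matrix.mulVec, dotProduct, hG.curv_prolong hy]
  split_ifs
  · have : ∑ j, 3 * w y * secV Γ w y j * x j = 3 * w y * ∑ j, secV Γ w y j * x j := by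
      rw [Finset.mul_sum]; exact Finset.sum_congr rfl fun _ _ ↦ by ring
    simpa [this] using Or.inr h
  · simp

theorem contDiffOn_rowsV (i j : Fin 3) : ContDiffOn ℝ 1 (fun z ↦ rowsV Γ w z i j) O := by
  fin_cases i
  · exact (hG.contDiffOn_secV j).of_le (by norm_num)
  · exact hG.contDiffOn_secDV 0 j
  · exact hG.contDiffOn_secDV 1 j

/-- The covariant derivative of the rows `V`, `D_0 V`, `D_1 V`, paired with `x`. -/
theorem fderiv_rowsV_apply (hy : y ∈ O) (a : Fin 2) (x : Fin 3 → ℝ) :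
    fderiv ℝ (fun z ↦ mulOp (rowsV Γ w z)) y (unitVec a) x +
        mulOp (rowsV Γ w y) (mulOp (prolong Γ w a y) x) =
      ![∑ i, secDV Γ w a y i * x i,
        ∑ i, secDDV Γ w a 0 y i * x i + ∑ d, Γ a 0 d y * ∑ i, secDV Γ w d y i * x i,
        ∑ i, secDDV Γ w a 1 y i * x i + ∑ d, Γ a 1 d y * ∑ i, secDV Γ w d y i * x i] := by
  ext k
  rw [Pi.add_apply, fderiv_mulOp_apply hG.isOpen hG.contDiffOn_rowsV hy]
  fin_cases k <;>
  simp [mulOp_apply, Matrix.mulVec, dotProduct, Fin.sum_univ_three, rowsV, secDDV] <;>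
  simp [secDV, Fin.sum_univ_three] <;> ring

/-- **Existence of parallel sections.**  Where the rank of `V`, `D_a V` is constant and the second
derivatives `D_b D_c V` add no new algebraic equation wherever `V ≠ 0`, all solutions of the
algebraic equations at `p` extend to parallel sections. -/
theorem exists_isParallelOn_of_rank_eq (hp : p ∈ O)
    (hrank : ∀ᶠ y in 𝓝 p, (rowsV Γ w y).rank = (rowsV Γ w p).rank) :
    ∃ δ₀ > 0, ∀ δ, 0 < δ → δ ≤ δ₀ → sq p δ ⊆ O ∧
      (∀ y ∈ sq p δ, (rowsV Γ w y).rank = (rowsV Γ w p).rank) ∧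
      ((∀ y ∈ sq p δ, secV Γ w y ≠ 0 → ∀ x, rowsV Γ w y *ᵥ x = 0 →
          ∀ b c, ∑ i, secDDV Γ w b c y i * x i = 0) →
        ∀ x₀, rowsV Γ w p *ᵥ x₀ = 0 → ∃ Ψ, IsParallelOn (prolong Γ w) Ψ (sq p δ) ∧ Ψ p = x₀) := by
  have hO := hG.isOpen
  set A := fun a y ↦ mulOp (prolong Γ w a y) with hA
  set R := fun y ↦ mulOp (rowsV Γ w y) with hR
  have hAC : ∀ a, ContDiffOn ℝ 1 (A a) O := fun a ↦ contDiffOn_mulOp (hG.contDiffOn_prolong a)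
  have hRC : ContDiffOn ℝ 1 R O := contDiffOn_mulOp hG.contDiffOn_rowsV
  have hRd : ∀ y ∈ O, DifferentiableAt ℝ R y := fun y hy ↦
    (hRC.contDiffAt (hO.mem_nhds hy)).differentiableAt one_ne_zero
  set S : Fin 2 → Plane → (Fin 3 → ℝ) →L[ℝ] (Fin 3 → ℝ) := fun a y ↦
    fderiv ℝ R y (unitVec a) + R y ∘L A a y with hS
  have hSc : ∀ a, ContinuousOn (S a) O := fun a ↦
    (((hRC.fderiv_of_isOpen (m := 0) hO (by norm_num)).continuousOn).clm_apply
      continuousOn_const).add (hRC.continuousOn.clm_comp (hAC a).continuousOn)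
  obtain ⟨C, hC0, hC⟩ := exists_bound_of_ker_le (R := R) (p := p)
    (hRC.continuousOn.continuousAt (hO.mem_nhds hp)) (hrank.mono fun y hy ↦ by
      rw [hR, finrank_ker_mulOp_rowsV, finrank_ker_mulOp_rowsV, hy])
  have hSb : ∀ a, ∀ᶠ z in 𝓝 p, ‖S a z‖ < ‖S a p‖ + 1 := fun a ↦
    ((hSc a).continuousAt (hO.mem_nhds hp)).norm.eventually_lt_const (by simp)
  set C' := ‖S 0 p‖ + ‖S 1 p‖ + 1 with hC'
  obtain ⟨δ₁, h₁, H₁⟩ := exists_isTransport hO (fun a ↦ (hAC a).continuousOn) hp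
  obtain ⟨δ₂, h₂, H₂⟩ := exists_sq_subset
    ((((hO.eventually_mem hp).and hrank).and hC).and (Filter.eventually_all.2 hSb))
  refine ⟨min δ₁ δ₂, lt_min h₁ h₂, fun δ hδ hle ↦ ?_⟩
  have hsq := H₂ δ (hle.trans (min_le_right _ _))
  obtain ⟨hmem, hex⟩ := H₁ δ hδ (hle.trans (min_le_left _ _))
  refine ⟨fun y hy ↦ (hsq hy).1.1.1, fun y hy ↦ (hsq hy).1.1.2, fun hinv x₀ hx₀ ↦ ?_⟩
  obtain ⟨Ψ, h0, hΨ⟩ := hex x₀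
  -- At the points of `D` the derivatives of the rows are combinations of the rows.  They are dense
  -- in the square: where `V` vanishes near a point, all derivatives of `V` vanish as well.
  set D : Set Plane := {y | y ∈ sq p δ ∧ ∀ a x, R y x = 0 → S a y x = 0} with hD
  have hDb : ∀ y ∈ D, ∀ a x, ‖S a y x‖ ≤ C * C' * ‖R y x‖ := by
    rintro y ⟨hy, hyk⟩ a x
    refine (pi_norm_le_iff_of_nonneg (by positivity)).2 fun k ↦ ?_
    have h1 := (hsq hy).1.2 (ContinuousLinearMap.proj (R := ℝ) (φ := fun _ : Fin 3 ↦ ℝ) k ∘L S a y)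
      (fun x hx ↦ by simp [hyk a x hx]) x
    refine h1.trans ?_
    gcongr
    refine ((ContinuousLinearMap.opNorm_comp_le _ _).trans
      (mul_le_of_le_one_left (norm_nonneg _) ?_)).trans (((hsq hy).2 a).le.trans ?_)
    · exact ContinuousLinearMap.opNorm_le_bound _ zero_le_one fun x ↦ by
        simpa using norm_le_pi_norm x k
    · fin_cases a <;> simp [hC']
  have hdense : sq p δ ⊆ closure D := by
    intro y hy
    by_cases hyc : y ∈ closure {z | z ∈ sq p δ ∧ secV Γ w z ≠ 0}
    · refine closure_mono ?_ hyc
      rintro z ⟨hz, hz0⟩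
      refine ⟨hz, fun a x hx ↦ ?_⟩
      have h1 := hinv z hz hz0 x hx
      have h2 := mulOp_rowsV_eq_zero_iff.1 hx
      have h3 := hG.fderiv_rowsV_apply (hsq hz).1.1.1 a x
      simp only [h1, h2.2, mul_zero, Finset.sum_const_zero, add_zero] at h3
      rw [vec3_zero] at h3
      simpa [S, R, A] using h3
    · refine subset_closure ⟨hy, fun a x _ ↦ ?_⟩
      have hV : ∀ᶠ z in 𝓝 y, secV Γ w z = 0 := by
        filter_upwards [isClosed_closure.isOpen_compl.mem_nhds hyc, (isOpen_sq p δ).mem_nhds hy]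
          with z hz hz'
        by_contra hne
        exact hz (subset_closure ⟨hz', hne⟩)
      have h3 := hG.fderiv_rowsV_apply (hsq hy).1.1.1 a x
      simp only [secDV_eq_zero hV, secDDV_eq_zero hV, Pi.zero_apply, zero_mul, mul_zero,
        Finset.sum_const_zero, add_zero] at h3
      rw [vec3_zero] at h3
      simpa [S, R, A] using h3
  have hb : ∀ u ∈ Icc (-δ) δ, ∀ v ∈ Icc (-δ) δ, ∀ a x,
      ‖S a (pt p u v) x‖ ≤ C * C' * ‖R (pt p u v) x‖ := by
    intro u hu v hv a x
    have hcl := closure_minimal hdense isClosed_closure (pt_mem_closure_sq hδ hu hv)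
    have hO' := hO.mem_nhds (hmem u hu v hv)
    exact le_of_tendsto_of_tendsto_of_frequently
      (((hSc a).continuousAt hO').clm_apply continuousAt_const).norm
      (((hRC.continuousOn.continuousAt hO').clm_apply continuousAt_const).norm.tendsto.const_mul _)
      ((mem_closure_iff_frequently.1 hcl).mono fun z hz ↦ hDb z hz a x)
  have hker : ∀ u ∈ Icc (-δ) δ, ∀ v ∈ Icc (-δ) δ, R (pt p u v) (Ψ u v) = 0 := fun u hu v hv ↦
    hΨ.apply_eq_zero hδ hmem hRd (mul_pos hC0 (by positivity : 0 < C')) hb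
      (by rw [h0]; exact hx₀) hu hv
  refine ⟨_, hΨ.isParallelOn hO hG.contDiffOn_prolong hδ hmem (fun y hy ↦ (hsq hy).1.1.1)
    fun u hu v hv ↦ ?_, by simpa using h0⟩
  exact hG.curv_prolong_mulVec (hmem u hu v hv) (mulOp_rowsV_eq_zero_iff.1 (hker u hu v hv)).1

/-- Where `V = 0` on a small square, all initial values extend to parallel sections. -/
theorem exists_isParallelOn_of_secV_eq_zero (hp : p ∈ O) :
    ∃ δ₀ > 0, ∀ δ, 0 < δ → δ ≤ δ₀ → sq p δ ⊆ O ∧ ((∀ y ∈ sq p δ, secV Γ w y = 0) →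
      ∀ x₀, ∃ Ψ, IsParallelOn (prolong Γ w) Ψ (sq p δ) ∧ Ψ p = x₀) := by
  obtain ⟨δ₀, h₀, H⟩ := exists_isParallelOn_of_curv_eq_zero hG.isOpen hG.contDiffOn_prolong hp
  refine ⟨δ₀, h₀, fun δ hδ hle ↦ ⟨(H δ hδ hle).1, fun hV ↦ (H δ hδ hle).2 fun y hy hcl ↦ ?_⟩⟩
  have hVy : ∀ j, secV Γ w y j = 0 := fun j ↦ by
    have hc := ((hG.contDiffOn_secV j).continuousOn.continuousAt (hG.isOpen.mem_nhds hy))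
    have hz := closure_mono (t := {(0 : ℝ)}) (by rintro _ ⟨z, hz, rfl⟩; simp [hV z hz])
      (mem_closure_image hc hcl)
    simpa using hz
  ext i j
  rw [hG.curv_prolong hy, hVy]
  simp

end IsGeometryOn

/-! ### The algebraic equations at a point -/

section Rank

open scoped Matrix

theorem minor_eq_zero_of_rank_le_one {m : Matrix (Fin 3) (Fin 3) ℝ} (h : m.rank ≤ 1)
    (i j k l : Fin 3) : m i k * m j l = m i l * m j k := by
  rw [Matrix.rank_eq_finrank_span_row, finrank_le_one_iff] at h
  obtain ⟨v, hv⟩ := h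
  have hrow : ∀ i, ∃ c : ℝ, ∀ k, m i k = c * (v : Fin 3 → ℝ) k := fun i ↦ by
    obtain ⟨c, hc⟩ := hv ⟨m i, Submodule.subset_span ⟨i, rfl⟩⟩
    exact ⟨c, fun k ↦ (congrFun (congrArg Subtype.val hc) k).symm⟩
  obtain ⟨c, hc⟩ := hrow i
  obtain ⟨d, hd⟩ := hrow j
  rw [hc, hc, hd, hd]
  ring

theorem eq_zero_of_rank_eq_zero {m : Matrix (Fin 3) (Fin 3) ℝ} (h : m.rank = 0) : m = 0 := by
  rw [Matrix.rank_eq_finrank_span_row, Submodule.finrank_eq_zero, Submodule.span_eq_bot] at h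
  ext i j
  exact congrFun (h (m i) ⟨i, rfl⟩) j

variable {Γ : Symbols} {w : Plane → ℝ} {y : Plane}

theorem rank_rowsV_le_one_of_forall (hV : ∀ a, ∃ c : ℝ, c • secV Γ w y = secDV Γ w a y) :
    (rowsV Γ w y).rank ≤ 1 := by
  obtain ⟨c, hc⟩ := hV 0
  obtain ⟨d, hd⟩ := hV 1
  have : rowsV Γ w y = Matrix.vecMulVec ![1, c, d] (secV Γ w y) := by
    ext i j
    fin_cases i
    · simp [rowsV, Matrix.vecMulVec_apply]
    · simpa [rowsV, Matrix.vecMulVec_apply] using (congrFun hc j).symm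
    · simpa [rowsV, Matrix.vecMulVec_apply] using (congrFun hd j).symm
  rw [this]
  exact Matrix.rank_vecMulVec_le _ _

theorem secV_eq_zero_of_rank (hrank : (rowsV Γ w y).rank = 0) : secV Γ w y = 0 :=
  congrFun (eq_zero_of_rank_eq_zero hrank) 0

end Rank

namespace IsGeometryOn

open scoped Matrix

variable {Γ : Symbols} {w : Plane → ℝ} {O : Set Plane} (hG : IsGeometryOn Γ w O) {y : Plane}
  (hy : y ∈ O)
include hG hy

/-- Where the rank is at least two and `V ≠ 0`, the equation `I_S = 0` says that the second
derivatives of `V` vanish on the solutions of the algebraic equations. -/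
theorem secDDV_pairing_of_invS (hrank : 2 ≤ (rowsV Γ w y).rank) (hV : secV Γ w y ≠ 0)
    (hS : ∀ a b c, invS Γ w a b c y = 0) {x : Fin 3 → ℝ} (hx : rowsV Γ w y *ᵥ x = 0)
    (b c : Fin 2) : ∑ i, secDDV Γ w b c y i * x i = 0 := by
  obtain ⟨h0, hD⟩ := mulOp_rowsV_eq_zero_iff.1 hx
  obtain ⟨a, ha⟩ : ∃ a, ∀ c : ℝ, c • secV Γ w y ≠ secDV Γ w a y := by
    by_contra! hne
    have := rank_rowsV_le_one_of_forall hne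
    omega
  have hli := (LinearIndependent.pair_iff' hV).2 ha
  have hsym : ∀ b c, ∑ i, (secDDV Γ w b c y i + secDDV Γ w c b y i) * x i = 0 := by
    intro b c
    obtain ⟨v, hv0, hv⟩ := Matrix.exists_vecMul_eq_zero_iff.2 (hS a b c)
    have hvi : ∀ i, v 0 * secV Γ w y i + v 1 * secDV Γ w a y i +
        v 2 * (1 / 2 * (secDDV Γ w b c y i + secDDV Γ w c b y i)) = 0 := fun i ↦ by
      simpa [Matrix.vecMul, dotProduct, Fin.sum_univ_three] using congrFun hv i
    have hv2 : v 2 ≠ 0 := by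
      intro hv2
      have h1 := LinearIndependent.pair_iff.1 hli (v 0) (v 1) (by
        ext i
        simpa [hv2] using hvi i)
      apply hv0
      ext i
      fin_cases i
      exacts [h1.1, h1.2, hv2]
    have h2 := hD a
    simp only [Fin.sum_univ_three] at h0 h2 ⊢
    have h3 : v 2 * ((secDDV Γ w b c y 0 + secDDV Γ w c b y 0) * x 0 +
      (secDDV Γ w b c y 1 + secDDV Γ w c b y 1) * x 1 +
      (secDDV Γ w b c y 2 + secDDV Γ w c b y 2) * x 2) = 0 := by
      linear_combination 2 * x 0 * hvi 0 + 2 * x 1 * hvi 1 + 2 * x 2 * hvi 2 - 2 * v 0 * h0 -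
        2 * v 1 * h2
    exact (mul_eq_zero.1 h3).resolve_left hv2
  have hskew : ∑ i, (secDDV Γ w 0 1 y i - secDDV Γ w 1 0 y i) * x i = 0 := by
    simp only [hG.secDDV_comm hy, Fin.sum_univ_three] at h0 ⊢
    linear_combination 3 * w y * beta Γ w y * h0
  have h1 := hsym b c
  simp only [Fin.sum_univ_three] at h1 hskew ⊢
  fin_cases b <;> fin_cases c <;> dsimp only [Fin.zero_eta, Fin.mk_one] at h1 ⊢
  · linear_combination h1 / 2
  · linear_combination h1 / 2 + hskew / 2
  · linear_combination h1 / 2 - hskew / 2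
  · linear_combination h1 / 2

/-- Where the rank is at most one near a point with `V ≠ 0`, the line spanned by `V` is preserved
by `D`. -/
theorem secDDV_pairing_of_rank_le_one (hrank : ∀ᶠ z in 𝓝 y, (rowsV Γ w z).rank ≤ 1)
    (hV : secV Γ w y ≠ 0) {x : Fin 3 → ℝ} (hx : rowsV Γ w y *ᵥ x = 0)
    (b c : Fin 2) : ∑ i, secDDV Γ w b c y i * x i = 0 := by
  obtain ⟨h0, hD⟩ := mulOp_rowsV_eq_zero_iff.1 hx
  have hd : ∀ i, DifferentiableAt ℝ (fun z ↦ secV Γ w z i) y := fun i ↦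
    (hG.contDiffOn_secV i).diffAt hG.isOpen two_ne_zero hy
  have hdD : ∀ a i, DifferentiableAt ℝ (fun z ↦ secDV Γ w a z i) y := fun a i ↦
    (hG.contDiffOn_secDV a i).diffAt hG.isOpen one_ne_zero hy
  have hmin : ∀ z, (rowsV Γ w z).rank ≤ 1 → ∀ a i j,
      secV Γ w z i * secDV Γ w a z j = secV Γ w z j * secDV Γ w a z i := by
    intro z hz a i j
    have := minor_eq_zero_of_rank_le_one hz 0 a.succ i j
    fin_cases a <;> exact this
  have hmin' : ∀ a b i j, secDV Γ w a y i * secDV Γ w b y j =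
      secDV Γ w a y j * secDV Γ w b y i := by
    intro a b i j
    have := minor_eq_zero_of_rank_le_one hrank.self_of_nhds a.succ b.succ i j
    fin_cases a <;> fin_cases b <;> exact this
  have hy1 := hmin y hrank.self_of_nhds
  -- differentiate the vanishing minors of `V` and `D_c V`
  have key : ∀ i j, secV Γ w y i * secDDV Γ w b c y j = secV Γ w y j * secDDV Γ w b c y i := by
    intro i j
    have h1 : pd b (fun z ↦ secV Γ w z i * secDV Γ w c z j) y =
        pd b (fun z ↦ secV Γ w z j * secDV Γ w c z i) y :=
      pd_congr (hrank.mono fun z hz ↦ hmin z hz c i j)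
    rw [pd_mul (hd i) (hdD c j), pd_mul (hd j) (hdD c i)] at h1
    have h2 := hmin' b c i j
    have e : ∀ i, pd b (fun z ↦ secV Γ w z i) y =
        secDV Γ w b y i - ∑ k, secV Γ w y k * prolong Γ w b y k i := fun i ↦ by
      simp [secDV]
    rw [e, e] at h1
    simp only [secDDV, Fin.sum_univ_two, Fin.sum_univ_three] at h1 ⊢
    linear_combination h1 - h2 - Γ b c 0 y * hy1 0 i j - Γ b c 1 y * hy1 1 i j +
      prolong Γ w b y 0 j * hy1 c i 0 + prolong Γ w b y 1 j * hy1 c i 1 +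
      prolong Γ w b y 2 j * hy1 c i 2 + prolong Γ w b y 0 i * hy1 c 0 j +
      prolong Γ w b y 1 i * hy1 c 1 j + prolong Γ w b y 2 i * hy1 c 2 j
  obtain ⟨i, hi⟩ := Function.ne_iff.1 hV
  have h3 : secV Γ w y i * ∑ j, secDDV Γ w b c y j * x j = 0 := by
    simp only [Fin.sum_univ_three] at h0 ⊢
    linear_combination x 0 * key i 0 + x 1 * key i 1 + x 2 * key i 2 + secDDV Γ w b c y i * h0
  exact (mul_eq_zero.1 h3).resolve_left hi

/-- The components of `T` are the `2 × 2` minors of `matM` that contain the entry `β`. -/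
theorem tensT_eq_zero_of_rank (hrank : (rowsV Γ w y).rank ≤ 1) (a b : Fin 2) :
    tensT Γ w a b y = 0 := by
  rw [hG.rank_rowsV hy] at hrank
  have := minor_eq_zero_of_rank_le_one hrank a.succ 0 2 b.castSucc
  fin_cases a <;> fin_cases b <;> simp [matM] at this <;> simp [tensT] <;> linear_combination this

theorem rank_le_one_of_tensT (hT : ∀ a b, tensT Γ w a b y = 0) (hβ : beta Γ w y ≠ 0) :
    (rowsV Γ w y).rank ≤ 1 := by
  rw [hG.rank_rowsV hy]
  have : matM Γ w y = Matrix.vecMulVec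
      ![1, tensN Γ w 0 y / beta Γ w y, tensN Γ w 1 y / beta Γ w y] (secV Γ w y) := by
    have hM : ∀ a b, tensM Γ w a b y = tensN Γ w a y / beta Γ w y * vecF Γ w b y := fun a b ↦ by
      have := hT a b
      rw [tensT] at this
      field_simp
      linarith
    ext i j
    fin_cases i <;> fin_cases j <;> simp [matM, Matrix.vecMulVec_apply, secV, hM, hβ]
  rw [this]
  exact Matrix.rank_vecMulVec_le _ _

/-- If the Ricci tensor is symmetric near a point and `T = 0`, then `V = 0`. -/
theorem secV_eq_zero_of_tensT (hT : ∀ a b, tensT Γ w a b y = 0)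
    (hβ : ∀ᶠ z in 𝓝 y, beta Γ w z = 0) : secV Γ w y = 0 := by
  have hw := hG.vol_ne_zero y hy
  have hP : ∀ᶠ z in 𝓝 y, schouten Γ 1 0 z - schouten Γ 0 1 z = 0 := by
    filter_upwards [hβ, hG.isOpen.eventually_mem hy] with z hz hzO
    have h0 := hG.vol_ne_zero z hzO
    rw [hG.beta_eq hzO] at hz
    simpa [h0] using hz
  have hB : ∀ b c, ∀ᶠ z in 𝓝 y, skewB Γ b c z = 0 := fun b c ↦ hP.mono fun z hz ↦ by
    fin_cases b <;> fin_cases c <;> simp [skewB] <;> linarith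
  have hB1 : ∀ b c, skewB Γ b c y = 0 := fun b c ↦ (hB b c).self_of_nhds
  have hB2 : ∀ a b c, nabla₂ Γ (skewB Γ) a b c y = 0 := fun a b c ↦ by
    have : pd a (skewB Γ b c) y = 0 := by rw [pd_congr (g := fun _ ↦ 0) (hB b c), pd_const]
    simp [nabla₂, this, hB1]
  have hβy := hβ.self_of_nhds
  have hNF : ∀ a b, vecFLow Γ w a y * vecF Γ w b y = 0 := fun a b ↦ by
    have := hT a b
    simpa [tensT, tensN, hB2, hβy] using this
  have hF0 : vecF Γ w 0 y = 0 := by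
    have := hNF 1 0
    simpa [vecFLow, epsLow, hw] using this
  have hF1 : vecF Γ w 1 y = 0 := by
    have := hNF 0 1
    simpa [vecFLow, epsLow, hw] using this
  ext i
  fin_cases i <;> simp [secV, hF0, hF1, hβy]

theorem beta_eq_zero_iff : beta Γ w y = 0 ↔ ∀ a b, ricci Γ a b y = ricci Γ b a y := by
  have hw := hG.vol_ne_zero y hy
  rw [hG.beta_eq hy]
  simp only [div_eq_zero_iff, hw, or_false, mul_eq_zero, two_ne_zero, false_or, schouten]
  constructor
  · intro h a b
    fin_cases a <;> fin_cases b <;> simp <;> linarith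
  · intro h
    linear_combination 1 / 3 * h 1 0

end IsGeometryOn

/-! ### Projective flatness in coordinates -/

/-- The change of the Schouten tensor under a projective change of the connection, so that
`schouten - projSchouten` is the Schouten tensor of the changed connection. -/
def projSchouten (Γ : Symbols) (Υ : Fin 2 → Plane → ℝ) (a b : Fin 2) (y : Plane) : ℝ :=
  pd a (Υ b) y - ∑ e, Γ a b e y * Υ e y - Υ a y * Υ b y

/-- The system of partial differential equations of a function `f`, with `f_a = ∂_a f`, whose
Hessian is `∇_a f_b = - P_{ab} f`. -/
def tractorSystem (Γ : Symbols) (a : Fin 2) (y : Plane) : Matrix (Fin 3) (Fin 3) ℝ :=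
  !![0, delta a 0, delta a 1;
     -schouten Γ a 0 y, Γ a 0 0 y, Γ a 0 1 y;
     -schouten Γ a 1 y, Γ a 1 0 y, Γ a 1 1 y]

namespace IsGeometryOn

variable {Γ : Symbols} {w : Plane → ℝ} {O : Set Plane} (hG : IsGeometryOn Γ w O) {y p : Plane}
  {Υ : Fin 2 → Plane → ℝ}
include hG

theorem riem_projChange (hy : y ∈ O) (hΥ : ∀ a, DifferentiableAt ℝ (Υ a) y) (a b c d : Fin 2) :
    riem (projChange Γ Υ) a b c d y =
      delta a c * (schouten Γ b d y - projSchouten Γ Υ b d y) -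
      delta b c * (schouten Γ a d y - projSchouten Γ Υ a d y) +
      ((schouten Γ b a y - projSchouten Γ Υ b a y) -
        (schouten Γ a b y - projSchouten Γ Υ a b y)) * delta d c := by
  have h1 : riem (projChange Γ Υ) a b c d y = riem Γ a b c d y -
      (delta a c * projSchouten Γ Υ b d y - delta b c * projSchouten Γ Υ a d y +
      (projSchouten Γ Υ b a y - projSchouten Γ Υ a b y) * delta d c) := by
    have hpd : ∀ e a b c, pd e (projChange Γ Υ a b c) y = pd e (Γ a b c) y +
        delta a c * pd e (Υ b) y + delta b c * pd e (Υ a) y := by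
      intro e a b c
      have hf : projChange Γ Υ a b c =
          fun z ↦ (Γ a b c z + delta a c * Υ b z) + delta b c * Υ a z := rfl
      rw [hf, pd_add (((hG.diff_symbols hy a b c).fun_add ((hΥ b).const_mul _)))
        ((hΥ a).const_mul _), pd_add (hG.diff_symbols hy a b c) ((hΥ b).const_mul _),
        pd_const_mul _ (hΥ b), pd_const_mul _ (hΥ a)]
    rw [riem, riem, hpd, hpd]
    simp only [projChange, projSchouten, Fin.sum_univ_two]
    have hs := fun c ↦ hG.symm y hy 1 0 c
    fin_cases a <;> fin_cases b <;> fin_cases c <;> fin_cases d <;> simp [hs] <;> ring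
  rw [h1, hG.riem_eq hy]
  ring

/-- A projectively flat connection with symmetric Ricci tensor has `V = 0`. -/
theorem secV_eq_zero_of_projChange (hsym : ∀ y ∈ O, ∀ a b, ricci Γ a b y = ricci Γ b a y)
    (hΥ : ∀ a, ContDiffOn ℝ 1 (Υ a) O)
    (hflat : ∀ y ∈ O, ∀ a b c d, riem (projChange Γ Υ) a b c d y = 0) (hy : y ∈ O) :
    secV Γ w y = 0 := by
  have hO := hG.isOpen
  have hd : ∀ y ∈ O, ∀ a, DifferentiableAt ℝ (Υ a) y := fun y hy a ↦
    (hΥ a).diffAt hO one_ne_zero hy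
  have hP : ∀ y ∈ O, ∀ a b, schouten Γ a b y = projSchouten Γ Υ a b y := by
    intro y hy
    have h := fun c d ↦ (hG.riem_projChange hy (hd y hy) 0 1 c d).symm.trans (hflat y hy 0 1 c d)
    have h00 := h 0 0
    have h01 := h 0 1
    have h10 := h 1 0
    have h11 := h 1 1
    simp at h00 h01 h10 h11
    intro a b
    fin_cases a <;> fin_cases b <;> simp <;> linarith
  have hpd : ∀ y ∈ O, ∀ a b, pd a (Υ b) y =
      schouten Γ a b y + (Γ a b 0 y * Υ 0 y + Γ a b 1 y * Υ 1 y) + Υ a y * Υ b y := by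
    intro y hy a b
    rw [hP y hy, projSchouten, Fin.sum_univ_two]
    ring
  have hS : ∀ y ∈ O, ∀ a b, schouten Γ a b y = schouten Γ b a y := fun y hy a b ↦ by
    rw [schouten, schouten, hsym y hy b a]
  have hC : ∀ a b, ContDiffOn ℝ 1 (pd a (Υ b)) O := fun a b ↦
    ((((hG.contDiffOn_schouten a b).of_le (by norm_num)).add
      (((hG.symbols (by norm_num) a b 0).mul (hΥ 0)).add
        ((hG.symbols (by norm_num) a b 1).mul (hΥ 1)))).add ((hΥ a).mul (hΥ b))).congr
      fun z hz ↦ hpd z hz a b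
  have hpp : ∀ e a b, pd e (pd a (Υ b)) y = pd e (schouten Γ a b) y +
      (pd e (Γ a b 0) y * Υ 0 y + Γ a b 0 y * pd e (Υ 0) y +
        (pd e (Γ a b 1) y * Υ 1 y + Γ a b 1 y * pd e (Υ 1) y)) +
      (pd e (Υ a) y * Υ b y + Υ a y * pd e (Υ b) y) := by
    intro e a b
    have d1 := fun c ↦ (hG.diff_symbols hy a b c).fun_mul (hd y hy c)
    rw [pd_congr_of_eqOn hO (fun z hz ↦ hpd z hz a b) hy,
      pd_add ((hG.diff_schouten hy a b).fun_add ((d1 0).fun_add (d1 1)))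
        ((hd y hy a).fun_mul (hd y hy b)),
      pd_add (hG.diff_schouten hy a b) ((d1 0).fun_add (d1 1)), pd_add (d1 0) (d1 1),
      pd_mul (hG.diff_symbols hy a b 0) (hd y hy 0), pd_mul (hG.diff_symbols hy a b 1) (hd y hy 1),
      pd_mul (hd y hy a) (hd y hy b)]
  have hR := hG.riem_eq hy
  have hs := fun c ↦ hG.symm y hy 1 0 c
  have hsp := fun e c ↦ hG.pd_symbols_symm hy e 1 0 c
  have hL : ∀ b, nabla₂ Γ (schouten Γ) 0 1 b y = nabla₂ Γ (schouten Γ) 1 0 b y := by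
    intro b
    have h1 := pd_comm_of_contDiffOn hO (hΥ b) (hC 0 b) (hC 1 b) hy
    have hR0 := hR 0 1 0 b
    have hR1 := hR 0 1 1 b
    have hS1 := hS y hy 1 0
    simp only [hpp, hpd y hy] at h1
    simp only [nabla₂, riem, Fin.sum_univ_two] at hR0 hR1 ⊢
    fin_cases b <;> simp [hs, hsp, hS1] at hR0 hR1 h1 ⊢
    · linear_combination h1 - Υ 0 y * hR0 - Υ 1 y * hR1
    · linear_combination h1 - Υ 0 y * hR0 - Υ 1 y * hR1
  have hN : ∀ a b c, nabla₂ Γ (schouten Γ) a b c y = nabla₂ Γ (schouten Γ) a c b y := by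
    intro a b c
    rw [nabla₂, nabla₂, pd_congr_of_eqOn hO (fun z hz ↦ hS z hz b c) hy]
    simp only [hS y hy b, hS y hy _ c, Fin.sum_univ_two]
    ring
  have hβ : beta Γ w y = 0 := (hG.beta_eq_zero_iff hy).2 (hsym y hy)
  ext i
  fin_cases i
  · simp [secV]
    rw [hG.vecF_zero hy, hN 0 1 1, hN 1 1 0, hL 1]
    ring
  · simp [secV]
    rw [hG.vecF_one hy, hN 0 0 1, hL 0]
    ring
  · simpa [secV] using hβ

/-- The Hessian equation `∇_a ∇_b f = - P_{ab} f` is integrable where `V = 0`. -/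
theorem curv_tractorSystem (hy : y ∈ O) (hV : ∀ z ∈ O, secV Γ w z = 0) :
    curv (tractorSystem Γ) y = 0 := by
  have hw := hG.vol_ne_zero y hy
  have hF0 : vecF Γ w 0 y = 0 := congrFun (hV y hy) 0
  have hF1 : vecF Γ w 1 y = 0 := congrFun (hV y hy) 1
  have hP : ∀ z ∈ O, schouten Γ 1 0 z = schouten Γ 0 1 z := by
    intro z hz
    have hβ : beta Γ w z = 0 := congrFun (hV z hz) 2
    have h0 := hG.vol_ne_zero z hz
    rw [hG.beta_eq hz] at hβ
    simp [h0] at hβ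
    linarith
  have hN : ∀ a, nabla₂ Γ (schouten Γ) a 1 0 y = nabla₂ Γ (schouten Γ) a 0 1 y := by
    intro a
    rw [nabla₂, nabla₂, pd_congr_of_eqOn hG.isOpen (fun z hz ↦ hP z hz) hy]
    simp only [hP y hy, Fin.sum_univ_two]
    ring
  rw [hG.vecF_zero hy, hN 1] at hF0
  rw [hG.vecF_one hy, hN 0] at hF1
  simp [hw] at hF0 hF1
  have hR := fun c d ↦ hG.riem_eq hy 0 1 c d
  have hs := fun c ↦ hG.symm y hy 1 0 c
  have hsp := fun e c ↦ hG.pd_symbols_symm hy e 1 0 c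
  have hPp := fun e ↦ pd_congr_of_eqOn (a := e) hG.isOpen (fun z hz ↦ hP z hz) hy
  have hPy := hP y hy
  have hn : ∀ e a b, pd e (fun z ↦ -schouten Γ a b z) y = -pd e (schouten Γ a b) y :=
    fun e a b ↦ pd_neg
  simp only [nabla₂, riem, Fin.sum_univ_two] at hF0 hF1 hR
  have h00 := hR 0 0
  have h01 := hR 0 1
  have h10 := hR 1 0
  have h11 := hR 1 1
  simp [hs, hsp, hPy] at hF0 hF1 h00 h01 h10 h11
  ext i j
  fin_cases i <;> fin_cases j <;>
    simp [curv, tractorSystem, pd_const, hn, hs, hsp, hPy, hPp]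
  · linear_combination hF1
  · linear_combination h00
  · linear_combination h10
  · linear_combination -hF0
  · linear_combination h01
  · linear_combination h11

/-- Where `V = 0`, the connection is projectively flat: if `f` solves `∇_a ∇_b f = - P_{ab} f`,
then `Υ = - d log |f|` flattens it. -/
theorem exists_projChange (hp : p ∈ O) (hV : ∀ z ∈ O, secV Γ w z = 0) :
    ∃ O' : Set Plane, IsOpen O' ∧ p ∈ O' ∧ O' ⊆ O ∧ ∃ Υ : Fin 2 → Plane → ℝ,
      (∀ a, ContDiffOn ℝ 1 (Υ a) O') ∧
        ∀ y ∈ O', ∀ a b c d, riem (projChange Γ Υ) a b c d y = 0 := by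
  have hA : ∀ a i j, ContDiffOn ℝ 1 (fun y ↦ tractorSystem Γ a y i j) O := by
    intro a i j
    have h1 := fun a b ↦ (hG.contDiffOn_schouten a b).of_le (m := 1) (by norm_num)
    have h2 := fun a b c ↦ hG.symbols (n := 1) (by norm_num) a b c
    fin_cases i <;> fin_cases j <;> simp [tractorSystem, contDiffOn_const, h2] <;>
      exact (h1 _ _).neg
  obtain ⟨δ, hδ, H⟩ := exists_isParallelOn_of_curv_eq_zero hG.isOpen hA hp
  obtain ⟨hsub, hex⟩ := H δ hδ le_rfl
  obtain ⟨Ψ, hΨ, hΨp⟩ := hex (fun y hy _ ↦ hG.curv_tractorSystem hy hV) ![1, 0, 0]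
  have hopen : IsOpen (sq p δ ∩ {y | Ψ y 0 ≠ 0}) :=
    (hΨ.contDiffOn 0).continuousOn.isOpen_inter_preimage (isOpen_sq p δ) isOpen_ne
  set O' := sq p δ ∩ {y | Ψ y 0 ≠ 0} with hO'
  have hC : ∀ i, ContDiffOn ℝ 1 (fun y ↦ Ψ y i) O' := fun i ↦
    (hΨ.contDiffOn i).mono Set.inter_subset_left
  have hd : ∀ y ∈ O', ∀ i, DifferentiableAt ℝ (fun y ↦ Ψ y i) y := fun y hy i ↦
    (hC i).diffAt hopen one_ne_zero hy
  refine ⟨O', hopen, ⟨mem_sq_self p hδ, by simp [hΨp]⟩, fun y hy ↦ hsub hy.1,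
    fun a y ↦ -(Ψ y a.succ) / Ψ y 0, fun a ↦ ?_, fun y hy a b c d ↦ ?_⟩
  · exact (hC a.succ).neg.div (hC 0) fun y hy ↦ hy.2
  have hO'O : O' ⊆ O := fun y hy ↦ hsub hy.1
  have h0 : Ψ y 0 ≠ 0 := hy.2
  have hX : ∀ a b, projSchouten Γ (fun a y ↦ -(Ψ y a.succ) / Ψ y 0) a b y = schouten Γ a b y := by
    intro a b
    rw [projSchouten, pd_div (hd y hy b.succ).fun_neg (hd y hy 0) h0, pd_neg,
      hΨ.pd_eq y hy.1, hΨ.pd_eq y hy.1]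
    fin_cases a <;> fin_cases b <;>
      simp [tractorSystem, Fin.sum_univ_three] <;> field_simp <;> ring
  have hd' : ∀ a : Fin 2, DifferentiableAt ℝ (fun y ↦ -(Ψ y a.succ) / Ψ y 0) y := fun a ↦ by
    simp only [div_eq_mul_inv]
    exact (hd y hy a.succ).fun_neg.fun_mul ((hd y hy 0).fun_inv h0)
  rw [hG.riem_projChange (hO'O hy) hd']
  simp [hX]

end IsGeometryOn

/-! ### The coordinate frame of a chart -/

section Frame

variable {M : Type*} [TopologicalSpace M] [ChartedSpace Plane M] [IsManifold (𝓡 2) 6 M]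
  {e : OpenPartialHomeomorph M Plane} {x : M}

/-- The differential of a function of class `C^6` is a one-form of class `C^5`. -/
theorem contMDiffAt_mvfderiv {f : M → ℝ} (hf : ContMDiffAt (𝓡 2) 𝓘(ℝ, ℝ) 6 f x) :
    ContMDiffAt (𝓡 2) ((𝓡 2).prod 𝓘(ℝ, Plane →L[ℝ] ℝ)) 5
      (fun z ↦ Bundle.TotalSpace.mk' (Plane →L[ℝ] ℝ)
        (E := fun z : M ↦ TangentSpace (𝓡 2) z →L[ℝ] Bundle.Trivial M ℝ z) z
          (mvfderiv (𝓡 2) f z)) x := by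
  rw [contMDiffAt_hom_bundle]
  refine ⟨contMDiffAt_id, ?_⟩
  have h := hf.mfderiv_const (m := 5) (by norm_num)
  refine h.congr_of_eventuallyEq (Filter.Eventually.of_forall fun z ↦ ?_)
  ext v
  simp [inTangentCoordinates, ContinuousLinearMap.inCoordinates, mvfderiv]
  rfl

section

variable (he : e ∈ atlas Plane M)
include he

theorem contMDiffAt_chart (hx : x ∈ e.source) : ContMDiffAt (𝓡 2) 𝓘(ℝ, Plane) 6 e x :=
  contMDiffAt_of_mem_maximalAtlas (IsManifold.subset_maximalAtlas he) hx

theorem contMDiffAt_chart_symm {y : Plane} (hy : y ∈ e.target) :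
    ContMDiffAt 𝓘(ℝ, Plane) (𝓡 2) 6 e.symm y :=
  contMDiffAt_symm_of_mem_maximalAtlas (IsManifold.subset_maximalAtlas he) hy

theorem mdifferentiable_chart_of_mem : e.MDifferentiable (𝓡 2) 𝓘(ℝ, Plane) :=
  mdifferentiable_of_mem_atlas he

theorem isInvertible_mfderiv_chart (hx : x ∈ e.source) :
    (mfderiv (𝓡 2) 𝓘(ℝ, Plane) e x).IsInvertible :=
  ⟨(mdifferentiable_chart_of_mem he).mfderiv hx, rfl⟩

theorem mvfderiv_coordField (hx : x ∈ e.source) (a : Fin 2) :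
    mvfderiv (𝓡 2) (e : M → Plane) x (coordField e a x) = unitVec a := by
  have h := (isInvertible_mfderiv_chart he hx).self_comp_inverse
  have h2 := DFunLike.congr_fun h
    ((NormedSpace.fromTangentSpace (𝕜 := ℝ) (e x)).symm (EuclideanSpace.single a (1 : ℝ)))
  exact h2

theorem coordComp_coordField (hx : x ∈ e.source) (a c : Fin 2) :
    coordComp e x (coordField e a x) c = delta a c := by
  rw [coordComp, mvfderiv_coordField he hx]
  simp [delta, eq_comm]

theorem eq_sum_coordField (hx : x ∈ e.source) (v : TangentSpace (𝓡 2) x) :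
    v = ∑ c, coordComp e x v c • coordField e c x := by
  apply (isInvertible_mfderiv_chart he hx).injective
  have h : mvfderiv (𝓡 2) (e : M → Plane) x v =
      mvfderiv (𝓡 2) (e : M → Plane) x (∑ c, coordComp e x v c • coordField e c x) := by
    simp only [map_add, map_smul, mvfderiv_coordField he hx, Fin.sum_univ_two]
    exact sum_coord_smul_unitVec _
  exact h

theorem contMDiffAt_coordField (hx : x ∈ e.source) (a : Fin 2) :
    ContMDiffAt (𝓡 2) ((𝓡 2).prod 𝓘(ℝ, Plane)) 5
      (fun z ↦ Bundle.TotalSpace.mk' Plane (E := fun z : M ↦ TangentSpace (𝓡 2) z) z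
        (coordField e a z)) x := by
  refine ContMDiffAt.mpullback_vectorField_preimage (n := 6) ?_ (contMDiffAt_chart he hx)
    (isInvertible_mfderiv_chart he hx) (by norm_num)
  exact contMDiffAt_vectorSpace_iff_contDiffAt.2 contDiffAt_const

theorem vectorDiffAt_coordField (hx : x ∈ e.source) (a : Fin 2) :
    VectorDiffAt (coordField e a) x :=
  (contMDiffAt_coordField he hx a).mdifferentiableAt (by norm_num)

theorem contMDiffAt_chart_apply (hx : x ∈ e.source) (c : Fin 2) :
    ContMDiffAt (𝓡 2) 𝓘(ℝ, ℝ) 6 (fun z ↦ e z c) x :=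
  (EuclideanSpace.proj c : Plane →L[ℝ] ℝ).contMDiff.contMDiffAt.comp x (contMDiffAt_chart he hx)

theorem mvfderiv_chart_apply (hx : x ∈ e.source) (v : TangentSpace (𝓡 2) x) (c : Fin 2) :
    mvfderiv (𝓡 2) (fun z ↦ e z c) x v = coordComp e x v c := by
  have h := mvfderiv_comp_apply (I := 𝓡 2) (I' := 𝓘(ℝ, Plane)) (f := (e : M → Plane))
    (g := fun y : Plane ↦ y c) x
    ((EuclideanSpace.proj c : Plane →L[ℝ] ℝ).contMDiff.contMDiffAt.mdifferentiableAt one_ne_zero)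
    ((contMDiffAt_chart he hx).mdifferentiableAt (by norm_num)) v
  have h2 : mfderiv 𝓘(ℝ, Plane) 𝓘(ℝ, ℝ) (fun y : Plane ↦ y c) (e x) =
      (EuclideanSpace.proj c : Plane →L[ℝ] ℝ) := by
    rw [mfderiv_eq_fderiv]
    exact (EuclideanSpace.proj c : Plane →L[ℝ] ℝ).fderiv
  have h3 : mvfderiv 𝓘(ℝ, Plane) (fun y : Plane ↦ y c) (e x) =
      (EuclideanSpace.proj c : Plane →L[ℝ] ℝ) := by
    rw [mvfderiv, h2]
    rfl
  rw [h3] at h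
  exact h

theorem mfderiv_chart_symm {y : Plane} (hy : y ∈ e.target) (a : Fin 2) :
    mfderiv 𝓘(ℝ, Plane) (𝓡 2) e.symm y (unitVec a) = coordField e a (e.symm y) := by
  apply (isInvertible_mfderiv_chart he (e.map_target hy)).injective
  have h := DFunLike.congr_fun ((mdifferentiable_chart_of_mem he).comp_symm_deriv hy) (unitVec a)
  exact h.trans (mvfderiv_coordField he (e.map_target hy) a).symm

/-- The partial derivatives of a function in the chart are its derivatives along the frame. -/
theorem pd_comp_chart_symm {y : Plane} (hy : y ∈ e.target) {f : M → ℝ}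
    (hf : MDifferentiableAt (𝓡 2) 𝓘(ℝ, ℝ) f (e.symm y)) (a : Fin 2) :
    pd a (fun z ↦ f (e.symm z)) y = mvfderiv (𝓡 2) f (e.symm y) (coordField e a (e.symm y)) := by
  have h := mvfderiv_comp_apply (I := 𝓡 2) (I' := 𝓘(ℝ, Plane)) (f := (e.symm : Plane → M))
    (g := f) y hf ((contMDiffAt_chart_symm he hy).mdifferentiableAt (by norm_num)) (unitVec a)
  rw [mfderiv_chart_symm he hy] at h
  rw [← h, pd, mvfderiv, mfderiv_eq_fderiv]
  rfl

theorem contDiffAt_comp_chart_symm {y : Plane} (hy : y ∈ e.target) {f : M → ℝ}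
    {n : WithTop ℕ∞} (hn : n ≤ 6) (hf : ContMDiffAt (𝓡 2) 𝓘(ℝ, ℝ) n f (e.symm y)) :
    ContDiffAt ℝ n (fun z ↦ f (e.symm z)) y :=
  contMDiffAt_iff_contDiffAt.1
    (ContMDiffAt.comp y hf ((contMDiffAt_chart_symm he hy).of_le hn))

theorem contMDiffAt_comp_chart (hx : x ∈ e.source)
    {k : Plane → ℝ} {n : WithTop ℕ∞} (hn : n ≤ 6) (hk : ContDiffAt ℝ n k (e x)) :
    ContMDiffAt (𝓡 2) 𝓘(ℝ, ℝ) n (fun z ↦ k (e z)) x :=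
  ContMDiffAt.comp x (contMDiffAt_iff_contDiffAt.2 hk) ((contMDiffAt_chart he hx).of_le hn)

end

/-- The smoothness of the evaluation of a one-form on a vector field. -/
theorem ContMDiffAt.oneForm_apply {n : WithTop ℕ∞} {K : OneForm M}
    {X : (x : M) → TangentSpace (𝓡 2) x}
    (hK : ContMDiffAt (𝓡 2) ((𝓡 2).prod 𝓘(ℝ, Plane →L[ℝ] ℝ)) n
      (fun x ↦ Bundle.TotalSpace.mk' (Plane →L[ℝ] ℝ)
        (E := fun x : M ↦ TangentSpace (𝓡 2) x →L[ℝ] Bundle.Trivial M ℝ x) x (K x)) x)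
    (hX : ContMDiffAt (𝓡 2) ((𝓡 2).prod 𝓘(ℝ, Plane)) n
      (fun z ↦ Bundle.TotalSpace.mk' Plane (E := fun z : M ↦ TangentSpace (𝓡 2) z) z (X z)) x) :
    ContMDiffAt (𝓡 2) 𝓘(ℝ, ℝ) n (fun z ↦ K z (X z)) x := by
  have h2 := ContMDiffAt.clm_bundle_apply (F₁ := Plane) (F₂ := ℝ)
    (E₁ := (TangentSpace (𝓡 2) : M → Type _)) (E₂ := Bundle.Trivial M ℝ)
    (b := fun z : M => z) (ϕ := fun z => K z) (v := X) hK hX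
  exact (Bundle.contMDiffAt_totalSpace.1 h2).2

theorem contMDiffAt_coordComp (he : e ∈ atlas Plane M) (hx : x ∈ e.source)
    {n : WithTop ℕ∞} (hn : n ≤ 5) {X : (x : M) → TangentSpace (𝓡 2) x}
    (hX : ContMDiffAt (𝓡 2) ((𝓡 2).prod 𝓘(ℝ, Plane)) n
      (fun z ↦ Bundle.TotalSpace.mk' Plane (E := fun z : M ↦ TangentSpace (𝓡 2) z) z (X z)) x)
    (c : Fin 2) : ContMDiffAt (𝓡 2) 𝓘(ℝ, ℝ) n (fun z ↦ coordComp e z (X z) c) x := by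
  have h := ContMDiffAt.oneForm_apply
    (K := fun z ↦ mvfderiv (𝓡 2) (fun z ↦ e z c) z)
    ((contMDiffAt_mvfderiv (contMDiffAt_chart_apply he hx c)).of_le hn) hX
  refine h.congr_of_eventuallyEq ?_
  filter_upwards [e.open_source.mem_nhds hx] with z hz
  exact (mvfderiv_chart_apply he hz _ c).symm

/-- A vector field of class `C^5` on the domain of a chart agrees near a given point with a global
vector field of class `C^5`. -/
theorem exists_global_vectorField [T2Space M] (he : e ∈ atlas Plane M) (hx : x ∈ e.source)
    {X : (x : M) → TangentSpace (𝓡 2) x}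
    (hX : ∀ z ∈ e.source, ContMDiffAt (𝓡 2) ((𝓡 2).prod 𝓘(ℝ, Plane)) 5
      (fun z ↦ Bundle.TotalSpace.mk' Plane (E := fun z : M ↦ TangentSpace (𝓡 2) z) z (X z)) z) :
    ∃ Y : (x : M) → TangentSpace (𝓡 2) x, (∀ᶠ z in 𝓝 x, Y z = X z) ∧
      ContMDiff (𝓡 2) ((𝓡 2).prod 𝓘(ℝ, Plane)) 5
        (fun z ↦ Bundle.TotalSpace.mk' Plane (E := fun z : M ↦ TangentSpace (𝓡 2) z) z (Y z)) := by
  classical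
  obtain ⟨r, hr, hball⟩ := Metric.nhds_basis_closedBall.mem_iff.1
    (e.open_target.mem_nhds (e.map_source hx))
  let φ : ContDiffBump (e x) := ⟨r / 2, r, by positivity, by linarith⟩
  set ψ : M → ℝ := fun z ↦ if z ∈ e.source then φ (e z) else 0 with hψ
  have hψ1 : ∀ᶠ z in 𝓝 x, ψ z = 1 := by
    filter_upwards [e.open_source.mem_nhds hx,
      (e.continuousAt hx).eventually φ.eventuallyEq_one] with z hz hz1
    simpa [hψ, hz] using hz1
  have hcomp : IsCompact (e.symm '' Metric.closedBall (e x) r) :=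
    (isCompact_closedBall _ _).image_of_continuousOn (e.continuousOn_symm.mono hball)
  refine ⟨ψ • X, hψ1.mono fun z hz ↦ by simp [hz], fun z ↦ ?_⟩
  by_cases hz : z ∈ e.source
  · refine ContMDiffAt.smul_section ?_ (hX z hz)
    have h1 := contMDiffAt_comp_chart he hz (n := 5) (by norm_num) (k := φ) φ.contDiffAt
    refine h1.congr_of_eventuallyEq ?_
    filter_upwards [e.open_source.mem_nhds hz] with z hz
    simp [hψ, hz]
  · have hz' : z ∉ e.symm '' Metric.closedBall (e x) r := by
      rintro ⟨y, hy, rfl⟩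
      exact hz (e.map_target (hball hy))
    refine (Bundle.contMDiff_zeroSection ℝ (TangentSpace (𝓡 2) : M → Type _)).contMDiffAt
      |>.congr_of_eventuallyEq ?_
    filter_upwards [hcomp.isClosed.isOpen_compl.mem_nhds hz'] with u hu
    have hu0 : ψ u = 0 := by
      by_cases hus : u ∈ e.source
      · have : φ (e u) = 0 := φ.zero_of_le_dist (by
          by_contra! hlt
          exact hu ⟨e u, hlt.le, e.left_inv hus⟩)
        simp [hψ, this]
      · simp [hψ, hus]
    simp [hu0, Bundle.zeroSection]

/-- In a chart, a torsion-free connection of class `C^4` and a volume form of class `C^2` are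
given by Christoffel symbols and a density as in `IsGeometryOn`. -/
theorem isGeometryOn_chart [T2Space M] (he : e ∈ atlas Plane M) (cov : AffineConnection M)
    [CovariantDerivative.ContMDiffCovariantDerivative cov 4] (hcov : cov.torsion = 0)
    (ε : VolumeForm M) : IsGeometryOn (christoffel cov e) (ε.comp e) e.target where
  isOpen := e.open_target
  contDiffOn_symbols a b c y hy := by
    have hx := e.map_target hy
    obtain ⟨Y, hY, hYs⟩ := exists_global_vectorField he hx
      fun z hz ↦ contMDiffAt_coordField he hz b
    have h1 := (CovariantDerivative.ContMDiffCovariantDerivative.contMDiff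
      (cov := cov) (k := 4)).contMDiff (σ := Y)
        (by simpa [show (4 : WithTop ℕ∞) + 1 = 5 by norm_num] using hYs.contMDiffOn)
    have h2 := (h1.contMDiffAt Filter.univ_mem (x := e.symm y)).clm_bundle_apply
      ((contMDiffAt_coordField he hx a).of_le (by norm_num))
    have h3 := contMDiffAt_coordComp he hx (by norm_num) h2 c
    refine (contDiffAt_comp_chart_symm he hy (f := fun z ↦
      coordComp e z (cov (coordField e b) z (coordField e a z)) c) (by norm_num)
      (h3.congr_of_eventuallyEq ?_)).contDiffWithinAt
    filter_upwards [hY.eventually_nhds, e.open_source.mem_nhds hx] with z hz hzs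
    have h4 : cov Y z = cov (coordField e b) z :=
      cov.isCovariantDerivativeOn.congr_of_eventuallyEq
        (hYs.contMDiffAt.mdifferentiableAt (by norm_num)) (vectorDiffAt_coordField he hzs b)
        Filter.univ_mem hz
    rw [← h4]
  symm y hy a b c := by
    have hx := e.map_target hy
    have h1 := cov.torsion_eq_zero_iff.1 hcov (vectorDiffAt_coordField he hx a)
      (vectorDiffAt_coordField he hx b)
    have h2 : VectorField.mlieBracket (𝓡 2) (coordField e a) (coordField e b) (e.symm y) = 0 := by
      have hc : ∀ c : Fin 2, ∀ y : Plane, MDifferentiableAt 𝓘(ℝ, Plane) 𝓘(ℝ, Plane).tangent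
          (fun z ↦ Bundle.TotalSpace.mk' Plane (E := fun z : Plane ↦ TangentSpace 𝓘(ℝ, Plane) z) z
            ((NormedSpace.fromTangentSpace (𝕜 := ℝ) z).symm (unitVec c))) y := fun c y ↦
        (contMDiffAt_vectorSpace_iff_contDiffAt (n := 1).2
          contDiffAt_const).mdifferentiableAt one_ne_zero
      have : IsManifold (𝓡 2) (minSmoothness ℝ 2) M := by
        rw [minSmoothness_of_isRCLikeNormedField]; infer_instance
      rw [coordField, coordField, ← VectorField.mpullback_mlieBracket (n := 6) (hc a _) (hc b _)
        (contMDiffAt_chart he hx) (by simp; norm_num)]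
      have h3 : VectorField.mlieBracket 𝓘(ℝ, Plane)
          (fun z : Plane ↦ (NormedSpace.fromTangentSpace (𝕜 := ℝ) z).symm (unitVec a))
          (fun z : Plane ↦ (NormedSpace.fromTangentSpace (𝕜 := ℝ) z).symm (unitVec b)) = 0 := by
        have hf : ∀ c : Fin 2, ∀ z : Plane, fderiv ℝ (fun z : Plane ↦ (unitVec c : Plane)) z = 0 :=
          fun c z ↦ fderiv_const_apply _
        ext1 z
        rw [← VectorField.mlieBracketWithin_univ,
          VectorField.mlieBracketWithin_eq_lieBracketWithin]
        change fderivWithin ℝ (fun z : Plane ↦ (unitVec b : Plane)) Set.univ z (unitVec a) -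
          fderivWithin ℝ (fun z : Plane ↦ (unitVec a : Plane)) Set.univ z (unitVec b) = 0
        simp [hf]
      rw [VectorField.mpullback_apply, h3]
      exact map_zero _
    rw [h2, sub_eq_zero] at h1
    rw [christoffel, christoffel, h1]
  contDiffOn_vol y hy := by
    have hx := e.map_target hy
    have h1 := fun c ↦ (contMDiffAt_coordField he hx c).of_le (n := 5) (m := 2) (by norm_num)
    have h2 := ContMDiffAt.clm_bundle_apply₂ (F₁ := Plane) (F₂ := Plane) (F₃ := ℝ)
      (E₁ := (TangentSpace (𝓡 2) : M → Type _)) (E₂ := (TangentSpace (𝓡 2) : M → Type _))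
      (E₃ := Bundle.Trivial M ℝ) (b := fun z : M => z) (ψ := fun z => ε.form z)
      (ε.contMDiff.contMDiffAt (x := e.symm y)) (h1 0) (h1 1)
    exact (contDiffAt_comp_chart_symm he hy (by norm_num)
      (Bundle.contMDiffAt_totalSpace.1 h2).2).contDiffWithinAt
  vol_ne_zero y hy h0 := by
    have hx := e.map_target hy
    have hw : ε.form (e.symm y) (coordField e 0 (e.symm y)) (coordField e 1 (e.symm y)) = 0 := h0
    have hskew : ∀ u v, ε.form (e.symm y) u v = - ε.form (e.symm y) v u := fun u v ↦ by
      have := ε.skew (e.symm y) (u + v)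
      simp only [map_add, add_apply, ε.skew] at this
      linarith
    apply ε.ne_zero (e.symm y)
    ext u v
    rw [eq_sum_coordField he hx u, eq_sum_coordField he hx v]
    simp [Fin.sum_univ_two, ε.skew, hw, hskew (coordField e 1 _) (coordField e 0 _)]

end Frame

/-! ### Linear first integrals in a chart -/

section Correspondence

variable {M : Type*} [TopologicalSpace M] {e : OpenPartialHomeomorph M Plane} {x : M}
  {U : TopologicalSpace.Opens M}

/-- The part of the chart lying over `U`. -/
def chartDomain (e : OpenPartialHomeomorph M Plane) (U : TopologicalSpace.Opens M) : Set Plane :=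
  e.target ∩ e.symm ⁻¹' U

theorem isOpen_chartDomain : IsOpen (chartDomain e U) :=
  e.isOpen_inter_preimage_symm U.isOpen

theorem map_mem_chartDomain (hx : x ∈ e.source) (hxU : x ∈ U) : e x ∈ chartDomain e U :=
  ⟨e.map_source hx, by simpa [e.left_inv hx] using hxU⟩

variable [ChartedSpace Plane M]

/-- The component `K_a` of a one-form in a chart. -/
def formComp (e : OpenPartialHomeomorph M Plane) (K : OneForm M) (a : Fin 2) (y : Plane) : ℝ :=
  K (e.symm y) (coordField e a (e.symm y))

variable {K : OneForm M}

theorem formComp_apply (hx : x ∈ e.source) (a : Fin 2) :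
    formComp e K a (e x) = K x (coordField e a x) := by
  change (fun z ↦ K z (coordField e a z)) (e.symm (e x)) = _
  rw [e.left_inv hx]

variable [IsManifold (𝓡 2) 6 M] {cov : AffineConnection M}

/-- `(∇_v K)(Y)` at the point `x`, whose symmetric part vanishes for a linear first integral. -/
def covForm (cov : AffineConnection M) (K : OneForm M) (x : M) (v : TangentSpace (𝓡 2) x)
    (Y : (x : M) → TangentSpace (𝓡 2) x) : ℝ :=
  mvfderiv (𝓡 2) (fun z ↦ K z (Y z)) x v - K x (cov Y x v)

/-- `(∇_v K)(Y)` depends only on the value of `Y` at the point. -/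
theorem tensorialAt_covForm (hK : IsC1On K U) (hx : x ∈ U) (v : TangentSpace (𝓡 2) x) :
    TensorialAt (𝓡 2) Plane (covForm cov K x v) x where
  smul {f Y} hf hY := by
    have h : (fun z ↦ K z ((f • Y) z)) = f • fun z ↦ K z (Y z) := by
      ext z; simp
    rw [covForm, covForm, h, mvfderiv_smul hf (hK.mdiffAt U.isOpen hx hY),
      cov.isCovariantDerivativeOn.leibniz (s := Set.univ) hY hf]
    simp
    ring
  add {Y Z} hY hZ := by
    have h : (fun z ↦ K z ((Y + Z) z)) = (fun z ↦ K z (Y z)) + fun z ↦ K z (Z z) := by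
      ext z; simp
    rw [covForm, covForm, covForm, h, mvfderiv_add (hK.mdiffAt U.isOpen hx hY)
      (hK.mdiffAt U.isOpen hx hZ), cov.isCovariantDerivativeOn.add (s := Set.univ) hY hZ]
    simp
    ring

theorem covForm_add (v w : TangentSpace (𝓡 2) x) (Y : (x : M) → TangentSpace (𝓡 2) x) :
    covForm cov K x (v + w) Y = covForm cov K x v Y + covForm cov K x w Y := by
  simp only [covForm, map_add]
  ring

theorem covForm_smul (c : ℝ) (v : TangentSpace (𝓡 2) x) (Y : (x : M) → TangentSpace (𝓡 2) x) :
    covForm cov K x (c • v) Y = c * covForm cov K x v Y := by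
  simp only [covForm, map_smul, smul_eq_mul]
  ring

section

variable (he : e ∈ atlas Plane M)
include he

theorem oneForm_apply_eq_sum (hx : x ∈ e.source) (v : TangentSpace (𝓡 2) x) :
    K x v = ∑ c, coordComp e x v c * formComp e K c (e x) := by
  conv_lhs => rw [eq_sum_coordField he hx v]
  simp [formComp_apply hx]

theorem oneForm_eq_zero_iff (hx : x ∈ e.source) : K x = 0 ↔ ∀ a, formComp e K a (e x) = 0 := by
  constructor
  · intro h a
    simp [formComp_apply hx, h]
  · intro h
    ext v
    simp [oneForm_apply_eq_sum he hx, h]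

theorem contDiffOn_formComp (hK : IsC1On K U) (a : Fin 2) :
    ContDiffOn ℝ 1 (formComp e K a) (chartDomain e U) := by
  rintro y ⟨hy, hyU⟩
  refine (contDiffAt_comp_chart_symm he hy (f := fun z ↦ K z (coordField e a z)) (by norm_num)
    (ContMDiffAt.oneForm_apply ((hK _ hyU).contMDiffAt (U.isOpen.mem_nhds hyU))
      ((contMDiffAt_coordField he (e.map_target hy) a).of_le (by norm_num)))).contDiffWithinAt

/-- `∇_a K_b = ∂_a K_b - Γ_{ab}^c K_c`. -/
theorem covForm_coordField (hK : IsC1On K U) {y : Plane} (hy : y ∈ chartDomain e U) (a b : Fin 2) :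
    covForm cov K (e.symm y) (coordField e a (e.symm y)) (coordField e b) =
      pd a (formComp e K b) y - ∑ c, christoffel cov e a b c y * formComp e K c y := by
  have hx := e.map_target hy.1
  rw [covForm, oneForm_apply_eq_sum (K := K) he hx
    (cov (coordField e b) (e.symm y) (coordField e a (e.symm y))), e.right_inv hy.1]
  congr 1
  exact (pd_comp_chart_symm he hy.1 (f := fun z ↦ K z (coordField e b z))
    (hK.mdiffAt U.isOpen hy.2 (vectorDiffAt_coordField he hx b)) a).symm

/-- The Killing equation on the coordinate frame: the equation for `∂_a + ∂_b` gives the mixed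
components. -/
theorem isKillingComp_formComp [T2Space M]
    [CovariantDerivative.ContMDiffCovariantDerivative cov 4] (hcov : cov.torsion = 0)
    (ε : VolumeForm M) (hK : IsC1On K U) (hKill : IsKillingOn cov K U) :
    IsKillingComp (christoffel cov e) (formComp e K) (chartDomain e U) := by
  intro y hy a b
  have hG := isGeometryOn_chart he cov hcov ε
  have hx := e.map_target hy.1
  have hE := vectorDiffAt_coordField he hx
  have hT := fun v ↦ tensorialAt_covForm (cov := cov) hK hy.2 v
  have hself : ∀ X, VectorDiffAt X (e.symm y) →
      covForm cov K (e.symm y) (X (e.symm y)) X = 0 := fun X hX ↦ hKill _ hy.2 X hX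
  have h1 := hself _ (mdifferentiableAt_add_section (hE a) (hE b))
  rw [Pi.add_apply, (hT _).add (hE a) (hE b), covForm_add, covForm_add, hself _ (hE a),
    hself _ (hE b), covForm_coordField he hK hy, covForm_coordField he hK hy] at h1
  simp only [hG.symm y hy.1 b a] at h1
  linarith

open Classical in
/-- The one-form on `U` with components `k_a` in the chart `e`, extended by zero. -/
def extendForm (e : OpenPartialHomeomorph M Plane) (k : Fin 2 → Plane → ℝ) (U : Set M) :
    OneForm M :=
  fun x ↦ if x ∈ U then ∑ a, k a (e x) • mvfderiv (𝓡 2) (fun z ↦ e z a) x else 0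

theorem formComp_extendForm {k : Fin 2 → Plane → ℝ} {y : Plane}
    (hy : y ∈ chartDomain e U) (a : Fin 2) :
    formComp e (extendForm e k U) a y = k a y := by
  have hx := e.map_target hy.1
  have hyU : e.symm y ∈ (U : Set M) := hy.2
  rw [formComp, extendForm, if_pos hyU, e.right_inv hy.1]
  fin_cases a <;> simp [mvfderiv_chart_apply he hx, coordComp_coordField he hx, delta]

variable {k : Fin 2 → Plane → ℝ} (hU : (U : Set M) ⊆ e.source)
include hU

theorem isC1On_extendForm (hk : ∀ a, ContDiffOn ℝ 1 (k a) (chartDomain e U)) :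
    IsC1On (extendForm e k U) U := by
  intro x hx
  have hxs := hU hx
  have h1 : ContMDiffAt (𝓡 2) ((𝓡 2).prod 𝓘(ℝ, Plane →L[ℝ] ℝ)) 1
      (fun x ↦ Bundle.TotalSpace.mk' (Plane →L[ℝ] ℝ)
        (E := fun x : M ↦ TangentSpace (𝓡 2) x →L[ℝ] Bundle.Trivial M ℝ x) x
        (∑ a : Fin 2, k a (e x) • mvfderiv (𝓡 2) (fun z ↦ e z a) x)) x := by
    refine ContMDiffAt.sum_section fun a _ ↦ ?_
    refine ContMDiffAt.smul_section (f := fun x ↦ k a (e x)) ?_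
      ((contMDiffAt_mvfderiv (contMDiffAt_chart_apply he hxs a)).of_le (by norm_num))
    exact contMDiffAt_comp_chart he hxs (by norm_num)
      ((hk a).contDiffAt (isOpen_chartDomain.mem_nhds (map_mem_chartDomain hxs hx)))
  refine (h1.congr_of_eventuallyEq ?_).contMDiffWithinAt
  filter_upwards [U.isOpen.mem_nhds hx] with z hz
  simp [extendForm, show z ∈ (U : Set M) from hz]

/-- Solutions of the Killing equation in a chart are linear first integrals. -/
theorem extendForm_mem_firstIntegrals (hk : ∀ a, ContDiffOn ℝ 1 (k a) (chartDomain e U))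
    (hKill : IsKillingComp (christoffel cov e) k (chartDomain e U))
    (hsymm : ∀ y ∈ e.target, ∀ a b c, christoffel cov e a b c y = christoffel cov e b a c y) :
    extendForm e k U ∈ firstIntegrals cov U := by
  have hC := isC1On_extendForm he hU hk
  refine ⟨hC, ?_, fun x hx ↦ if_neg hx⟩
  intro x hx X hX
  have hxs := hU hx
  have hyU := map_mem_chartDomain hxs hx
  have hT := fun v ↦ tensorialAt_covForm (cov := cov) hC hx v
  have hE := fun c ↦ vectorDiffAt_coordField he hxs c
  set c := coordComp e x (X x) with hc
  have hcE : ∀ i, VectorDiffAt (c i • coordField e i) x := fun i ↦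
    (hE i).smul_const_section
  have hXx : X x = (c 0 • coordField e 0 + c 1 • coordField e 1) x := by
    conv_lhs => rw [eq_sum_coordField he hxs (X x)]
    simp [Fin.sum_univ_two, hc]
  have hsm : ∀ v i, covForm cov (extendForm e k U) x v (c i • coordField e i) =
      c i * covForm cov (extendForm e k U) x v (coordField e i) := fun v i ↦
    (hT v).smul (f := fun _ ↦ c i) mdifferentiableAt_const (hE i)
  have hQ : ∀ a b, covForm cov (extendForm e k U) x (coordField e a x) (coordField e b) =
      pd a (k b) (e x) - ∑ c, christoffel cov e a b c (e x) * k c (e x) := by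
    intro a b
    have h1 := covForm_coordField (cov := cov) he hC hyU a b
    rw [e.left_inv hxs] at h1
    rw [h1, pd_congr_of_eqOn isOpen_chartDomain
      (fun z hz ↦ formComp_extendForm he hz b) hyU]
    simp only [formComp_extendForm he hyU]
  change covForm cov (extendForm e k U) x (X x) X = 0
  rw [(hT _).pointwise hX (mdifferentiableAt_add_section (hcE 0) (hcE 1)) hXx,
    (hT _).add (hcE 0) (hcE 1), hsm, hsm, hXx]
  simp only [Pi.add_apply, Pi.smul_apply, covForm_add, covForm_smul, hQ]
  have hK := hKill _ hyU
  have hs := hsymm _ (e.map_source hxs)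
  have h00 := hK 0 0
  have h01 := hK 0 1
  have h11 := hK 1 1
  simp only [Fin.sum_univ_two] at h00 h01 h11 ⊢
  rw [hs 1 0, hs 1 0]
  linear_combination c 0 ^ 2 / 2 * h00 + c 0 * c 1 * h01 + c 1 ^ 2 / 2 * h11

end

end Correspondence

/-! ### Unique continuation and the dimension of the space of linear first integrals -/

section Dimension

variable {M : Type*} [TopologicalSpace M] [T2Space M] [ChartedSpace Plane M]
  [IsManifold (𝓡 2) 6 M] {e : OpenPartialHomeomorph M Plane} {x : M} {cov : AffineConnection M}
  {U : TopologicalSpace.Opens M} {K : OneForm M}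

/-- The section `(K_1, K_2, μ)` of the prolongation bundle attached to a one-form, in a chart. -/
def formSection (cov : AffineConnection M) (ε : VolumeForm M) (e : OpenPartialHomeomorph M Plane)
    (K : OneForm M) : Plane → Fin 3 → ℝ :=
  killingSection (christoffel cov e) (ε.comp e) (formComp e K)

variable [CovariantDerivative.ContMDiffCovariantDerivative cov 4]
  (hcov : cov.torsion = 0) (ε : VolumeForm M)
include hcov

theorem isGeometryOn_chartDomain (he : e ∈ atlas Plane M) :
    IsGeometryOn (christoffel cov e) (ε.comp e) (chartDomain e U) :=
  (isGeometryOn_chart he cov hcov ε).mono isOpen_chartDomain Set.inter_subset_left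

theorem isParallelOn_formSection (he : e ∈ atlas Plane M) (hK : K ∈ firstIntegrals cov U) :
    IsParallelOn (prolong (christoffel cov e) (ε.comp e)) (formSection cov ε e K)
      (chartDomain e U) :=
  (isGeometryOn_chartDomain hcov ε he).isParallelOn_killingSection (contDiffOn_formComp he hK.1)
    (isKillingComp_formComp he hcov ε hK.1 hK.2.1)

/-- A linear first integral vanishes near a point if and only if its prolongation vanishes there. -/
theorem eventually_eq_zero_iff (he : e ∈ atlas Plane M) (hK : K ∈ firstIntegrals cov U)
    (hx : x ∈ e.source) (hxU : x ∈ U) :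
    (∀ᶠ z in 𝓝 x, K z = 0) ↔ formSection cov ε e K (e x) = 0 := by
  constructor
  · intro h
    have hc : Filter.Tendsto e.symm (𝓝 (e x)) (𝓝 x) := by
      simpa only [e.left_inv hx] using (e.symm.continuousAt (e.map_source hx)).tendsto
    have h0 : ∀ a, formComp e K a =ᶠ[𝓝 (e x)] fun _ ↦ 0 := fun a ↦ by
      filter_upwards [hc.eventually h] with y hy
      simp [formComp, hy]
    have h1 : pd 0 (formComp e K 1) (e x) = 0 := by rw [pd_congr (h0 1), pd_const]
    ext i
    fin_cases i <;> simp [formSection, killingSection, h1, (h0 0).self_of_nhds,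
      (h0 1).self_of_nhds]
  · intro h
    have hG := isGeometryOn_chartDomain (U := U) hcov ε he
    have h0 := (isParallelOn_formSection hcov ε he hK).eventually_eq_zero hG.isOpen
      hG.contDiffOn_prolong (map_mem_chartDomain hx hxU) h
    filter_upwards [(e.continuousAt hx).eventually h0, e.open_source.mem_nhds hx] with z hz hzs
    refine (oneForm_eq_zero_iff he hzs).2 fun a ↦ ?_
    fin_cases a
    exacts [congrFun hz 0, congrFun hz 1]

/-- Unique continuation: a linear first integral on a connected open set is determined by the
value of its prolongation at one point. -/
theorem eq_zero_of_formSection_eq_zero (hU : IsPreconnected (U : Set M)) (he : e ∈ atlas Plane M)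
    (hK : K ∈ firstIntegrals cov U) (hx : x ∈ e.source) (hxU : x ∈ U)
    (h : formSection cov ε e K (e x) = 0) : K = 0 := by
  have hsub : (U : Set M) ⊆ {z | ∀ᶠ w in 𝓝 z, K w = 0} := by
    refine hU.subset_of_closure_inter_subset isOpen_setOfPred_eventually_nhds
      ⟨x, hxU, (eventually_eq_zero_iff hcov ε he hK hx hxU).2 h⟩ ?_
    rintro z ⟨hz, hzU⟩
    have he' := chart_mem_atlas Plane z
    have hzs := mem_chart_source Plane z
    refine (eventually_eq_zero_iff hcov ε he' hK hzs hzU).2 ?_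
    by_contra hne
    have hG := isGeometryOn_chartDomain (U := U) hcov ε he'
    have hc : ContinuousAt (formSection cov ε (chartAt Plane z) K) (chartAt Plane z z) :=
      continuousAt_pi.2 fun i ↦ ((isParallelOn_formSection hcov ε he' hK).contDiffOn
        i).continuousOn.continuousAt (hG.isOpen.mem_nhds (map_mem_chartDomain hzs hzU))
    have hev : ∀ᶠ v in 𝓝 z, formSection cov ε (chartAt Plane z) K (chartAt Plane z v) ≠ 0 ∧
        v ∈ (chartAt Plane z).source ∧ v ∈ U :=
      ((hc.comp ((chartAt Plane z).continuousAt hzs)).tendsto.eventually_ne hne).and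
        (((chartAt Plane z).open_source.eventually_mem hzs).and (U.isOpen.eventually_mem hzU))
    obtain ⟨v, ⟨hv1, hv2, hv3⟩, hv⟩ := mem_closure_iff_nhds.1 hz _ hev
    exact hv1 ((eventually_eq_zero_iff hcov ε he' hK hv2 hv3).1 hv)
  ext1 z
  by_cases hz : z ∈ U
  · exact (hsub hz).self_of_nhds
  · exact hK.2.2 z hz

/-- The value at a point of the prolongation of a linear first integral, as a linear map. -/
def jetMap (he : e ∈ atlas Plane M) (hx : x ∈ e.source) (hxU : x ∈ U) :
    firstIntegrals cov U →ₗ[ℝ] LinearMap.ker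
      (mulOp (rowsV (christoffel cov e) (ε.comp e) (e x))).toLinearMap :=
  LinearMap.codRestrict _
    { toFun K := formSection cov ε e K (e x)
      map_add' K L := by
        have hd := fun (K : firstIntegrals cov U) a ↦ (contDiffOn_formComp he K.2.1 a).diffAt
          isOpen_chartDomain one_ne_zero (map_mem_chartDomain hx hxU)
        have h : ∀ a, formComp e (K + L : OneForm M) a =
          fun y ↦ formComp e (K : OneForm M) a y + formComp e (L : OneForm M) a y := fun a ↦ rfl
        ext i
        fin_cases i
        · rfl
        · rfl
        · simp only [formSection, killingSection, Submodule.coe_add, h,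
            pd_add (hd K 1) (hd L 1), Fin.sum_univ_two]
          simp
          ring
      map_smul' c K := by
        have hd := (contDiffOn_formComp he K.2.1 1).diffAt
          isOpen_chartDomain one_ne_zero (map_mem_chartDomain hx hxU)
        have h : ∀ a, formComp e (c • K : OneForm M) a =
          fun y ↦ c * formComp e (K : OneForm M) a y := fun a ↦ rfl
        ext i
        fin_cases i
        · rfl
        · rfl
        · simp only [formSection, killingSection, Submodule.coe_smul, h,
            pd_const_mul c hd, Fin.sum_univ_two]
          simp
          ring }
    fun K ↦ (isGeometryOn_chartDomain hcov ε he).rowsV_mulVec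
      (isParallelOn_formSection hcov ε he K.2) (map_mem_chartDomain hx hxU)

theorem jetMap_injective (hU : IsPreconnected (U : Set M)) (he : e ∈ atlas Plane M)
    (hx : x ∈ e.source) (hxU : x ∈ U) : Function.Injective (jetMap hcov ε he hx hxU) := by
  refine (injective_iff_map_eq_zero _).2 fun K hK ↦ Subtype.ext ?_
  exact eq_zero_of_formSection_eq_zero hcov ε hU he K.2 hx hxU (congrArg Subtype.val hK)

theorem finrank_firstIntegrals_le (hU : IsPreconnected (U : Set M)) (he : e ∈ atlas Plane M)
    (hx : x ∈ e.source) (hxU : x ∈ U) : Module.finrank ℝ (firstIntegrals cov U) ≤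
      3 - (rowsV (christoffel cov e) (ε.comp e) (e x)).rank :=
  (LinearMap.finrank_le_finrank_of_injective (jetMap_injective hcov ε hU he hx hxU)).trans_eq
    (finrank_ker_mulOp_rowsV _)

/-- Every parallel section of the prolongation connection over a subset of a chart comes from a
linear first integral. -/
theorem exists_firstIntegral_of_isParallelOn (he : e ∈ atlas Plane M)
    (hUe : (U : Set M) ⊆ e.source) {Ψ : Plane → Fin 3 → ℝ}
    (hΨ : IsParallelOn (prolong (christoffel cov e) (ε.comp e)) Ψ (chartDomain e U)) :
    ∃ K ∈ firstIntegrals cov U, ∀ y ∈ chartDomain e U, formSection cov ε e K y = Ψ y := by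
  have hG := isGeometryOn_chartDomain (U := U) hcov ε he
  refine ⟨extendForm e ![fun y ↦ Ψ y 0, fun y ↦ Ψ y 1] U,
    extendForm_mem_firstIntegrals he hUe (fun a ↦ ?_) (hG.isKillingComp_of_isParallelOn hΨ)
      (isGeometryOn_chart he cov hcov ε).symm, fun y hy ↦ ?_⟩
  · fin_cases a
    exacts [hΨ.contDiffOn 0, hΨ.contDiffOn 1]
  · rw [← hG.killingSection_of_isParallelOn hΨ hy, formSection, killingSection, killingSection,
      pd_congr_of_eqOn isOpen_chartDomain (fun z hz ↦ formComp_extendForm he hz 1) hy]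
    simp only [formComp_extendForm he hy]

/-- If all solutions of the algebraic equations at a point extend to parallel sections, the
dimension of the space of linear first integrals is the corank of these equations. -/
theorem finrank_firstIntegrals_eq (hU : IsPreconnected (U : Set M)) (he : e ∈ atlas Plane M)
    (hx : x ∈ e.source) (hxU : x ∈ U) (hUe : (U : Set M) ⊆ e.source)
    (h : ∀ x₀, (rowsV (christoffel cov e) (ε.comp e) (e x)).mulVec x₀ = 0 →
      ∃ Ψ, IsParallelOn (prolong (christoffel cov e) (ε.comp e)) Ψ (chartDomain e U) ∧
        Ψ (e x) = x₀) :
    Module.finrank ℝ (firstIntegrals cov U) =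
      3 - (rowsV (christoffel cov e) (ε.comp e) (e x)).rank := by
  rw [← finrank_ker_mulOp_rowsV]
  refine (LinearEquiv.ofBijective _ ⟨jetMap_injective hcov ε hU he hx hxU, fun x₀ ↦ ?_⟩).finrank_eq
  obtain ⟨Ψ, hΨ, h0⟩ := h x₀ x₀.2
  obtain ⟨K, hK, hKΨ⟩ := exists_firstIntegral_of_isParallelOn hcov ε he hUe hΨ
  exact ⟨⟨K, hK⟩, Subtype.ext ((hKΨ _ (map_mem_chartDomain hx hxU)).trans h0)⟩

/-- A nonzero linear first integral on a connected open set has a nonzero prolongation at every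
point, which solves the algebraic equations there. -/
theorem invariants_vanish (hU : IsPreconnected (U : Set M))
    (h : firstIntegrals cov U ≠ ⊥) : InvNVanishes cov ε U ∧ InvSVanishes cov ε U := by
  obtain ⟨K, hK, hK0⟩ := (Submodule.ne_bot_iff _).1 h
  have key : ∀ e ∈ atlas Plane M, ∀ y ∈ e.target, e.symm y ∈ U → formSection cov ε e K y ≠ 0 := by
    intro e he y hy hyU h0
    rw [← e.right_inv hy] at h0
    exact hK0 (eq_zero_of_formSection_eq_zero hcov ε hU he hK (e.map_target hy) hyU h0)
  constructor <;> intro e he y hy hyU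
  · have hG := isGeometryOn_chartDomain (U := U) hcov ε he
    exact hG.invN_eq_zero_of_mulVec ⟨hy, hyU⟩ (key e he y hy hyU)
      (hG.rowsV_mulVec (isParallelOn_formSection hcov ε he hK) ⟨hy, hyU⟩)
  · exact (isGeometryOn_chartDomain (U := U) hcov ε he).invS_eq_zero_of_isParallelOn
      (isParallelOn_formSection hcov ε he hK) ⟨hy, hyU⟩ (key e he y hy hyU)

end Dimension

/-! ### Regular points -/

section LocalRank

variable {Γ : Symbols} {w : Plane → ℝ} {O : Set Plane} {y : Plane}

namespace IsGeometryOn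

variable (hG : IsGeometryOn Γ w O) (hy : y ∈ O)
include hG hy

/-- The rank is lower semicontinuous. -/
theorem eventually_rank_le : ∀ᶠ z in 𝓝 y, (rowsV Γ w y).rank ≤ (rowsV Γ w z).rank := by
  have hc : ContinuousAt (fun z ↦ mulOp (rowsV Γ w z)) y :=
    (contDiffOn_mulOp hG.contDiffOn_rowsV).continuousOn.continuousAt (hG.isOpen.mem_nhds hy)
  have hr : ∀ z, (rowsV Γ w z).rank =
      Module.finrank ℝ (LinearMap.range (mulOp (rowsV Γ w z)).toLinearMap) := fun _ ↦ rfl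
  have := hc.eventually_mem ((_root_.isOpen_setOfPred_nat_le_rank
    (𝕜 := ℝ) (E := Fin 3 → ℝ) (F := Fin 3 → ℝ) (rowsV Γ w y).rank).mem_nhds
      (by rw [hr]; exact (Module.finrank_eq_rank _ _).le))
  filter_upwards [this] with z hz
  rw [hr z]
  exact_mod_cast (Module.finrank_eq_rank ℝ _).ge.trans' hz

theorem eventually_beta_ne_zero (h : beta Γ w y ≠ 0) : ∀ᶠ z in 𝓝 y, beta Γ w z ≠ 0 :=
  ((hG.contDiffOn_secV 2).continuousOn.continuousAt (hG.isOpen.mem_nhds hy)).eventually_ne h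

end IsGeometryOn

end LocalRank

section Regular

variable {M : Type*} [TopologicalSpace M] [T2Space M] [ChartedSpace Plane M]
  [IsManifold (𝓡 2) 6 M] {e : OpenPartialHomeomorph M Plane} {p : M} {cov : AffineConnection M}
  [CovariantDerivative.ContMDiffCovariantDerivative cov 4]
  (hcov : cov.torsion = 0) (ε : VolumeForm M)

omit [CovariantDerivative.ContMDiffCovariantDerivative cov 4] [T2Space M] in
theorem isOpen_regularAt : IsOpen {p | RegularAt cov ε p} := by
  refine isOpen_iff_eventually.2 ?_
  rintro p ⟨e, he, hp, h⟩
  filter_upwards [(e.continuousAt hp).eventually (h.eventually_nhds.and h),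
    e.open_source.eventually_mem hp] with z hz hzs
  exact ⟨e, he, hzs, hz.1.mono fun y hy ↦ hy.trans hz.2.symm⟩

include hcov

theorem regularAt_of_rank_rowsV (he : e ∈ atlas Plane M) (hp : p ∈ e.source) {r : ℕ}
    (h : ∀ᶠ y in 𝓝 (e p), (rowsV (christoffel cov e) (ε.comp e) y).rank = r) :
    RegularAt cov ε p := by
  have hG := isGeometryOn_chart he cov hcov ε
  refine ⟨e, he, hp, ?_⟩
  filter_upwards [h, hG.isOpen.eventually_mem (e.map_source hp)] with y hy hyO
  rw [← hG.rank_rowsV hyO, ← hG.rank_rowsV (e.map_source hp), hy, h.self_of_nhds]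

/-- A point at which the rank is maximal among nearby points is regular. -/
theorem dense_regularAt : Dense {p | RegularAt cov ε p} := by
  refine dense_iff_inter_open.2 ?_
  rintro W hW ⟨p, hp⟩
  set e := chartAt Plane p
  have he := chart_mem_atlas Plane p
  have hG := isGeometryOn_chartDomain (U := ⟨W, hW⟩) hcov ε he
  set r := fun y ↦ (rowsV (christoffel cov e) (ε.comp e) y).rank with hr
  have hfin : (r '' chartDomain e ⟨W, hW⟩).Finite := by
    refine (Set.finite_Iic 3).subset ?_
    rintro _ ⟨y, -, rfl⟩
    exact Matrix.rank_le_card_width _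
  obtain ⟨y, hy, hmax⟩ := Set.Finite.exists_maximalFor' r _ hfin
    ⟨e p, map_mem_chartDomain (mem_chart_source Plane p) hp⟩
  refine ⟨e.symm y, hy.2, regularAt_of_rank_rowsV hcov ε he (e.map_target hy.1) (r := r y) ?_⟩
  rw [e.right_inv hy.1]
  filter_upwards [hG.eventually_rank_le hy, hG.isOpen.eventually_mem hy] with z hz hzO
  exact (hmax hzO hz).antisymm hz

end Regular

/-! ### Adapted neighbourhoods -/

section Adapted

open scoped Matrix

variable {M : Type*} [TopologicalSpace M] [T2Space M] [ChartedSpace Plane M]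
  [IsManifold (𝓡 2) 6 M]

/-- `U` is a connected neighbourhood of `p` in the domain of the chart `e`, so small that the local
existence theorems for parallel sections of the prolongation connection apply on all of `U`. -/
structure IsAdapted (cov : AffineConnection M) (ε : VolumeForm M)
    (e : OpenPartialHomeomorph M Plane) (p : M) (U : TopologicalSpace.Opens M) : Prop where
  mem_atlas : e ∈ atlas Plane M
  mem : p ∈ U
  isPreconnected : IsPreconnected (U : Set M)
  subset_source : (U : Set M) ⊆ e.source
  exists_of_secV : (∀ y ∈ chartDomain e U, secV (christoffel cov e) (ε.comp e) y = 0) →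
    ∀ x₀, ∃ Ψ, IsParallelOn (prolong (christoffel cov e) (ε.comp e)) Ψ (chartDomain e U) ∧
      Ψ (e p) = x₀
  rank_eq : RegularAt cov ε p → ∀ y ∈ chartDomain e U,
    (rowsV (christoffel cov e) (ε.comp e) y).rank =
      (rowsV (christoffel cov e) (ε.comp e) (e p)).rank
  exists_of_regular : RegularAt cov ε p →
    (∀ y ∈ chartDomain e U, secV (christoffel cov e) (ε.comp e) y ≠ 0 →
      ∀ x, rowsV (christoffel cov e) (ε.comp e) y *ᵥ x = 0 →
        ∀ b c, ∑ i, secDDV (christoffel cov e) (ε.comp e) b c y i * x i = 0) →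
    ∀ x₀, rowsV (christoffel cov e) (ε.comp e) (e p) *ᵥ x₀ = 0 →
      ∃ Ψ, IsParallelOn (prolong (christoffel cov e) (ε.comp e)) Ψ (chartDomain e U) ∧
        Ψ (e p) = x₀

/-- Every point has arbitrarily small adapted neighbourhoods: coordinate squares. -/
theorem exists_isAdapted {cov : AffineConnection M}
    [CovariantDerivative.ContMDiffCovariantDerivative cov 4] (hcov : cov.torsion = 0)
    (ε : VolumeForm M) (p : M) {W : Set M} (hW : W ∈ 𝓝 p) :
    ∃ (e : OpenPartialHomeomorph M Plane) (U : TopologicalSpace.Opens M),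
      (U : Set M) ⊆ W ∧ IsAdapted cov ε e p U := by
  obtain ⟨e, he, hp, δ₃, h₃, H₃⟩ : ∃ e ∈ atlas Plane M, p ∈ e.source ∧ ∃ δ₃ > 0, ∀ δ, 0 < δ →
      δ ≤ δ₃ → RegularAt cov ε p → (∀ y ∈ sq (e p) δ,
        (rowsV (christoffel cov e) (ε.comp e) y).rank =
          (rowsV (christoffel cov e) (ε.comp e) (e p)).rank) ∧
      ((∀ y ∈ sq (e p) δ, secV (christoffel cov e) (ε.comp e) y ≠ 0 →
        ∀ x, rowsV (christoffel cov e) (ε.comp e) y *ᵥ x = 0 →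
          ∀ b c, ∑ i, secDDV (christoffel cov e) (ε.comp e) b c y i * x i = 0) →
      ∀ x₀, rowsV (christoffel cov e) (ε.comp e) (e p) *ᵥ x₀ = 0 →
        ∃ Ψ, IsParallelOn (prolong (christoffel cov e) (ε.comp e)) Ψ (sq (e p) δ) ∧
          Ψ (e p) = x₀) := by
    by_cases h : RegularAt cov ε p
    · obtain ⟨e, he, hp, h⟩ := h
      have hG := isGeometryOn_chart he cov hcov ε
      obtain ⟨δ₃, h₃, H₃⟩ := hG.exists_isParallelOn_of_rank_eq (e.map_source hp) <| by
        filter_upwards [h, hG.isOpen.eventually_mem (e.map_source hp)] with y hy hyO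
        rw [hG.rank_rowsV hyO, hG.rank_rowsV (e.map_source hp), hy]
      exact ⟨e, he, hp, δ₃, h₃, fun δ hδ hle _ ↦ (H₃ δ hδ hle).2⟩
    · exact ⟨_, chart_mem_atlas Plane p, mem_chart_source Plane p, 1, one_pos,
        fun _ _ _ h' ↦ (h h').elim⟩
  have hG := isGeometryOn_chart he cov hcov ε
  have hN : e.target ∩ e.symm ⁻¹' W ∈ 𝓝 (e p) := by
    refine Filter.inter_mem (e.open_target.mem_nhds (e.map_source hp)) ?_
    refine (e.symm.continuousAt (e.map_source hp)).preimage_mem_nhds ?_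
    rwa [e.left_inv hp]
  obtain ⟨δ₁, h₁, H₁⟩ := exists_sq_subset hN
  obtain ⟨δ₂, h₂, H₂⟩ := hG.exists_isParallelOn_of_secV_eq_zero (e.map_source hp)
  obtain ⟨δ, hδ, l₁, l₂, l₃⟩ : ∃ δ > 0, δ ≤ δ₁ ∧ δ ≤ δ₂ ∧ δ ≤ δ₃ :=
    ⟨min δ₁ (min δ₂ δ₃), by positivity, by simp, by simp, by simp⟩
  have hsub := H₁ δ l₁
  set U : TopologicalSpace.Opens M :=
    ⟨e.source ∩ e ⁻¹' sq (e p) δ, e.isOpen_inter_preimage (isOpen_sq _ _)⟩ with hU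
  have hUsq : chartDomain e U = sq (e p) δ := by
    ext y
    constructor
    · rintro ⟨hy, -, hyU⟩
      simpa [e.right_inv hy] using hyU
    · intro hy
      have hyt := (hsub hy).1
      exact ⟨hyt, e.map_target hyt, by simpa [e.right_inv hyt] using hy⟩
  have hUim : (U : Set M) = e.symm '' sq (e p) δ := by
    rw [e.symm_image_eq_source_inter_preimage fun y hy ↦ (hsub hy).1]
    rfl
  refine ⟨e, U, ?_, he, ⟨hp, mem_sq_self _ hδ⟩, ?_, Set.inter_subset_left, ?_, ?_, ?_⟩
  · rw [hUim]
    rintro _ ⟨y, hy, rfl⟩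
    exact (hsub hy).2
  · rw [hUim]
    exact (convex_sq _ _).isPreconnected.image _
      (e.symm.continuousOn.mono fun y hy ↦ (hsub hy).1)
  · rw [hUsq]
    exact (H₂ δ hδ l₂).2
  · rw [hUsq]
    exact fun h ↦ (H₃ δ hδ l₃ h).1
  · rw [hUsq]
    exact fun h ↦ (H₃ δ hδ l₃ h).2

end Adapted

/-! ### Counting linear first integrals on an adapted neighbourhood -/

section Counting

open scoped Matrix

variable {M : Type*} [TopologicalSpace M] [T2Space M] [ChartedSpace Plane M]
  [IsManifold (𝓡 2) 6 M] {e : OpenPartialHomeomorph M Plane} {p : M} {cov : AffineConnection M}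
  [CovariantDerivative.ContMDiffCovariantDerivative cov 4] {U : TopologicalSpace.Opens M}
  (hcov : cov.torsion = 0) (ε : VolumeForm M)
include hcov

theorem ricciSymmAt_of_beta {x : M}
    (h : ∀ e ∈ atlas Plane M, x ∈ e.source → beta (christoffel cov e) (ε.comp e) (e x) = 0) :
    RicciSymmAt cov x := fun e he hx ↦
  ((isGeometryOn_chart he cov hcov ε).beta_eq_zero_iff (e.map_source hx)).1 (h e he hx)

theorem beta_eq_zero_of_ricciSymmAt (h : ∀ x ∈ U, RicciSymmAt cov x) (he : e ∈ atlas Plane M)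
    {y : Plane} (hy : y ∈ chartDomain e U) : beta (christoffel cov e) (ε.comp e) y = 0 := by
  refine ((isGeometryOn_chartDomain hcov ε he).beta_eq_zero_iff hy).2 ?_
  simpa only [e.right_inv hy.1] using h _ hy.2 e he (e.map_target hy.1)

/-- With `k` independent linear first integrals, the rank is at most `3 - k` at every point. -/
theorem rank_rowsV_le (hU : IsPreconnected (U : Set M)) (he : e ∈ atlas Plane M) {y : Plane}
    (hy : y ∈ chartDomain e U) : (rowsV (christoffel cov e) (ε.comp e) y).rank ≤
      3 - Module.finrank ℝ (firstIntegrals cov U) := by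
  have h := finrank_firstIntegrals_le hcov ε hU he (e.map_target hy.1) hy.2
  rw [e.right_inv hy.1] at h
  have h3 : (rowsV (christoffel cov e) (ε.comp e) y).rank ≤ 3 := Matrix.rank_le_card_width _
  omega

theorem secV_eq_zero_of_finrank (hU : IsPreconnected (U : Set M))
    (h : Module.finrank ℝ (firstIntegrals cov U) = 3) (he : e ∈ atlas Plane M) {y : Plane}
    (hy : y ∈ chartDomain e U) : secV (christoffel cov e) (ε.comp e) y = 0 :=
  secV_eq_zero_of_rank (by have := rank_rowsV_le hcov ε hU he hy; omega)

include ε in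
theorem ricciSymmAt_of_finrank (hU : IsPreconnected (U : Set M))
    (h : Module.finrank ℝ (firstIntegrals cov U) = 3) : ∀ x ∈ U, RicciSymmAt cov x := fun _ hxU ↦
  ricciSymmAt_of_beta hcov ε fun _ he hx ↦
    congrFun (secV_eq_zero_of_finrank hcov ε hU h he (map_mem_chartDomain hx hxU)) 2

include ε in
theorem projFlatOn_of_finrank (hU : IsPreconnected (U : Set M))
    (h : Module.finrank ℝ (firstIntegrals cov U) = 3) : ProjFlatOn cov U := by
  intro e he y hy hyU
  obtain ⟨O, hO, hyO, hsub, H⟩ := (isGeometryOn_chartDomain (U := U) hcov ε he).exists_projChange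
    ⟨hy, hyU⟩ fun z hz ↦ secV_eq_zero_of_finrank hcov ε hU h he hz
  exact ⟨O, hO, hyO, hsub.trans Set.inter_subset_left, H⟩

namespace IsAdapted

variable {ε} (hA : IsAdapted cov ε e p U)
include hA

omit hcov in
omit [CovariantDerivative.ContMDiffCovariantDerivative cov 4] [T2Space M] in
theorem mem_source : p ∈ e.source := hA.subset_source hA.mem

omit hcov in
omit [CovariantDerivative.ContMDiffCovariantDerivative cov 4] [T2Space M] in
theorem map_mem : e p ∈ chartDomain e U := map_mem_chartDomain hA.mem_source hA.mem

theorem finrank_eq_three (h : ∀ y ∈ chartDomain e U, secV (christoffel cov e) (ε.comp e) y = 0) :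
    Module.finrank ℝ (firstIntegrals cov U) = 3 := by
  have hV : ∀ᶠ z in 𝓝 (e p), secV (christoffel cov e) (ε.comp e) z = 0 :=
    (isOpen_chartDomain.eventually_mem hA.map_mem).mono h
  have h0 : rowsV (christoffel cov e) (ε.comp e) (e p) = 0 := by
    ext i j
    fin_cases i
    exacts [congrFun hV.self_of_nhds j, congrFun (secDV_eq_zero hV 0) j,
      congrFun (secDV_eq_zero hV 1) j]
  rw [finrank_firstIntegrals_eq hcov ε hA.isPreconnected hA.mem_atlas hA.mem_source hA.mem
    hA.subset_source fun x₀ _ ↦ hA.exists_of_secV h x₀, h0, Matrix.rank_zero]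

theorem finrank_eq_of_rank_le_one (hreg : RegularAt cov ε p)
    (h : (rowsV (christoffel cov e) (ε.comp e) (e p)).rank ≤ 1) :
    Module.finrank ℝ (firstIntegrals cov U) =
      3 - (rowsV (christoffel cov e) (ε.comp e) (e p)).rank :=
  finrank_firstIntegrals_eq hcov ε hA.isPreconnected hA.mem_atlas hA.mem_source hA.mem
    hA.subset_source <| hA.exists_of_regular hreg fun _ hy hV _ hx ↦
      (isGeometryOn_chartDomain hcov ε hA.mem_atlas).secDDV_pairing_of_rank_le_one hy
        ((isOpen_chartDomain.eventually_mem hy).mono fun z hz ↦ (hA.rank_eq hreg z hz).trans_le h)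
        hV hx

theorem ne_bot_of_invariants (hreg : RegularAt cov ε p) (hN : InvNVanishes cov ε U)
    (hS : InvSVanishes cov ε U) : firstIntegrals cov U ≠ ⊥ := by
  have hG := isGeometryOn_chartDomain (U := U) hcov ε hA.mem_atlas
  have hy := hA.map_mem
  obtain ⟨x₀, hne, hx₀⟩ := Matrix.exists_mulVec_eq_zero_iff.2
    ((hG.det_rowsV hy).trans (hN e hA.mem_atlas _ hy.1 hy.2))
  obtain ⟨Ψ, hΨ, h0⟩ := hA.exists_of_regular hreg (fun y hy hV x hx ↦ by
    rcases le_or_gt (rowsV (christoffel cov e) (ε.comp e) y).rank 1 with h | h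
    · refine hG.secDDV_pairing_of_rank_le_one hy ?_ hV hx
      filter_upwards [isOpen_chartDomain.eventually_mem hy] with z hz
      rwa [hA.rank_eq hreg z hz, ← hA.rank_eq hreg y hy]
    · exact hG.secDDV_pairing_of_invS hy h hV (hS e hA.mem_atlas y hy.1 hy.2) hx) x₀ hx₀
  obtain ⟨K, hK, hKΨ⟩ := exists_firstIntegral_of_isParallelOn hcov ε hA.mem_atlas
    hA.subset_source hΨ
  refine (Submodule.ne_bot_iff _).2 ⟨K, hK, fun hK0 ↦ hne ?_⟩
  rw [← h0, ← hKΨ _ hy]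
  exact (eventually_eq_zero_iff hcov ε hA.mem_atlas hK hA.mem_source hA.mem).1
    (Filter.Eventually.of_forall fun z ↦ by rw [hK0]; rfl)

/-- If `T = 0` and the Ricci tensor is symmetric then `V = 0`. -/
theorem finrank_eq_three_of_tensT (hT : TensTVanishes cov ε U)
    (hβ : ∀ y ∈ chartDomain e U, beta (christoffel cov e) (ε.comp e) y = 0) :
    Module.finrank ℝ (firstIntegrals cov U) = 3 :=
  hA.finrank_eq_three hcov fun y hy ↦ (isGeometryOn_chartDomain hcov ε
    hA.mem_atlas).secV_eq_zero_of_tensT hy (hT e hA.mem_atlas y hy.1 hy.2)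
      ((isOpen_chartDomain.eventually_mem hy).mono hβ)

theorem tensTVanishes_of_finrank (h : Module.finrank ℝ (firstIntegrals cov U) = 2) :
    TensTVanishes cov ε U ∧ ∃ x ∈ U, ¬ RicciSymmAt cov x := by
  have hT : TensTVanishes cov ε U := fun e' he' y hy hyU ↦
    (isGeometryOn_chartDomain (U := U) hcov ε he').tensT_eq_zero_of_rank ⟨hy, hyU⟩
      (by have := rank_rowsV_le hcov ε hA.isPreconnected he' ⟨hy, hyU⟩; omega)
  refine ⟨hT, ?_⟩
  by_contra! hsymm
  have := hA.finrank_eq_three_of_tensT hcov hT fun y hy ↦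
    beta_eq_zero_of_ricciSymmAt hcov ε hsymm hA.mem_atlas hy
  omega

theorem finrank_eq_two (hreg : RegularAt cov ε p) (hT : TensTVanishes cov ε U)
    (hskew : ∃ x ∈ U, ¬ RicciSymmAt cov x) :
    Module.finrank ℝ (firstIntegrals cov U) = 2 := by
  have h3 : Module.finrank ℝ (firstIntegrals cov U) ≠ 3 := fun h ↦ by
    obtain ⟨x, hxU, hx⟩ := hskew
    exact hx (ricciSymmAt_of_finrank hcov ε hA.isPreconnected h x hxU)
  obtain ⟨y, hy, hβ⟩ : ∃ y ∈ chartDomain e U, beta (christoffel cov e) (ε.comp e) y ≠ 0 := by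
    by_contra! h
    exact h3 (hA.finrank_eq_three_of_tensT hcov hT h)
  have hrank := (isGeometryOn_chartDomain hcov ε hA.mem_atlas).rank_le_one_of_tensT hy
    (hT e hA.mem_atlas y hy.1 hy.2) hβ
  rw [hA.rank_eq hreg y hy] at hrank
  have := hA.finrank_eq_of_rank_le_one hcov hreg hrank
  omega

omit hA in
/-- Where `T = 0` and the Ricci tensor is not symmetric, the rank is one. -/
theorem _root_.SurfaceConnection.regularAt_of_tensT (hT : TensTVanishes cov ε U) (hp : p ∈ U)
    (h : ¬ RicciSymmAt cov p) : RegularAt cov ε p := by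
  obtain ⟨e, he, hpe, hβ⟩ : ∃ e ∈ atlas Plane M, p ∈ e.source ∧
      beta (christoffel cov e) (ε.comp e) (e p) ≠ 0 := by
    by_contra! h'
    exact h (ricciSymmAt_of_beta hcov ε h')
  have hG := isGeometryOn_chartDomain (U := U) hcov ε he
  have hy := map_mem_chartDomain hpe hp
  refine regularAt_of_rank_rowsV hcov ε he hpe (r := 1) ?_
  filter_upwards [hG.eventually_beta_ne_zero hy hβ, hG.isOpen.eventually_mem hy] with z hz hzO
  have h1 := hG.rank_le_one_of_tensT hzO (hT e he z hzO.1 hzO.2) hz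
  have h0 : (rowsV (christoffel cov e) (ε.comp e) z).rank ≠ 0 := fun h0 ↦
    hz (congrFun (secV_eq_zero_of_rank h0) 2)
  omega

theorem finrank_eq_three_of_projFlatOn (hflat : ProjFlatOn cov U)
    (hsymm : ∀ x ∈ U, RicciSymmAt cov x) : Module.finrank ℝ (firstIntegrals cov U) = 3 := by
  refine hA.finrank_eq_three hcov fun y hy ↦ ?_
  obtain ⟨O, hO, hyO, -, Υ, hΥ, hR⟩ := hflat e hA.mem_atlas y hy.1 hy.2
  have hG := isGeometryOn_chartDomain (U := U) hcov ε hA.mem_atlas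
  refine (hG.mono (hO.inter hG.isOpen) Set.inter_subset_right).secV_eq_zero_of_projChange
    (fun z hz ↦ (hG.beta_eq_zero_iff hz.2).1
      (beta_eq_zero_of_ricciSymmAt hcov ε hsymm hA.mem_atlas hz.2))
    (fun a ↦ (hΥ a).mono Set.inter_subset_left) (fun z hz ↦ hR z hz.1) ⟨hyO, hy⟩

end IsAdapted

end Counting

end SurfaceConnection

end

theorem theorem1 {M : Type*} [TopologicalSpace M] [T2Space M]
    [ChartedSpace SurfaceConnection.Plane M] [IsManifold (𝓡 2) 6 M]
    (cov : SurfaceConnection.AffineConnection M)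
    [CovariantDerivative.ContMDiffCovariantDerivative cov 4]
    (hcov : cov.torsion = 0) (ε : SurfaceConnection.VolumeForm M) :
    -- necessity of `I_N = I_S = 0`
    (∀ U : TopologicalSpace.Opens M, IsPreconnected (U : Set M) →
      SurfaceConnection.firstIntegrals cov U ≠ ⊥ →
        SurfaceConnection.InvNVanishes cov ε U ∧ SurfaceConnection.InvSVanishes cov ε U) ∧
    -- the regular points form a dense open set
    (IsOpen {p | SurfaceConnection.RegularAt cov ε p} ∧
      Dense {p | SurfaceConnection.RegularAt cov ε p}) ∧
    -- every point has arbitrarily small connected neighbourhoods `U` such that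
    (∀ (p : M), ∀ W ∈ 𝓝 p, ∃ U : TopologicalSpace.Opens M,
      p ∈ U ∧ (U : Set M) ⊆ W ∧ IsConnected (U : Set M) ∧
      -- sufficiency of `I_N = I_S = 0`
      (SurfaceConnection.RegularAt cov ε p →
        SurfaceConnection.InvNVanishes cov ε U → SurfaceConnection.InvSVanishes cov ε U →
          SurfaceConnection.firstIntegrals cov U ≠ ⊥) ∧
      -- precisely two independent first integrals
      (Module.finrank ℝ (SurfaceConnection.firstIntegrals cov U) = 2 →
        SurfaceConnection.TensTVanishes cov ε U ∧
          ∃ x ∈ U, ¬ SurfaceConnection.RicciSymmAt cov x) ∧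
      (SurfaceConnection.TensTVanishes cov ε U →
        (∀ x ∈ U, ¬ SurfaceConnection.RicciSymmAt cov x) →
          Module.finrank ℝ (SurfaceConnection.firstIntegrals cov U) = 2) ∧
      (SurfaceConnection.RegularAt cov ε p →
        (Module.finrank ℝ (SurfaceConnection.firstIntegrals cov U) = 2 ↔
          SurfaceConnection.TensTVanishes cov ε U ∧
            ∃ x ∈ U, ¬ SurfaceConnection.RicciSymmAt cov x)) ∧
      -- three independent first integrals
      (Module.finrank ℝ (SurfaceConnection.firstIntegrals cov U) = 3 ↔
        SurfaceConnection.ProjFlatOn cov U ∧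
          ∀ x ∈ U, SurfaceConnection.RicciSymmAt cov x)) := by
  refine ⟨fun U hU h ↦ SurfaceConnection.invariants_vanish hcov ε hU h,
    ⟨SurfaceConnection.isOpen_regularAt ε, SurfaceConnection.dense_regularAt hcov ε⟩,
    fun p W hW ↦ ?_⟩
  obtain ⟨e, U, hUW, hA⟩ := SurfaceConnection.exists_isAdapted hcov ε p hW
  exact ⟨U, hA.mem, hUW, ⟨⟨p, hA.mem⟩, hA.isPreconnected⟩, hA.ne_bot_of_invariants hcov,
    hA.tensTVanishes_of_finrank hcov,
    fun hT h ↦ hA.finrank_eq_two hcov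
      (SurfaceConnection.regularAt_of_tensT hcov hT hA.mem (h p hA.mem)) hT ⟨p, hA.mem, h p hA.mem⟩,
    fun hreg ↦ ⟨hA.tensTVanishes_of_finrank hcov, fun h ↦ hA.finrank_eq_two hcov hreg h.1 h.2⟩,
    fun h ↦ ⟨SurfaceConnection.projFlatOn_of_finrank hcov ε hA.isPreconnected h,
      SurfaceConnection.ricciSymmAt_of_finrank hcov ε hA.isPreconnected h⟩,
    fun h ↦ hA.finrank_eq_three_of_projFlatOn hcov h.1 h.2⟩
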